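/- Let $n\ge2$ and let $\mathbb M=\mathbb M^n=\{z\in\mathbb C^{n+1}: z\cdot z=0,\ z\ne0,\ |z|<1\}$ be the unit ball of the Kepler manifold, where $z\cdot z=\sum_j z_j^2$; it is an $n$-dimensional complex manifold. Let $$\alpha=(n+1)\frac{(-1)^{j-1}}{z_j}\,dz_1\wedge\dots\wedge\widehat{dz_j}\wedge\dots\wedge dz_{n+1}\quad\text{on } z_j\ne0,\qquad d\rho=\frac{\alpha\wedge\overline\alpha}{(-1)^{n(n+1)/2}(2i)^n},\qquad c_{\mathbb M}=(n-1)\int_{\mathbb M}d\rho .$$ Then $0<c_{\mathbb M}<\infty$. Let $f:(0,1)\to(0,\infty)$ be twice continuously differentiable and such that, for $u(z)=f(|z|^2)$, the function $\log\frac1u$ is strictly plurisubharmonic on $\mathbb M$ (its Levi form is positive definite at every point). Put $$\phi(t)=W[f](t)=(-1)^n\,t\,(f')^{n-1}\bigl(ff'+tff''-t(f')^2\bigr),\qquad c_k=\int_0^1t^k\phi(t)\,dt,\qquad N(k)=\binom{k+n-1}{n-1}+\binom{k+n-2}{n-1}.$$ Then $\phi>0$ on $(0,1)$, so that $c_k\in(0,\infty]$.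 Let $\bigwedge^n(\frac i2\partial\overline\partial\log\frac1u)$ denote the volume element which in local holomorphic coordinates $\zeta_1,\dots,\zeta_n$ equals $\det\bigl[\frac{\partial^2\log(1/u)}{\partial\zeta_k\partial\overline{\zeta_l}}\bigr](\frac i2)^n d\zeta_1\wedge d\overline{\zeta_1}\wedge\dots\wedge d\zeta_n\wedge d\overline{\zeta_n}$. Then the space of all holomorphic functions on $\mathbb M$ that are square integrable with respect to $u^{n+1}\bigwedge^n(\frac i2\partial\overline\partial\log\frac1u)$ has a reproducing kernel $K$, and for all $z\in\mathbb M$ $$K(z,z)=\frac{(n+1)^2}{c_{\mathbb M}}\sum_{k=0}^\infty\frac{N(k)}{c_{k+n-2}}\,|z|^{2k},$$ where the series converges and $1/\infty=0$ is understood for infinite moments. -/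

import Mathlib

noncomputable section

namespace Kepler

open MeasureTheory
open scoped ComplexOrder

/-- The squared Euclidean norm `|z|² = ∑ |z_i|²` on `ℂ^(n+1)`. -/
def normSq {n : ℕ} (z : Fin (n + 1) → ℂ) : ℝ := ∑ i, ‖z i‖ ^ 2

/-- The unit ball `𝕄ⁿ` of the Kepler manifold: nonzero `z ∈ ℂ^(n+1)` with `z · z = 0` (bilinear
product) and `|z| < 1`. -/
def ball (n : ℕ) : Set (Fin (n + 1) → ℂ) :=
  {z | ∑ i, z i ^ 2 = 0 ∧ z ≠ 0 ∧ normSq z < 1}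

/-! ### Local holomorphic coordinates

Where `z_j ≠ 0`, the remaining `n` coordinates `Z = (z_i)_{i ≠ j}` are local holomorphic coordinates
on the Kepler manifold, and `z_j` is one of the two square roots of `-(Z · Z)`. -/

/-- The `n` coordinates of `p` other than the `j`-th one. -/
def coord {n : ℕ} (j : Fin (n + 1)) (p : Fin (n + 1) → ℂ) : Fin n → ℂ := j.removeNth p

/-- For a point `p` of the Kepler manifold with `p_j ≠ 0`, the inverse, near `coord j p`, of the
chart `coord j` around `p`. The principal square root is taken near `1`, so that this is holomorphic
in `Z` near `coord j p`, squares to `-(Z · Z)` in the `j`-th place, and takes the value `p` at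
`coord j p`. -/
def localParam {n : ℕ} (j : Fin (n + 1)) (p : Fin (n + 1) → ℂ) (Z : Fin n → ℂ) :
    Fin (n + 1) → ℂ :=
  j.insertNth (α := fun _ => ℂ) (p j * ((∑ i, Z i ^ 2) / (-(p j) ^ 2)) ^ (1 / 2 : ℂ)) Z

/-- `g` is holomorphic on the complex manifold `𝕄ⁿ`: complex differentiable at every point in the
local coordinates. (Values of `g` off `𝕄ⁿ` play no role.) -/
def IsHolomorphic (n : ℕ) (g : (Fin (n + 1) → ℂ) → ℂ) : Prop :=
  ∀ p ∈ ball n, ∀ j, p j ≠ 0 → DifferentiableAt ℂ (fun Z => g (localParam j p Z)) (coord j p)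

/-! ### Complex Hessians and plurisubharmonicity -/

/-- The Wirtinger derivative `∂F/∂z_k = (∂F/∂x_k - i ∂F/∂y_k) / 2`. -/
def dz {n : ℕ} (k : Fin n) (F : (Fin n → ℂ) → ℂ) (Z : Fin n → ℂ) : ℂ :=
  (fderiv ℝ F Z (Pi.single k 1) - Complex.I * fderiv ℝ F Z (Pi.single k Complex.I)) / 2

/-- The Wirtinger derivative `∂F/∂z̄_k = (∂F/∂x_k + i ∂F/∂y_k) / 2`. -/
def dzbar {n : ℕ} (k : Fin n) (F : (Fin n → ℂ) → ℂ) (Z : Fin n → ℂ) : ℂ :=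
  (fderiv ℝ F Z (Pi.single k 1) + Complex.I * fderiv ℝ F Z (Pi.single k Complex.I)) / 2

/-- The complex Hessian `(∂²h / ∂z_k ∂z̄_l)_{k,l}` of a real-valued function on `ℂⁿ`. -/
def complexHessian {n : ℕ} (h : (Fin n → ℂ) → ℝ) (Z : Fin n → ℂ) : Matrix (Fin n) (Fin n) ℂ :=
  Matrix.of fun k l => dz k (dzbar l (fun Y => (h Y : ℂ))) Z

/-- The matrix of `∂∂̄Φ` at the point `p`, in the coordinates `coord j`. -/
def leviMatrix {n : ℕ} (Φ : (Fin (n + 1) → ℂ) → ℝ) (j : Fin (n + 1)) (p : Fin (n + 1) → ℂ) :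
    Matrix (Fin n) (Fin n) ℂ :=
  complexHessian (fun Z => Φ (localParam j p Z)) (coord j p)

/-- A (twice continuously differentiable) function `Φ` is strictly plurisubharmonic on `𝕄ⁿ`: its
Levi form is positive definite at every point. -/
def IsStrictlyPSH (n : ℕ) (Φ : (Fin (n + 1) → ℂ) → ℝ) : Prop :=
  ∀ p ∈ ball n, ∀ j, p j ≠ 0 → (leviMatrix Φ j p).PosDef

/-! ### Measures of volume forms -/

/-- The points of `𝕄ⁿ` whose last nonvanishing coordinate is the `j`-th. These sets form a Borel
partition of `𝕄ⁿ`, the `j`-th one lying in the domain of the `j`-th chart. -/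
def piece (n : ℕ) (j : Fin (n + 1)) : Set (Fin (n + 1) → ℂ) :=
  {z | z ∈ ball n ∧ z j ≠ 0 ∧ ∀ i, j < i → z i = 0}

/-- The two points with given coordinates `Z` in the `j`-th chart, indexed by `s`. -/
def sheet {n : ℕ} (j : Fin (n + 1)) (s : Fin 2) (Z : Fin n → ℂ) : Fin (n + 1) → ℂ :=
  j.insertNth (α := fun _ => ℂ) ((-1) ^ (s : ℕ) * (-∑ i, Z i ^ 2) ^ (1 / 2 : ℂ)) Z

/-- The measure on `𝕄ⁿ` (extended by zero to `ℂ^(n+1)`) defined by a nonnegative volume form which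
is given in the `j`-th chart by
`D j · (i/2)ⁿ dZ_1 ∧ dZ̄_1 ∧ ⋯ ∧ dZ_n ∧ dZ̄_n = D j · Lebesgue measure`, for each `j`. -/
def formMeasure (n : ℕ) (D : Fin (n + 1) → (Fin (n + 1) → ℂ) → ℝ) :
    Measure (Fin (n + 1) → ℂ) :=
  ∑ j : Fin (n + 1), ∑ s : Fin 2,
    (((volume : Measure (Fin n → ℂ)).restrict {Z | sheet j s Z ∈ piece n j}).withDensity
      (fun Z => ENNReal.ofReal (D j (sheet j s Z)))).map (sheet j s)

/-- The coefficient of the holomorphic `n`-form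
`α = (n+1) (-1)^(j-1) / z_j  dz_1 ∧ ⋯ ∧ (omit dz_j) ∧ ⋯ ∧ dz_(n+1)` in the `j`-th chart
(with `j` counted from `0` in the code). -/
def alphaCoeff (n : ℕ) (j : Fin (n + 1)) (z : Fin (n + 1) → ℂ) : ℂ :=
  (n + 1) * ((-1) ^ (j : ℕ) / z j)

/-- The measure `dρ = α ∧ ᾱ / ((-1)^(n(n+1)/2) (2i)ⁿ)` on `𝕄ⁿ`. For `α = a dZ_1 ∧ ⋯ ∧ dZ_n` this
form is `|a|² (i/2)ⁿ dZ_1 ∧ dZ̄_1 ∧ ⋯ ∧ dZ_n ∧ dZ̄_n`. -/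
def rho (n : ℕ) : Measure (Fin (n + 1) → ℂ) :=
  formMeasure n fun j z => ‖alphaCoeff n j z‖ ^ 2

/-- The constant `c_𝕄 = (n - 1) ∫_𝕄 dρ`. -/
def cM (n : ℕ) : ℝ := ((n : ℝ) - 1) * (rho n).real (ball n)

/-- The measure `u^(n+1) ∧ⁿ (i/2 ∂∂̄ log(1/u))` on `𝕄ⁿ`. Here `∧ⁿ ω` for `ω = i/2 ∂∂̄Φ` is the
volume element of the metric, which in local coordinates is
`det(∂²Φ/∂z_k∂z̄_l) (i/2)ⁿ dz_1 ∧ dz̄_1 ∧ ⋯ ∧ dz_n ∧ dz̄_n` (without a factor `n!`). -/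
def weightMeasure (n : ℕ) (u : (Fin (n + 1) → ℂ) → ℝ) : Measure (Fin (n + 1) → ℂ) :=
  formMeasure n fun j z =>
    u z ^ (n + 1) * (leviMatrix (fun w => Real.log (1 / u w)) j z).det.re

/-! ### Weighted Bergman spaces and kernels -/

/-- Membership in the weighted Bergman space `L²_hol(𝕄ⁿ, ν)`. -/
def MemBergman (n : ℕ) (ν : Measure (Fin (n + 1) → ℂ)) (g : (Fin (n + 1) → ℂ) → ℂ) : Prop :=
  IsHolomorphic n g ∧ MemLp g 2 ν

/-- `K` is the reproducing kernel of `L²_hol(𝕄ⁿ, ν)`: every `K(·, y)` belongs to the space and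
`g(y) = ⟨g, K(·, y)⟩` for every `g` in the space. -/
def IsBergmanKernel (n : ℕ) (ν : Measure (Fin (n + 1) → ℂ))
    (K : (Fin (n + 1) → ℂ) → (Fin (n + 1) → ℂ) → ℂ) : Prop :=
  (∀ y ∈ ball n, MemBergman n ν fun x => K x y) ∧
    ∀ g, MemBergman n ν g → ∀ y ∈ ball n, g y = ∫ x, g x * starRingEnd ℂ (K x y) ∂ν

/-! ### The series -/

/-- `W[f] = (-1)ⁿ t f'^(n-1) (f f' + t f f'' - t f'²)`. -/
def W (n : ℕ) (f : ℝ → ℝ) (t : ℝ) : ℝ :=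
  (-1) ^ n * t * deriv f t ^ (n - 1) *
    (f t * deriv f t + t * f t * deriv (deriv f) t - t * deriv f t ^ 2)

/-- The moments `∫_0^1 t^k φ(t) dt ∈ [0, ∞]` of a nonnegative function `φ` on `(0, 1)`. -/
def moment (φ : ℝ → ℝ) (k : ℕ) : ENNReal :=
  ∫⁻ t in Set.Ioo (0 : ℝ) 1, ENNReal.ofReal (t ^ k * φ t)

/-- `N(k) = C(k+n-1, n-1) + C(k+n-2, n-1)` (used for `n ≥ 2`). -/
def N (n k : ℕ) : ℕ := (k + n - 1).choose (n - 1) + (k + n - 2).choose (n - 1)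

/-- The `k`-th term `N(k) / c_(k+n-2) · t^k` of the series, with `c_k` the moments of `W[f]`
and `1/∞ = 0`. -/
def term (n : ℕ) (f : ℝ → ℝ) (t : ℝ) (k : ℕ) : ℝ :=
  (N n k : ℝ) * ((moment (W n f) (k + n - 2))⁻¹).toReal * t ^ k

end Kepler

end

/-! ### The two sheets over the last chart and the invariant measure -/

noncomputable section
namespace Kepler
open MeasureTheory
open scoped ComplexOrder ENNReal

/-! Over the set where the last coordinate `w` does not vanish, the ball is a two-sheeted cover, `w`
being a square root of `-(Z · Z)`. Up to null sets only this chart matters, and every volume form in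
question is a density times `mu`, which is Lebesgue measure over `|Z · Z|` on each sheet; thus `rho`
is `(n + 1)² mu`. For a function of `|z|²` the complex Hessian is a multiple of the identity plus a
matrix of rank two, so its determinant is explicit (`det_radialHessian`) and the weight becomes
`W[f](|z|²) mu` (`weightMeasure_eq`). Positivity of `W[f]` is positivity of that determinant.

The kernel is then computed degree by degree.

Radial integration. Dilating the ball shows how `mu` scales, so for functions of degree `k` the norm
for the weight is the norm for `mu` times the square root of `gam`, where `gam = (k + n - 1)
c_(k+n-2)` (`lintegral_mu_radial`, `gam_density`).

Dimension. A holomorphic function of degree `k` on the ball extends to the cone. Its even part in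
`w`, and that of its product with `w`, are entire of polynomial growth in each variable, hence
polynomials in `Z`. This gives the form `A(Z) + w B(Z)` (`exists_eq_add_mul`), and counting
monomials gives dimension `N(k)`.

Symmetry. Real reflections preserve `mu` (`lintegral_mu_refl`) and act transitively, through
products, on the levels of `|z|²`. Hence the diagonal of the degree `k` kernel for `mu` is a
constant times `|z|^(2k)`, and its integral, the dimension `N(k)`, fixes the constant (`diag_eq`).
The factor `k + n - 1` found there cancels the one in `gam`, which leaves `N(k) / c_(k+n-2)`.

Completeness. Averaging over the circle action splits any holomorphic function into homogeneous
components (`hasSum_comp`). Those of negative degree vanish, by a Hartogs type argument. Averaging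
does not increase the weighted norm, so a component of a square integrable function must vanish when
the moment of its degree is infinite, which is the convention `1/∞ = 0`. Lower bounds for the
moments make the series of kernels converge locally uniformly and in `L²`, so its sum reproduces;
the reproducing property determines the diagonal of any other kernel. -/

/-- The quadratic form `Z · Z`. -/
def quad {n : ℕ} (Z : Fin n → ℂ) : ℂ := ∑ i, Z i ^ 2

/-- The principal square root of `-(Z · Z)`. -/
def root {n : ℕ} (Z : Fin n → ℂ) : ℂ := (-quad Z) ^ (1 / 2 : ℂ)

/-- The point with first coordinates `Z` and last coordinate `w`. -/
def pt {n : ℕ} (Z : Fin n → ℂ) (w : ℂ) : Fin (n + 1) → ℂ := Fin.snoc (α := fun _ => ℂ) Z w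

@[simp] lemma pt_last {n : ℕ} (Z : Fin n → ℂ) (w : ℂ) : pt Z w (Fin.last n) = w := by
  simp [pt]

@[simp] lemma pt_castSucc {n : ℕ} (Z : Fin n → ℂ) (w : ℂ) (i : Fin n) :
    pt Z w i.castSucc = Z i := by
  simp [pt]

lemma pt_init {n : ℕ} (z : Fin (n + 1) → ℂ) :
    pt (fun i => z i.castSucc) (z (Fin.last n)) = z := by
  ext i
  refine Fin.lastCases ?_ (fun i => ?_) i <;> simp

lemma sheet_last {n : ℕ} (s : Fin 2) (Z : Fin n → ℂ) :
    sheet (Fin.last n) s Z = pt Z ((-1) ^ (s : ℕ) * root Z) := by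
  simp [sheet, pt, root, quad, Fin.insertNth_last']

lemma root_sq {n : ℕ} (Z : Fin n → ℂ) : root Z ^ 2 = -quad Z := by
  unfold root
  rw [one_div]
  exact_mod_cast Complex.cpow_nat_inv_pow (-quad Z) two_ne_zero

lemma norm_root_sq {n : ℕ} (Z : Fin n → ℂ) : ‖root Z‖ ^ 2 = ‖quad Z‖ := by
  rw [← norm_pow, root_sq, norm_neg]

lemma root_eq_zero {n : ℕ} (Z : Fin n → ℂ) : root Z = 0 ↔ quad Z = 0 := by
  rw [← pow_eq_zero_iff two_ne_zero, root_sq, neg_eq_zero]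

lemma eq_or_eq_neg_root {n : ℕ} {Z : Fin n → ℂ} {w : ℂ} (h : w ^ 2 = -quad Z) :
    w = root Z ∨ w = -root Z := by
  rw [← root_sq] at h
  exact sq_eq_sq_iff_eq_or_eq_neg.1 h

lemma sum_sq_pt {n : ℕ} (Z : Fin n → ℂ) (w : ℂ) : ∑ i, pt Z w i ^ 2 = quad Z + w ^ 2 := by
  simp [Fin.sum_univ_castSucc, quad]

lemma normSq_pt {n : ℕ} (Z : Fin n → ℂ) (w : ℂ) :
    normSq (pt Z w) = ∑ i, ‖Z i‖ ^ 2 + ‖w‖ ^ 2 := by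
  simp [normSq, Fin.sum_univ_castSucc]

lemma continuous_normSq {n : ℕ} : Continuous (normSq (n := n)) := by
  unfold normSq; fun_prop

lemma continuous_quad {n : ℕ} : Continuous (quad (n := n)) := by
  unfold quad; fun_prop

lemma normSq_nonneg {n : ℕ} (z : Fin (n + 1) → ℂ) : 0 ≤ normSq z :=
  Finset.sum_nonneg fun _ _ => by positivity

lemma normSq_eq_zero {n : ℕ} {z : Fin (n + 1) → ℂ} : normSq z = 0 ↔ z = 0 := by
  unfold normSq
  rw [Finset.sum_eq_zero_iff_of_nonneg (fun _ _ => by positivity)]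
  simp [funext_iff]

lemma normSq_pos {n : ℕ} {z : Fin (n + 1) → ℂ} (h : z ≠ 0) : 0 < normSq z :=
  (normSq_nonneg z).lt_of_ne fun h' => h (normSq_eq_zero.1 h'.symm)

lemma normSq_mem_Ioo {n : ℕ} {z : Fin (n + 1) → ℂ} (h : z ∈ ball n) :
    normSq z ∈ Set.Ioo (0 : ℝ) 1 := ⟨normSq_pos h.2.1, h.2.2⟩

lemma normSq_smul {n : ℕ} (c : ℂ) (z : Fin (n + 1) → ℂ) :
    normSq (c • z) = ‖c‖ ^ 2 * normSq z := by
  simp [normSq, mul_pow, Finset.mul_sum]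

lemma sum_sq_smul {n : ℕ} (c : ℂ) (z : Fin n → ℂ) :
    ∑ i, (c • z) i ^ 2 = c ^ 2 * ∑ i, z i ^ 2 := by
  simp [mul_pow, Finset.mul_sum]

lemma smul_mem_ball {n : ℕ} {c : ℂ} {z : Fin (n + 1) → ℂ} (hz : z ∈ ball n) (hc : c ≠ 0)
    (h : ‖c‖ ^ 2 * normSq z < 1) : c • z ∈ ball n := by
  refine ⟨by rw [sum_sq_smul, hz.1, mul_zero], smul_ne_zero hc hz.2.1, by rwa [normSq_smul]⟩

lemma smul_mem_ball_of_le {n : ℕ} {c : ℂ} {z : Fin (n + 1) → ℂ} (hz : z ∈ ball n) (hc : c ≠ 0)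
    (h : ‖c‖ ≤ 1) : c • z ∈ ball n := by
  refine smul_mem_ball hz hc (lt_of_le_of_lt ?_ hz.2.2)
  exact mul_le_of_le_one_left (normSq_nonneg z) (pow_le_one₀ (norm_nonneg _) h)

/-- The domain in `ℂⁿ` over which the two sheets of the ball lie. -/
def baseSet (n : ℕ) : Set (Fin n → ℂ) :=
  {Z | quad Z ≠ 0 ∧ ∑ i, ‖Z i‖ ^ 2 + ‖quad Z‖ < 1}

lemma isOpen_baseSet (n : ℕ) : IsOpen (baseSet n) :=
  (isOpen_ne_fun continuous_quad continuous_const).inter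
    (isOpen_lt (f := fun Z : Fin n → ℂ => ∑ i, ‖Z i‖ ^ 2 + ‖quad Z‖) (g := fun _ => 1)
      (by have := continuous_quad (n := n); fun_prop) continuous_const)

lemma measurableSet_ball (n : ℕ) : MeasurableSet (ball n) := by
  have h1 : IsClosed {z : Fin (n + 1) → ℂ | ∑ i, z i ^ 2 = 0} :=
    isClosed_eq (by fun_prop) continuous_const
  have h2 : IsOpen {z : Fin (n + 1) → ℂ | z ≠ 0} := isOpen_ne
  have h3 : IsOpen {z : Fin (n + 1) → ℂ | normSq z < 1} :=
    isOpen_lt continuous_normSq continuous_const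
  exact h1.measurableSet.inter (h2.measurableSet.inter h3.measurableSet)

lemma pt_mem_ball {n : ℕ} {Z : Fin n → ℂ} {w : ℂ} (hZ : Z ∈ baseSet n) (hw : w ^ 2 = -quad Z) :
    pt Z w ∈ ball n := by
  refine ⟨by rw [sum_sq_pt, hw, add_neg_cancel], fun h => hZ.1 ?_, ?_⟩
  · have : w = 0 := by simpa using congrFun h (Fin.last n)
    rw [this] at hw
    simpa using hw.symm
  · rw [normSq_pt, ← norm_pow, hw, norm_neg]
    exact hZ.2

lemma sheet_last_sq {n : ℕ} (s : Fin 2) (Z : Fin n → ℂ) :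
    ((-1) ^ (s : ℕ) * root Z) ^ 2 = -quad Z := by
  rw [mul_pow, root_sq, ← pow_mul, mul_comm (s : ℕ), pow_mul]
  simp

lemma normSq_sheet_last {n : ℕ} (s : Fin 2) (Z : Fin n → ℂ) :
    normSq (sheet (Fin.last n) s Z) = ∑ i, ‖Z i‖ ^ 2 + ‖quad Z‖ := by
  rw [sheet_last, normSq_pt, ← norm_pow, sheet_last_sq, norm_neg]

lemma sheet_last_mem_ball {n : ℕ} (s : Fin 2) {Z : Fin n → ℂ} (hZ : Z ∈ baseSet n) :
    sheet (Fin.last n) s Z ∈ ball n := by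
  rw [sheet_last]
  exact pt_mem_ball hZ (sheet_last_sq s Z)

lemma norm_sheet_last_last {n : ℕ} (s : Fin 2) (Z : Fin n → ℂ) :
    ‖sheet (Fin.last n) s Z (Fin.last n)‖ ^ 2 = ‖quad Z‖ := by
  rw [sheet_last, pt_last, ← norm_pow, sheet_last_sq, norm_neg]

lemma sheet_last_mem_piece {n : ℕ} (s : Fin 2) :
    {Z : Fin n → ℂ | sheet (Fin.last n) s Z ∈ piece n (Fin.last n)} = baseSet n := by
  ext Z
  have key := norm_sheet_last_last s Z
  constructor
  · rintro ⟨h1, h2, -⟩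
    refine ⟨fun h => h2 ?_, ?_⟩
    · rw [h, norm_zero] at key
      simpa using key
    · rw [← normSq_sheet_last s]
      exact h1.2.2
  · intro h
    refine ⟨sheet_last_mem_ball s h, fun h2 => h.1 ?_, fun i hi => absurd hi (Fin.le_last i).not_gt⟩
    rw [h2] at key
    simpa using key.symm

lemma measurable_root {n : ℕ} : Measurable (root (n := n)) := by
  unfold root
  exact (continuous_quad.measurable.neg).pow_const _

lemma measurable_pt {n : ℕ} {w : (Fin n → ℂ) → ℂ} (hw : Measurable w) :
    Measurable fun Z => pt Z (w Z) := by
  refine measurable_pi_lambda _ fun i => ?_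
  refine Fin.lastCases ?_ (fun i => ?_) i
  · simpa using hw
  · simpa using measurable_pi_apply i

lemma measurable_sheet_last {n : ℕ} (s : Fin 2) :
    Measurable (sheet (Fin.last n) s) := by
  have : sheet (Fin.last n) s = fun Z => pt Z ((-1) ^ (s : ℕ) * root Z) :=
    funext fun Z => sheet_last s Z
  rw [this]
  exact measurable_pt (measurable_root.const_mul _)

/-- Lebesgue measure weighted by `1 / |Z · Z|` below the ball. -/
def baseMeasure (n : ℕ) : Measure (Fin n → ℂ) :=
  (volume.restrict (baseSet n)).withDensity fun Z => ENNReal.ofReal (1 / ‖quad Z‖)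

/-- The invariant measure on the ball, `rho` without the factor `(n + 1)²`. -/
def mu (n : ℕ) : Measure (Fin (n + 1) → ℂ) :=
  ∑ s : Fin 2, (baseMeasure n).map (sheet (Fin.last n) s)

lemma measurable_inv_quad {n : ℕ} :
    Measurable fun Z : Fin n → ℂ => ENNReal.ofReal (1 / ‖quad Z‖) := by
  have := (continuous_quad (n := n)).measurable
  fun_prop

lemma lintegral_baseMeasure {n : ℕ} {h : (Fin n → ℂ) → ℝ≥0∞} (hh : Measurable h) :
    ∫⁻ Z, h Z ∂(baseMeasure n) =
      ∫⁻ Z in baseSet n, ENNReal.ofReal (1 / ‖quad Z‖) * h Z := by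
  rw [baseMeasure, lintegral_withDensity_eq_lintegral_mul _ measurable_inv_quad hh]
  rfl

lemma lintegral_mu {n : ℕ} {h : (Fin (n + 1) → ℂ) → ℝ≥0∞} (hh : Measurable h) :
    ∫⁻ z, h z ∂(mu n) = ∫⁻ Z in baseSet n, ENNReal.ofReal (1 / ‖quad Z‖) *
      (h (pt Z (root Z)) + h (pt Z (-root Z))) := by
  have h2 : ∀ s, Measurable fun Z => h (sheet (Fin.last n) s Z) :=
    fun s => hh.comp (measurable_sheet_last s)
  rw [mu, lintegral_finsetSum_measure, Fin.sum_univ_two,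
    lintegral_map hh (measurable_sheet_last _), lintegral_map hh (measurable_sheet_last _),
    ← lintegral_add_left (h2 0)]
  refine (lintegral_baseMeasure ((h2 0).add (h2 1))).trans ?_
  simp [sheet_last]

lemma mu_compl_ball (n : ℕ) : mu n (ball n)ᶜ = 0 := by
  rw [← lintegral_indicator_one (measurableSet_ball n).compl,
    lintegral_mu (measurable_one.indicator (measurableSet_ball n).compl)]
  refine (setLIntegral_congr_fun (g := fun _ => 0) (isOpen_baseSet n).measurableSet ?_).trans (by simp)
  intro Z hZ
  have h1 := pt_mem_ball hZ (root_sq Z)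
  have h2 := pt_mem_ball (w := -root Z) hZ (by rw [neg_sq, root_sq])
  simp [h1, h2]

lemma ae_mem_ball (n : ℕ) : ∀ᵐ z ∂(mu n), z ∈ ball n := mu_compl_ball n

lemma map_withDensity_comp {α β : Type*} [MeasurableSpace α] [MeasurableSpace β] (m : Measure α)
    {T : α → β} (hT : Measurable T) {F : β → ℝ≥0∞} (hF : Measurable F) :
    (m.withDensity fun x => F (T x)).map T = (m.map T).withDensity F := by
  ext s hs
  rw [Measure.map_apply hT hs, withDensity_apply _ (hT hs), withDensity_apply _ hs,
    setLIntegral_map hs hF hT]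

/-- Such points have vanishing last coordinate, and for `j` not the last index this coordinate is
one of the chart coordinates, so they lie over a hyperplane. Consequently only the last chart
contributes to `formMeasure`. -/
lemma volume_sheet_mem_piece {n : ℕ} {j : Fin (n + 1)} (hj : j ≠ Fin.last n) (s : Fin 2) :
    (volume : Measure (Fin n → ℂ)) {Z | sheet j s Z ∈ piece n j} = 0 := by
  rcases n with _ | n
  · exact absurd (Fin.ext (by have := j.2; simp)) hj
  have h0 : (volume : Measure (Fin (n + 1) → ℂ)) {Z | Z (Fin.last n) = 0} = 0 := by
    have := Measure.pi_hyperplane (fun _ : Fin (n + 1) => (volume : Measure ℂ)) (Fin.last n) 0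
    rwa [← volume_pi] at this
  refine measure_mono_null (fun Z hZ => ?_) h0
  have h1 := hZ.2.2 (Fin.last (n + 1)) (Fin.lt_last_iff_ne_last.2 hj)
  have h2 : j.succAbove (Fin.last n) = Fin.last (n + 1) := by
    rw [Fin.succAbove_of_le_castSucc _ _ (by
      have := Fin.lt_last_iff_ne_last.2 hj
      rw [Fin.le_def]; rw [Fin.lt_def] at this; simp at this ⊢; omega), Fin.succ_last]
  rw [← h2, sheet, Fin.insertNth_apply_succAbove] at h1
  exact h1

/-- The measure of a volume form with density `Ψ / |z_{n+1}|²` in the last chart. -/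
lemma formMeasure_eq {n : ℕ} (D : Fin (n + 1) → (Fin (n + 1) → ℂ) → ℝ)
    {Ψ : (Fin (n + 1) → ℂ) → ℝ≥0∞} (hΨ : Measurable Ψ)
    (hD : ∀ z ∈ ball n, z (Fin.last n) ≠ 0 → ENNReal.ofReal (D (Fin.last n) z) =
      ENNReal.ofReal (1 / ‖z (Fin.last n)‖ ^ 2) * Ψ z) :
    formMeasure n D = (mu n).withDensity Ψ := by
  have h1 : ∀ (j : Fin (n + 1)), j ≠ Fin.last n → ∀ s : Fin 2,
      (((volume : Measure (Fin n → ℂ)).restrict {Z | sheet j s Z ∈ piece n j}).withDensity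
      (fun Z => ENNReal.ofReal (D j (sheet j s Z)))).map (sheet j s) = 0 := by
    intro j hj s
    rw [Measure.restrict_eq_zero.2 (volume_sheet_mem_piece hj s)]
    simp
  rw [formMeasure, Finset.sum_eq_single (Fin.last n)
    (fun j _ hj => Finset.sum_eq_zero fun s _ => h1 j hj s) (by simp), mu, Fin.sum_univ_two,
    Fin.sum_univ_two, withDensity_add_measure]
  have h2 : ∀ s : Fin 2, (((volume : Measure (Fin n → ℂ)).restrict
      {Z | sheet (Fin.last n) s Z ∈ piece n (Fin.last n)}).withDensity
      (fun Z => ENNReal.ofReal (D (Fin.last n) (sheet (Fin.last n) s Z)))).map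
        (sheet (Fin.last n) s) =
      ((baseMeasure n).map (sheet (Fin.last n) s)).withDensity Ψ := by
    intro s
    rw [sheet_last_mem_piece, ← map_withDensity_comp _ (measurable_sheet_last s) hΨ, baseMeasure,
      show (fun x => Ψ (sheet (Fin.last n) s x)) = Ψ ∘ sheet (Fin.last n) s from rfl,
      ← withDensity_mul _ measurable_inv_quad (hΨ.comp (measurable_sheet_last s))]
    congr 1
    refine withDensity_congr_ae ?_
    filter_upwards [ae_restrict_mem (isOpen_baseSet n).measurableSet] with Z hZ
    have := norm_sheet_last_last s Z
    rw [hD _ (sheet_last_mem_ball s hZ) (fun h => hZ.1 (by rw [h] at this; simpa using this.symm)),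
      this]
    rfl
  rw [h2, h2]

lemma rho_eq (n : ℕ) : rho n = ENNReal.ofReal (((n : ℝ) + 1) ^ 2) • mu n := by
  rw [rho, formMeasure_eq (Ψ := fun _ => ENNReal.ofReal (((n : ℝ) + 1) ^ 2)) _ measurable_const,
    withDensity_const]
  intro z _ _
  rw [← ENNReal.ofReal_mul (by positivity)]
  congr 1
  rw [alphaCoeff]
  have : ‖(n : ℂ) + 1‖ = n + 1 := by
    exact_mod_cast Complex.norm_natCast (n + 1)
  simp only [norm_mul, norm_div, norm_pow, norm_neg, norm_one, one_pow, this]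
  ring

end Kepler
end

/-! ### Complex Hessians of functions of the height -/

noncomputable section
namespace Kepler
open MeasureTheory
open scoped ComplexOrder ENNReal ComplexConjugate

section Wirtinger

variable {n : ℕ}

lemma dz_congr {F G : (Fin n → ℂ) → ℂ} {Z : Fin n → ℂ} (h : F =ᶠ[nhds Z] G) (k : Fin n) :
    dz k F Z = dz k G Z := by
  simp only [dz, h.fderiv_eq]

lemma dz_mul {F G : (Fin n → ℂ) → ℂ} {Z : Fin n → ℂ} (hF : DifferentiableAt ℝ F Z)
    (hG : DifferentiableAt ℝ G Z) (k : Fin n) :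
    dz k (fun Y => F Y * G Y) Z = dz k F Z * G Z + F Z * dz k G Z := by
  simp only [dz, fderiv_fun_mul hF hG]
  simp
  ring

lemma dz_add {F G : (Fin n → ℂ) → ℂ} {Z : Fin n → ℂ} (hF : DifferentiableAt ℝ F Z)
    (hG : DifferentiableAt ℝ G Z) (k : Fin n) :
    dz k (fun Y => F Y + G Y) Z = dz k F Z + dz k G Z := by
  simp only [dz, fderiv_fun_add hF hG]
  simp
  ring

lemma dz_of_hasFDerivAt {F : (Fin n → ℂ) → ℂ} {F' : (Fin n → ℂ) →L[ℂ] ℂ} {Z : Fin n → ℂ}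
    (h : HasFDerivAt F F' Z) (k : Fin n) : dz k F Z = F' (Pi.single k 1) := by
  have h1 : (Pi.single k Complex.I : Fin n → ℂ) = Complex.I • Pi.single k 1 := by
    rw [← Pi.single_smul]; simp
  simp only [dz, (h.restrictScalars ℝ).fderiv, ContinuousLinearMap.coe_restrictScalars', h1,
    map_smul, smul_eq_mul, ← mul_assoc, Complex.I_mul_I]
  ring

lemma dz_conj_coord (k l : Fin n) (Z : Fin n → ℂ) : dz k (fun Y => conj (Y l)) Z = 0 := by
  have h : HasFDerivAt (fun Y : Fin n → ℂ => conj (Y l))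
      (Complex.conjCLE.toContinuousLinearMap.comp (ContinuousLinearMap.proj (R := ℝ) l)) Z :=
    (Complex.conjCLE.toContinuousLinearMap.comp
      (ContinuousLinearMap.proj (R := ℝ) (φ := fun _ : Fin n => ℂ) l)).hasFDerivAt
  simp only [dz, h.fderiv]
  by_cases hk : k = l
  · subst hk
    simp
  · simp [Pi.single_eq_of_ne (Ne.symm hk)]

/-- The real-linear form `v ↦ 2 Re ∑ a_i v_i`. -/
def reForm (a : Fin n → ℂ) : (Fin n → ℂ) →L[ℝ] ℝ :=
  (2 : ℝ) • Complex.reCLM.comp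
    (∑ i, a i • (ContinuousLinearMap.proj (R := ℂ) (φ := fun _ : Fin n => ℂ) i)
      |>.restrictScalars ℝ)

lemma reForm_apply (a v : Fin n → ℂ) : reForm a v = 2 * (∑ i, a i * v i).re := by
  simp [reForm]

lemma sum_mul_single (a : Fin n → ℂ) (k : Fin n) (c : ℂ) :
    ∑ i, a i * (Pi.single k c : Fin n → ℂ) i = a k * c := by
  rw [Finset.sum_eq_single k (fun i _ hi => by simp [hi]) (by simp)]
  simp

lemma fderiv_ofReal {T : (Fin n → ℂ) → ℝ} {T' : (Fin n → ℂ) →L[ℝ] ℝ} {Z : Fin n → ℂ}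
    (h : HasFDerivAt T T' Z) :
    HasFDerivAt (fun Y => (T Y : ℂ)) (Complex.ofRealCLM.comp T') Z :=
  Complex.ofRealCLM.hasFDerivAt.comp Z h

/-- For a real function the two Wirtinger derivatives are conjugate, so writing the differential as
`reForm a` records both of them at once. -/
lemma dz_ofReal {T : (Fin n → ℂ) → ℝ} {a : Fin n → ℂ} {Z : Fin n → ℂ}
    (h : HasFDerivAt T (reForm a) Z) (k : Fin n) : dz k (fun Y => (T Y : ℂ)) Z = a k := by
  simp only [dz, (fderiv_ofReal h).fderiv, ContinuousLinearMap.comp_apply, reForm_apply,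
    sum_mul_single, Complex.ofRealCLM_apply]
  apply Complex.ext <;> simp

lemma dzbar_ofReal {T : (Fin n → ℂ) → ℝ} {a : Fin n → ℂ} {Z : Fin n → ℂ}
    (h : HasFDerivAt T (reForm a) Z) (k : Fin n) :
    dzbar k (fun Y => (T Y : ℂ)) Z = conj (a k) := by
  simp only [dzbar, (fderiv_ofReal h).fderiv, ContinuousLinearMap.comp_apply, reForm_apply,
    sum_mul_single, Complex.ofRealCLM_apply]
  apply Complex.ext <;> simp
  ring

lemma hasFDerivAt_quad (Z : Fin n → ℂ) :
    HasFDerivAt quad (∑ i, (2 * Z i) • (ContinuousLinearMap.proj (R := ℂ)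
      (φ := fun _ : Fin n => ℂ) i)) Z := by
  unfold quad
  refine HasFDerivAt.fun_sum fun i _ => ?_
  have := (hasFDerivAt_apply (𝕜 := ℂ) (F' := fun _ : Fin n => ℂ) i Z).pow 2
  simpa using this

lemma hasFDerivAt_norm_quad {Z : Fin n → ℂ} (hZ : quad Z ≠ 0) :
    HasFDerivAt (fun Y : Fin n → ℂ => ‖quad Y‖)
      (reForm fun i => conj (quad Z) * Z i / ‖quad Z‖) Z := by
  have h1 := ((hasFDerivAt_quad Z).restrictScalars ℝ).norm_sq.sqrt (by simpa using hZ)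
  simp only [Real.sqrt_sq (norm_nonneg _)] at h1
  refine h1.congr_fderiv ?_
  ext v
  have h0 : ‖quad Z‖ ≠ 0 := by simpa using hZ
  have h2 : ∑ i, conj (quad Z) * Z i / (‖quad Z‖ : ℂ) * v i =
      ((1 / (2 * ‖quad Z‖) : ℝ) : ℂ) * ((∑ i, 2 * Z i * v i) * conj (quad Z)) := by
    rw [Finset.sum_mul, Finset.mul_sum]
    refine Finset.sum_congr rfl fun i _ => ?_
    push_cast
    have : (‖quad Z‖ : ℂ) ≠ 0 := by exact_mod_cast h0
    field_simp
  have h3 : (∑ i, (2 * Z i) • (ContinuousLinearMap.proj (R := ℂ)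
      (φ := fun _ : Fin n => ℂ) i)) v = ∑ i, 2 * Z i * v i := by
    simp
  rw [reForm_apply, h2, Complex.re_ofReal_mul]
  simp only [smul_apply, ContinuousLinearMap.comp_apply,
    ContinuousLinearMap.coe_restrictScalars', h3, innerSL_apply_apply, Complex.inner, smul_eq_mul]
  simp [mul_comm]
  ring

/-- The squared norm of the points over `Z`. -/
def height (Z : Fin n → ℂ) : ℝ := ∑ i, ‖Z i‖ ^ 2 + ‖quad Z‖

/-- The derivatives `∂τ/∂Z_k` of `τ = height`. -/
def heightGrad (Z : Fin n → ℂ) (i : Fin n) : ℂ := conj (Z i) + conj (quad Z) * Z i / ‖quad Z‖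

lemma hasFDerivAt_height {Z : Fin n → ℂ} (hZ : quad Z ≠ 0) :
    HasFDerivAt height (reForm (heightGrad Z)) Z := by
  have h1 : HasFDerivAt (fun Y : Fin n → ℂ => ∑ i, ‖Y i‖ ^ 2)
      (reForm fun i => conj (Z i)) Z := by
    have : HasFDerivAt (fun Y : Fin n → ℂ => ∑ i, ‖Y i‖ ^ 2) _ Z :=
      HasFDerivAt.fun_sum (u := Finset.univ) fun i _ =>
        (hasFDerivAt_apply (𝕜 := ℝ) (F' := fun _ : Fin n => ℂ) i Z).norm_sq
    refine this.congr_fderiv ?_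
    ext v
    simp only [sum_apply, smul_apply, ContinuousLinearMap.comp_apply, innerSL_apply_apply,
      Complex.inner, ContinuousLinearMap.proj_apply, reForm_apply, Complex.re_sum, Finset.mul_sum]
    exact Finset.sum_congr rfl fun x _ => by simp; ring
  refine (h1.add (hasFDerivAt_norm_quad hZ)).congr_fderiv ?_
  ext v
  simp only [add_apply, reForm_apply, heightGrad, add_mul,
    Finset.sum_add_distrib, Complex.add_re, mul_add]

lemma reForm_smul (c : ℝ) (a : Fin n → ℂ) : c • reForm a = reForm fun i => c * a i := by
  ext v
  simp only [smul_apply, reForm_apply, smul_eq_mul, mul_assoc,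
    ← Finset.mul_sum, Complex.re_ofReal_mul]
  ring

lemma hasFDerivAt_comp_height {Z : Fin n → ℂ} (hZ : quad Z ≠ 0) {ψ : ℝ → ℝ} {d : ℝ}
    (hψ : HasDerivAt ψ d (height Z)) :
    HasFDerivAt (fun Y : Fin n → ℂ => ψ (height Y)) (reForm fun i => d * heightGrad Z i) Z := by
  have := hψ.comp_hasFDerivAt Z (hasFDerivAt_height hZ)
  rwa [reForm_smul] at this

/-- The first derivative is `g(τ)` times the conjugate of `heightGrad`, in which `Y_l` and `conj
(Y_l)` appear explicitly, so one product rule finishes. Of the factor `2 Z_k` coming from `∂(Z ·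
Z)`, half is cancelled by the derivative of `1 / |Z · Z|`. Keeping `g` separate from `ψ` means that
its derivative is needed at a single point only. -/
lemma complexHessian_comp_height {Z : Fin n → ℂ} (hZ : quad Z ≠ 0) {ψ g : ℝ → ℝ} {d : ℝ}
    (hψ : ∀ᶠ t in nhds (height Z), HasDerivAt ψ (g t) t) (hg : HasDerivAt g d (height Z)) :
    complexHessian (fun Y => ψ (height Y)) Z = Matrix.of fun k l =>
      (g (height Z) : ℂ) * ((if k = l then 1 else 0) + Z k * conj (Z l) / ‖quad Z‖) +
        d * (heightGrad Z k * conj (heightGrad Z l)) := by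
  have hN : (‖quad Z‖ : ℂ) ≠ 0 := by simpa using hZ
  have hcont : ContinuousAt height Z := (hasFDerivAt_height hZ).continuousAt
  have hev : ∀ᶠ Y in nhds Z, quad Y ≠ 0 ∧ HasDerivAt ψ (g (height Y)) (height Y) :=
    ((isOpen_ne_fun continuous_quad continuous_const).eventually_mem hZ).and
      (hcont.eventually hψ)
  ext k l
  have h1 : dzbar l (fun Y => (ψ (height Y) : ℂ)) =ᶠ[nhds Z] fun Y => (g (height Y) : ℂ) *
      (Y l + quad Y * conj (Y l) * ((‖quad Y‖⁻¹ : ℝ) : ℂ)) := by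
    filter_upwards [hev] with Y hY
    rw [dzbar_ofReal (hasFDerivAt_comp_height hY.1 hY.2)]
    simp [heightGrad, div_eq_mul_inv]
  have hg' := hasFDerivAt_comp_height hZ hg
  have hinv : HasFDerivAt (fun Y : Fin n → ℂ => ‖quad Y‖⁻¹)
      (reForm fun i => ((-(‖quad Z‖ ^ 2)⁻¹ : ℝ) : ℂ) * (conj (quad Z) * Z i / ‖quad Z‖)) Z := by
    rw [← reForm_smul]
    exact (hasDerivAt_inv (by simpa using hZ)).comp_hasFDerivAt Z (hasFDerivAt_norm_quad hZ)
  have d1 : DifferentiableAt ℝ (fun Y : Fin n → ℂ => Y l) Z := by fun_prop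
  have d2 : DifferentiableAt ℝ (quad (n := n)) Z :=
    ((hasFDerivAt_quad Z).restrictScalars ℝ).differentiableAt
  have d3 : DifferentiableAt ℝ (fun Y : Fin n → ℂ => conj (Y l)) Z :=
    Complex.conjCLE.differentiableAt.comp Z d1
  have d4 : DifferentiableAt ℝ (fun Y : Fin n → ℂ => ((‖quad Y‖⁻¹ : ℝ) : ℂ)) Z :=
    (fderiv_ofReal hinv).differentiableAt
  simp only [complexHessian, Matrix.of_apply]
  rw [dz_congr h1, dz_mul (fderiv_ofReal hg').differentiableAt (d1.fun_add ((d2.fun_mul d3).fun_mul d4)),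
    dz_add d1 ((d2.fun_mul d3).fun_mul d4), dz_mul (d2.fun_mul d3) d4, dz_mul d2 d3, dz_conj_coord,
    dz_ofReal hg', dz_ofReal hinv, dz_of_hasFDerivAt (hasFDerivAt_quad Z),
    dz_of_hasFDerivAt (hasFDerivAt_apply (𝕜 := ℂ) (F' := fun _ : Fin n => ℂ) l Z)]
  have h5 : quad Z * conj (quad Z) = (‖quad Z‖ : ℂ) ^ 2 := Complex.mul_conj' _
  have h6 : (∑ i, (2 * Z i) • (ContinuousLinearMap.proj (R := ℂ)
      (φ := fun _ : Fin n => ℂ) i)) (Pi.single k 1) = 2 * Z k := by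
    simp [Pi.single_apply]
  rw [h6]
  have h7 : conj (heightGrad Z l) = Z l + quad Z * conj (Z l) * ((‖quad Z‖⁻¹ : ℝ) : ℂ) := by
    simp [heightGrad, div_eq_mul_inv]
  rw [h7]
  have h8 : (ContinuousLinearMap.proj (R := ℂ) (φ := fun _ : Fin n => ℂ) l) (Pi.single k 1) =
      if k = l then 1 else 0 := by
    simp [Pi.single_apply, eq_comm]
  rw [h8]
  have h9 : quad Z * conj (Z l) * (((-(‖quad Z‖ ^ 2)⁻¹ : ℝ) : ℂ) *
      (conj (quad Z) * Z k / ‖quad Z‖)) = - (Z k * conj (Z l) / ‖quad Z‖) := by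
    rw [show quad Z * conj (Z l) * (((-(‖quad Z‖ ^ 2)⁻¹ : ℝ) : ℂ) *
      (conj (quad Z) * Z k / ‖quad Z‖)) = (quad Z * conj (quad Z)) * (((-(‖quad Z‖ ^ 2)⁻¹ : ℝ) : ℂ) *
      (conj (Z l) * Z k / ‖quad Z‖)) by ring, h5]
    push_cast
    field_simp
  rw [h9]
  push_cast
  field_simp
  ring

end Wirtinger

lemma sum_norm_sq_eq {n : ℕ} (v : Fin n → ℂ) :
    ∑ i, v i * conj (v i) = ((∑ i, ‖v i‖ ^ 2 : ℝ) : ℂ) := by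
  push_cast
  exact Finset.sum_congr rfl fun i _ => Complex.mul_conj' _

/-- The Hessian of a function of `height`, with first and second derivatives `x` and `y`. -/
def radialHessian {n : ℕ} (x y : ℝ) (Z : Fin n → ℂ) : Matrix (Fin n) (Fin n) ℂ :=
  Matrix.of fun k l => (x : ℂ) * ((if k = l then 1 else 0) + Z k * conj (Z l) / ‖quad Z‖) +
    y * (heightGrad Z k * conj (heightGrad Z l))

/-- As `n ≥ 2`, some nonzero vector is annihilated by the gradient. On it the rank one term with
coefficient `y` drops out and the form equals `x` times a positive number. The sign matters because
the determinant is computed after factoring out `x`. -/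
lemma radialHessian_pos {n : ℕ} (hn : 2 ≤ n) {x y : ℝ} {Z : Fin n → ℂ}
    (h : (radialHessian x y Z).PosDef) : 0 < x := by
  set c := heightGrad Z
  obtain ⟨w, hw0, hw⟩ : ∃ w : Fin n → ℂ, w ≠ 0 ∧ ∑ k, w k * c k = 0 := by
    let i : Fin n := ⟨0, by omega⟩
    let j : Fin n := ⟨1, by omega⟩
    have hij : i ≠ j := by simp [i, j]
    by_cases h1 : c i = 0
    · refine ⟨Pi.single i 1, fun h => by simpa using congrFun h i, ?_⟩
      simp_rw [mul_comm _ (c _)]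
      rw [sum_mul_single, h1, zero_mul]
    · refine ⟨Pi.single i (c j) - Pi.single j (c i), fun h => h1 ?_, ?_⟩
      · simpa [Pi.single_apply, hij, hij.symm] using congrFun h j
      · simp_rw [mul_comm _ (c _), Pi.sub_apply, mul_sub]
        rw [Finset.sum_sub_distrib, sum_mul_single, sum_mul_single]
        ring
  have h1 := h.dotProduct_mulVec_pos (x := fun i => conj (w i))
    (fun h => hw0 (funext fun i => by simpa using congrFun h i))
  have h2 : star (fun i => conj (w i)) ⬝ᵥ (radialHessian x y Z).mulVec (fun i => conj (w i)) =
      ((x * (∑ i, ‖w i‖ ^ 2 + ‖∑ k, w k * Z k‖ ^ 2 / ‖quad Z‖) : ℝ) : ℂ) := by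
    have e1 : ∀ k, (radialHessian x y Z).mulVec (fun i => conj (w i)) k =
        x * (conj (w k) + Z k * conj (∑ l, w l * Z l) / ‖quad Z‖) := by
      intro k
      have : ∀ l, radialHessian x y Z k l * conj (w l) =
          x * ((if k = l then 1 else 0) * conj (w l)) +
          (x * Z k / ‖quad Z‖) * conj (w l * Z l) + y * c k * conj (w l * c l) := by
        intro l
        simp only [radialHessian, Matrix.of_apply, map_mul]
        ring
      simp only [Matrix.mulVec, dotProduct, this, Finset.sum_add_distrib, ← Finset.mul_sum,
        ← map_sum, hw]
      simp
      ring
    simp only [dotProduct, e1, Pi.star_apply, RCLike.star_def, Complex.conj_conj]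
    have : ∀ k, w k * (x * (conj (w k) + Z k * conj (∑ l, w l * Z l) / ‖quad Z‖)) =
        x * (w k * conj (w k)) + (w k * Z k) * (x * conj (∑ l, w l * Z l) / ‖quad Z‖) := by
      intro k; ring
    simp only [this, Finset.sum_add_distrib, ← Finset.mul_sum, ← Finset.sum_mul, sum_norm_sq_eq]
    push_cast
    rw [← Complex.mul_conj' (∑ k, w k * Z k)]
    ring
  rw [h2] at h1
  have h3 : 0 < x * (∑ i, ‖w i‖ ^ 2 + ‖∑ k, w k * Z k‖ ^ 2 / ‖quad Z‖) := by exact_mod_cast h1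
  exact pos_of_mul_pos_left h3 (by positivity)

/-- Dividing by `x` leaves the identity plus a product `U * V` of an `n × 2` and a `2 × n` matrix,
so `det (1 + UV) = det (1 + VU)` reduces the computation to a `2 × 2` determinant. Its entries are
the inner products of `Z` and `heightGrad Z`, all expressible through `height Z` and `quad Z`. -/
lemma det_radialHessian {n : ℕ} (hn : 1 ≤ n) {x y : ℝ} (hx : x ≠ 0) {Z : Fin n → ℂ}
    (hZ : quad Z ≠ 0) :
    (radialHessian x y Z).det =
      ((x ^ (n - 1) * (x + height Z * y) * (height Z / ‖quad Z‖) : ℝ) : ℂ) := by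
  have hN : (‖quad Z‖ : ℂ) ≠ 0 := by simpa using hZ
  have hx' : (x : ℂ) ≠ 0 := by exact_mod_cast hx
  set c := heightGrad Z with hc
  let U : Matrix (Fin n) (Fin 2) ℂ := Matrix.of fun k s => if s = 0 then Z k else c k
  let V : Matrix (Fin 2) (Fin n) ℂ := Matrix.of fun s l =>
    if s = 0 then conj (Z l) / ‖quad Z‖ else (y / x) * conj (c l)
  have h1 : radialHessian x y Z = (x : ℂ) • (1 + U * V) := by
    ext k l
    simp only [radialHessian, Matrix.of_apply, Matrix.smul_apply, Matrix.add_apply,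
      Matrix.one_apply, Matrix.mul_apply, Fin.sum_univ_two, U, V, smul_eq_mul]
    simp
    field_simp
    ring
  have e1 : ∑ k, conj (Z k) * Z k = ((∑ i, ‖Z i‖ ^ 2 : ℝ) : ℂ) := by
    rw [← sum_norm_sq_eq]; simp_rw [mul_comm]
  have q1 : ∑ k, Z k * Z k = quad Z := by simp [quad, sq]
  have q2 : ∑ k, conj (Z k) * conj (Z k) = conj (quad Z) := by simp [quad, sq]
  have q3 : quad Z * conj (quad Z) = (‖quad Z‖ : ℂ) ^ 2 := Complex.mul_conj' _
  have hR : (height Z : ℂ) = ((∑ i, ‖Z i‖ ^ 2 : ℝ) : ℂ) + ‖quad Z‖ := by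
    rw [height]; push_cast; ring
  set R : ℂ := ((∑ i, ‖Z i‖ ^ 2 : ℝ) : ℂ)
  have e2 : ∑ k, conj (Z k) * c k = conj (quad Z) * height Z / ‖quad Z‖ := by
    have : ∀ k, conj (Z k) * c k = conj (Z k) * conj (Z k) +
        (conj (Z k) * Z k) * (conj (quad Z) / ‖quad Z‖) := by
      intro k; simp only [hc, heightGrad]; ring
    simp only [this, Finset.sum_add_distrib, ← Finset.sum_mul, q2, e1, hR]
    field_simp
    ring
  have e3 : ∑ k, conj (c k) * Z k = quad Z * height Z / ‖quad Z‖ := by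
    have := congrArg conj e2
    simp only [map_sum, map_mul, map_div₀, Complex.conj_conj, Complex.conj_ofReal] at this
    rw [← this]
    simp_rw [mul_comm]
  have e4 : ∑ k, conj (c k) * c k = 2 * height Z := by
    have : ∀ k, conj (c k) * c k = conj (Z k) * c k * (quad Z / ‖quad Z‖) +
        conj (Z k) * Z k + (Z k * Z k) * (conj (quad Z) / ‖quad Z‖) := by
      intro k
      simp only [hc, heightGrad, map_add, map_mul, map_div₀, Complex.conj_conj,
        Complex.conj_ofReal]
      ring
    simp only [this, Finset.sum_add_distrib, ← Finset.sum_mul, q1, e2, e1]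
    rw [show conj (quad Z) * height Z / ‖quad Z‖ * (quad Z / ‖quad Z‖) + R +
      quad Z * (conj (quad Z) / ‖quad Z‖) = (quad Z * conj (quad Z)) * (height Z / ‖quad Z‖ ^ 2) + R +
      (quad Z * conj (quad Z)) / ‖quad Z‖ by field_simp, q3, hR]
    field_simp
    ring
  have f1 : ∀ (a b : ℂ) (u v : Fin n → ℂ), ∑ k, (a * u k * b) * v k = a * b * ∑ k, u k * v k := by
    intro a b u v
    rw [Finset.mul_sum]
    exact Finset.sum_congr rfl fun k _ => by ring
  have m00 : (V * U) 0 0 = R / ‖quad Z‖ := by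
    rw [← e1, Matrix.mul_apply, Finset.sum_div]
    exact Finset.sum_congr rfl fun k _ => by simp [U, V]; ring
  have m01 : (V * U) 0 1 = conj (quad Z) * height Z / ‖quad Z‖ / ‖quad Z‖ := by
    rw [← e2, Matrix.mul_apply, Finset.sum_div]
    exact Finset.sum_congr rfl fun k _ => by simp [U, V]; ring
  have m10 : (V * U) 1 0 = (y / x) * (quad Z * height Z / ‖quad Z‖) := by
    rw [← e3, Matrix.mul_apply, Finset.mul_sum]
    exact Finset.sum_congr rfl fun k _ => by simp [U, V]; ring
  have m11 : (V * U) 1 1 = (y / x) * (2 * height Z) := by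
    rw [← e4, Matrix.mul_apply, Finset.mul_sum]
    exact Finset.sum_congr rfl fun k _ => by simp [U, V]; ring
  rw [h1, Matrix.det_smul, Matrix.det_one_add_mul_comm, Matrix.det_fin_two, Fintype.card_fin]
  simp only [Matrix.add_apply, m00, m01, m10, m11]
  simp only [Matrix.one_apply_eq, ne_eq, zero_ne_one, one_ne_zero, not_false_eq_true,
    Matrix.one_apply_ne, zero_add]
  rw [show conj (quad Z) * height Z / ‖quad Z‖ / ‖quad Z‖ * ((y / x) * (quad Z * height Z / ‖quad Z‖))
    = (quad Z * conj (quad Z)) * ((y / x) * height Z ^ 2 / ‖quad Z‖ ^ 3) by field_simp, q3]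
  obtain ⟨m, rfl⟩ : ∃ m, n = m + 1 := ⟨n - 1, by omega⟩
  rw [Nat.add_sub_cancel, show R = height Z - ‖quad Z‖ by rw [hR]; ring]
  push_cast
  rw [pow_succ]
  field_simp
  ring

/-- Only the modulus of the square root enters, so the branch is irrelevant and the identity holds
for all `Z`. It turns radial potentials in any chart into functions of `height`. -/
lemma normSq_localParam {n : ℕ} {j : Fin (n + 1)} {p : Fin (n + 1) → ℂ} (hp : p j ≠ 0)
    (Z : Fin n → ℂ) : normSq (localParam j p Z) = height Z := by
  have h : ‖p j * ((∑ i, Z i ^ 2) / (-(p j) ^ 2)) ^ (1 / 2 : ℂ)‖ ^ 2 = ‖quad Z‖ := by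
    rw [norm_mul, mul_pow, ← norm_pow (_ ^ (1 / 2 : ℂ)), one_div]
    have : (((∑ i, Z i ^ 2) / (-(p j) ^ 2)) ^ (2⁻¹ : ℂ)) ^ 2 = (∑ i, Z i ^ 2) / (-(p j) ^ 2) := by
      exact_mod_cast Complex.cpow_nat_inv_pow _ two_ne_zero
    rw [this, norm_div, norm_neg, norm_pow, mul_div_cancel₀ _ (by simpa using hp)]
    rfl
  rw [normSq, Fin.sum_univ_succAbove _ j]
  simp only [localParam, Fin.insertNth_apply_same, Fin.insertNth_apply_succAbove, h, height]
  ring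

lemma sum_succAbove {n : ℕ} (j : Fin (n + 1)) (p : Fin (n + 1) → ℂ) :
    ∑ i, p i ^ 2 = p j ^ 2 + quad (coord j p) := by
  rw [Fin.sum_univ_succAbove _ j]
  rfl

lemma quad_coord {n : ℕ} {p : Fin (n + 1) → ℂ} (hp : p ∈ ball n) (j : Fin (n + 1)) :
    quad (coord j p) = -p j ^ 2 := by
  have := sum_succAbove j p
  rw [hp.1] at this
  linear_combination -this

lemma height_coord {n : ℕ} {p : Fin (n + 1) → ℂ} (hp : p ∈ ball n) (j : Fin (n + 1)) :
    height (coord j p) = normSq p := by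
  rw [height, quad_coord hp, normSq, Fin.sum_univ_succAbove _ j, norm_neg, norm_pow, add_comm]
  rfl

/-! ### The volume density of the metric with potential `log (1/f)` -/

section Potential

variable {f : ℝ → ℝ}

lemma hasDerivAt_of_contDiffOn (hf : ContDiffOn ℝ 2 f (Set.Ioo 0 1)) {t : ℝ}
    (ht : t ∈ Set.Ioo (0 : ℝ) 1) :
    HasDerivAt f (deriv f t) t ∧ HasDerivAt (deriv f) (deriv (deriv f) t) t := by
  have h1 : ContDiffOn ℝ 1 (deriv f) (Set.Ioo 0 1) :=
    ((contDiffOn_succ_iff_deriv_of_isOpen (n := 1) isOpen_Ioo).1 (by exact_mod_cast hf)).2.2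
  exact ⟨((hf.differentiableOn (by norm_num)).differentiableAt
      (isOpen_Ioo.mem_nhds ht)).hasDerivAt,
    ((h1.differentiableOn (by norm_num)).differentiableAt (isOpen_Ioo.mem_nhds ht)).hasDerivAt⟩

lemma continuousOn_W (n : ℕ) (hf : ContDiffOn ℝ 2 f (Set.Ioo 0 1)) :
    ContinuousOn (W n f) (Set.Ioo 0 1) := by
  have h1 : ContDiffOn ℝ 1 (deriv f) (Set.Ioo 0 1) :=
    ((contDiffOn_succ_iff_deriv_of_isOpen (n := 1) isOpen_Ioo).1 (by exact_mod_cast hf)).2.2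
  have h2 : ContinuousOn (deriv (deriv f)) (Set.Ioo 0 1) :=
    h1.continuousOn_deriv_of_isOpen isOpen_Ioo le_rfl
  have h3 := h1.continuousOn
  have h4 := hf.continuousOn
  unfold W
  fun_prop

lemma leviMatrix_log (hf : ContDiffOn ℝ 2 f (Set.Ioo 0 1))
    (hpos : ∀ t ∈ Set.Ioo (0 : ℝ) 1, 0 < f t) {n : ℕ} {p : Fin (n + 1) → ℂ} (hp : p ∈ ball n)
    {j : Fin (n + 1)} (hj : p j ≠ 0) :
    leviMatrix (fun w => Real.log (1 / f (normSq w))) j p =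
      radialHessian (-(deriv f (normSq p) / f (normSq p)))
        (-((deriv (deriv f) (normSq p) * f (normSq p) - deriv f (normSq p) * deriv f (normSq p)) /
          f (normSq p) ^ 2)) (coord j p) := by
  have hq : quad (coord j p) ≠ 0 := by rw [quad_coord hp]; simpa using hj
  have ht : height (coord j p) ∈ Set.Ioo (0 : ℝ) 1 := by
    rw [height_coord hp]; exact normSq_mem_Ioo hp
  rw [leviMatrix]
  simp only [normSq_localParam hj]
  rw [complexHessian_comp_height hq (ψ := fun t => Real.log (1 / f t))
    (g := fun t => -(deriv f t / f t))
    (d := -((deriv (deriv f) (normSq p) * f (normSq p) - deriv f (normSq p) * deriv f (normSq p)) /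
          f (normSq p) ^ 2)), height_coord hp]
  · rfl
  · filter_upwards [isOpen_Ioo.mem_nhds ht] with t ht
    have := ((hasDerivAt_of_contDiffOn hf ht).1.log (hpos t ht).ne').neg
    refine this.congr_of_eventuallyEq (Filter.Eventually.of_forall fun y => ?_)
    simp
  · rw [height_coord hp] at ht ⊢
    obtain ⟨h1, h2⟩ := hasDerivAt_of_contDiffOn hf ht
    exact (h2.div h1 (hpos _ ht).ne').neg

/-- Here `x = -f'/f` and `x + t y = -(f f' + t f f'' - t f'²) / f²`. The signs combine to `(-1)ⁿ`,
and the denominators `f^(n-1)` and `f²` are absorbed by `f^(n+1)`. -/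
lemma det_leviMatrix_log (hf : ContDiffOn ℝ 2 f (Set.Ioo 0 1))
    (hpos : ∀ t ∈ Set.Ioo (0 : ℝ) 1, 0 < f t) {n : ℕ} (hn : 2 ≤ n)
    (hpsh : IsStrictlyPSH n (fun z => Real.log (1 / f (normSq z))))
    {p : Fin (n + 1) → ℂ} (hp : p ∈ ball n) {j : Fin (n + 1)} (hj : p j ≠ 0) :
    f (normSq p) ^ (n + 1) * (leviMatrix (fun w => Real.log (1 / f (normSq w))) j p).det.re =
      1 / ‖p j‖ ^ 2 * W n f (normSq p) := by
  have h := hpsh p hp j hj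
  rw [leviMatrix_log hf hpos hp hj] at h ⊢
  have hx := radialHessian_pos hn h
  have hq : quad (coord j p) ≠ 0 := by rw [quad_coord hp]; simpa using hj
  have hf0 := hpos _ (normSq_mem_Ioo hp)
  have hj' : ‖p j‖ ≠ 0 := by simpa using hj
  rw [det_radialHessian (by omega) hx.ne' hq, Complex.ofReal_re, height_coord hp, quad_coord hp,
    norm_neg, norm_pow, W]
  obtain ⟨m, rfl⟩ : ∃ m, n = m + 1 := ⟨n - 1, by omega⟩
  rw [Nat.add_sub_cancel, ← neg_div, div_pow, neg_pow]
  field_simp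
  ring

lemma W_normSq_pos (hf : ContDiffOn ℝ 2 f (Set.Ioo 0 1))
    (hpos : ∀ t ∈ Set.Ioo (0 : ℝ) 1, 0 < f t) {n : ℕ} (hn : 2 ≤ n)
    (hpsh : IsStrictlyPSH n (fun z => Real.log (1 / f (normSq z))))
    {p : Fin (n + 1) → ℂ} (hp : p ∈ ball n) : 0 < W n f (normSq p) := by
  obtain ⟨j, hj⟩ : ∃ j, p j ≠ 0 := Function.ne_iff.1 hp.2.1
  have h1 := det_leviMatrix_log hf hpos hn hpsh hp hj
  have h2 : 0 < (leviMatrix (fun w => Real.log (1 / f (normSq w))) j p).det.re :=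
    (Complex.lt_def.1 (hpsh p hp j hj).det_pos).1
  have h3 := pow_pos (hpos _ (normSq_mem_Ioo hp)) (n + 1)
  have hj' : 0 < ‖p j‖ := by simpa using hj
  have h4 := mul_pos h3 h2
  rw [h1] at h4
  exact pos_of_mul_pos_right h4 (by positivity)

end Potential

lemma exists_mem_ball_normSq {n : ℕ} (hn : 1 ≤ n) {t : ℝ} (ht : t ∈ Set.Ioo (0 : ℝ) 1) :
    ∃ p ∈ ball n, normSq p = t ∧ p (Fin.last n) ≠ 0 := by
  obtain ⟨m, rfl⟩ : ∃ m, n = m + 1 := ⟨n - 1, by omega⟩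
  -- The point is `(a, 0, …, 0, i a)`, with `|a|² = t / 2`.
  set a : ℂ := ((√(t / 2) : ℝ) : ℂ)
  have ha : ‖a‖ ^ 2 = t / 2 := by
    rw [Complex.norm_real, Real.norm_eq_abs, sq_abs, Real.sq_sqrt (by linarith [ht.1])]
  have ha0 : a ≠ 0 := by
    intro h; rw [h] at ha; simp at ha; linarith [ht.1]
  have hq : quad (Pi.single 0 a : Fin (m + 1) → ℂ) = a ^ 2 := by
    rw [quad, Finset.sum_eq_single 0 (fun i _ hi => by simp [hi]) (by simp)]; simp
  have hs : ∑ i, ‖(Pi.single 0 a : Fin (m + 1) → ℂ) i‖ ^ 2 = ‖a‖ ^ 2 := by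
    rw [Finset.sum_eq_single 0 (fun i _ hi => by simp [hi]) (by simp)]; simp
  refine ⟨pt (Pi.single 0 a) (Complex.I * a), pt_mem_ball ⟨?_, ?_⟩ ?_, ?_, ?_⟩
  · rw [hq]; positivity
  · rw [hq, hs, norm_pow, ha]; linarith [ht.2]
  · rw [hq, mul_pow, Complex.I_sq]; ring
  · rw [normSq_pt, hs, norm_mul, Complex.norm_I, one_mul, ha]; ring
  · simpa using ha0

end Kepler
end

/-! ### Finiteness and positivity of the total mass -/

noncomputable section
namespace Kepler
open MeasureTheory
open scoped ComplexOrder ENNReal ComplexConjugate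

section Finite

lemma lintegral_inv_norm_disc :
    ∫⁻ u in {u : ℂ | ‖u‖ ≤ 1}, ‖u‖ₑ⁻¹ < ∞ := by
  have hm : MeasurableSet {u : ℂ | ‖u‖ ≤ 1} :=
    (isClosed_le continuous_norm continuous_const).measurableSet
  rw [← lintegral_indicator hm, ← Complex.lintegral_comp_polarCoord_symm]
  have hsub : ∀ p ∈ polarCoord.target, ENNReal.ofReal p.1 •
      ({u : ℂ | ‖u‖ ≤ 1}.indicator (fun u => ‖u‖ₑ⁻¹) (Complex.polarCoord.symm p)) ≤
      (Set.Icc (0 : ℝ) 1 ×ˢ Set.Icc (-Real.pi) Real.pi).indicator 1 p := by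
    rintro ⟨r, θ⟩ ⟨hr, hθ⟩
    simp only [Set.mem_Ioi] at hr
    have hn : ‖Complex.polarCoord.symm (r, θ)‖ = r := by
      rw [Complex.norm_polarCoord_symm, abs_of_pos hr]
    by_cases h1 : r ≤ 1
    · rw [Set.indicator_of_mem (by simpa only [Set.mem_ofPred_eq, hn] using h1),
        Set.indicator_of_mem (show (r, θ) ∈ Set.Icc (0 : ℝ) 1 ×ˢ Set.Icc (-Real.pi) Real.pi from
          ⟨⟨hr.le, h1⟩, hθ.1.le, hθ.2.le⟩), ← ofReal_norm, hn,
        smul_eq_mul, ENNReal.mul_inv_cancel (by simpa using hr) ENNReal.ofReal_ne_top]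
      rfl
    · rw [Set.indicator_of_notMem (by simpa only [Set.mem_ofPred_eq, hn] using h1)]
      simp
  refine (setLIntegral_mono' polarCoord.open_target.measurableSet hsub).trans_lt ?_
  refine (setLIntegral_le_lintegral _ _).trans_lt ?_
  rw [lintegral_indicator_one (measurableSet_Icc.prod measurableSet_Icc), Measure.volume_eq_prod,
    Measure.prod_prod]
  simp

/-- A uniform bound for the integrals of `1 / |z - p|` over the unit disc. -/
def discBound : ℝ≥0∞ :=
  (∫⁻ u in {u : ℂ | ‖u‖ ≤ 1}, ‖u‖ₑ⁻¹) + volume {u : ℂ | ‖u‖ ≤ 1}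

lemma setOf_norm_le_one : {u : ℂ | ‖u‖ ≤ 1} = Metric.closedBall 0 1 := by
  ext; simp

lemma discBound_lt_top : discBound < ∞ := by
  refine ENNReal.add_lt_top.2 ⟨lintegral_inv_norm_disc, ?_⟩
  rw [setOf_norm_le_one]
  exact measure_closedBall_lt_top

/-- Within distance one of `p` the integrand is bounded by the translated singularity, farther away
by one. The resulting bound does not depend on `p`. -/
lemma lintegral_inv_norm_sub_le (p : ℂ) :
    ∫⁻ z in {u : ℂ | ‖u‖ ≤ 1}, ‖z - p‖ₑ⁻¹ ≤ discBound := by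
  have hm : MeasurableSet {u : ℂ | ‖u‖ ≤ 1} :=
    (isClosed_le continuous_norm continuous_const).measurableSet
  set F : ℂ → ℝ≥0∞ := {u : ℂ | ‖u‖ ≤ 1}.indicator (fun u => ‖u‖ₑ⁻¹) with hF
  have h1 : ∀ z, ‖z - p‖ₑ⁻¹ ≤ F (z - p) + 1 := by
    intro z
    by_cases h : ‖z - p‖ ≤ 1
    · rw [hF, Set.indicator_of_mem (by simpa using h)]
      exact le_self_add
    · refine le_add_left (ENNReal.inv_le_one.2 ?_)
      rw [← ofReal_norm, ENNReal.one_le_ofReal]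
      exact (not_le.1 h).le
  calc ∫⁻ z in {u : ℂ | ‖u‖ ≤ 1}, ‖z - p‖ₑ⁻¹
      ≤ ∫⁻ z in {u : ℂ | ‖u‖ ≤ 1}, (F (z - p) + 1) := lintegral_mono h1
    _ = (∫⁻ z in {u : ℂ | ‖u‖ ≤ 1}, F (z - p)) + volume {u : ℂ | ‖u‖ ≤ 1} := by
        rw [lintegral_add_right _ measurable_const]; simp
    _ ≤ (∫⁻ z, F (z - p)) + volume {u : ℂ | ‖u‖ ≤ 1} := by
        gcongr; exact Measure.restrict_le_self
    _ = discBound := by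
        rw [lintegral_sub_right_eq_self F p, hF, lintegral_indicator hm]; rfl

/-- Partial fractions: `1/(ab) = (1/a - 1/b) / (b - a)`. The factor 2 is given away. If one of the
three numbers vanishes, the right side is infinite. -/
lemma inv_enorm_mul_le {a b p : ℂ} (h : 2 * p = b - a) :
    ‖a * b‖ₑ⁻¹ ≤ ‖p‖ₑ⁻¹ * (‖a‖ₑ⁻¹ + ‖b‖ₑ⁻¹) := by
  by_cases ha : a = 0
  · simp [ha, ENNReal.mul_top]
  by_cases hb : b = 0
  · simp [hb, ENNReal.mul_top]
  by_cases hp : p = 0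
  · simp [hp, ENNReal.top_mul]
  have ha' : 0 < ‖a‖ := norm_pos_iff.2 ha
  have hb' : 0 < ‖b‖ := norm_pos_iff.2 hb
  have hp' : 0 < ‖p‖ := norm_pos_iff.2 hp
  have hn : 2 * ‖p‖ ≤ ‖b‖ + ‖a‖ := by
    have := norm_sub_le b a
    rw [← h] at this
    simpa using this
  have hab : 0 < ‖a * b‖ := by rw [norm_mul]; positivity
  simp only [← ofReal_norm]
  rw [← ENNReal.ofReal_inv_of_pos ha', ← ENNReal.ofReal_inv_of_pos hb',
    ← ENNReal.ofReal_inv_of_pos hp', ← ENNReal.ofReal_inv_of_pos hab,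
    ← ENNReal.ofReal_add (by positivity) (by positivity), ← ENNReal.ofReal_mul (by positivity)]
  refine ENNReal.ofReal_le_ofReal ?_
  rw [norm_mul, ← sub_nonneg, show ‖p‖⁻¹ * (‖a‖⁻¹ + ‖b‖⁻¹) - (‖a‖ * ‖b‖)⁻¹ =
    (‖b‖ + ‖a‖ - ‖p‖) / (‖p‖ * ‖a‖ * ‖b‖) by field_simp]
  exact div_nonneg (by linarith) (by positivity)

/-- The geometric mean of `‖a‖` and `‖b‖` is at least the smaller of the two. -/
lemma inv_enorm_sqrt_le {a b q : ℂ} (h : ‖q‖ ^ 2 = ‖a * b‖) :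
    ‖q‖ₑ⁻¹ ≤ ‖a‖ₑ⁻¹ + ‖b‖ₑ⁻¹ := by
  rw [norm_mul] at h
  simp only [← ofReal_norm]
  rcases le_total ‖a‖ ‖b‖ with hab | hab
  · refine le_add_right (ENNReal.inv_le_inv.2 (ENNReal.ofReal_le_ofReal ?_))
    exact le_of_sq_le_sq (by rw [h]; nlinarith [norm_nonneg a]) (norm_nonneg q)
  · refine le_add_left (ENNReal.inv_le_inv.2 (ENNReal.ofReal_le_ofReal ?_))
    exact le_of_sq_le_sq (by rw [h]; nlinarith [norm_nonneg b]) (norm_nonneg q)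

lemma quad_cons {n : ℕ} (z : ℂ) (Y : Fin n → ℂ) :
    quad (Fin.cons z Y : Fin (n + 1) → ℂ) = (z - root Y) * (z - -root Y) := by
  have := root_sq Y
  rw [quad, Fin.sum_univ_succ]
  simp only [Fin.cons_zero, Fin.cons_succ]
  rw [← quad]
  linear_combination this

lemma lintegral_inv_quad_cons_le {n : ℕ} (Y : Fin n → ℂ) :
    ∫⁻ z in {u : ℂ | ‖u‖ ≤ 1}, ‖quad (Fin.cons z Y : Fin (n + 1) → ℂ)‖ₑ⁻¹ ≤
      ‖root Y‖ₑ⁻¹ * (discBound + discBound) := by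
  simp_rw [quad_cons]
  refine (lintegral_mono fun z => inv_enorm_mul_le (p := root Y) (by ring)).trans ?_
  rw [lintegral_const_mul _ (by fun_prop), lintegral_add_left (by fun_prop)]
  gcongr <;> exact lintegral_inv_norm_sub_le _

lemma lintegral_inv_root_cons_le {n : ℕ} (Y : Fin n → ℂ) :
    ∫⁻ z in {u : ℂ | ‖u‖ ≤ 1}, ‖root (Fin.cons z Y : Fin (n + 1) → ℂ)‖ₑ⁻¹ ≤
      discBound + discBound := by
  refine (lintegral_mono fun z => inv_enorm_sqrt_le (a := z - root Y) (b := z - -root Y)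
    (by rw [norm_root_sq, quad_cons])).trans ?_
  rw [lintegral_add_left (by fun_prop)]
  gcongr <;> exact lintegral_inv_norm_sub_le _

/-- The closed unit polydisc. -/
def polydisc (n : ℕ) : Set (Fin n → ℂ) := {Z | ∀ i, ‖Z i‖ ≤ 1}

lemma measurableSet_polydisc (n : ℕ) : MeasurableSet (polydisc n) := by
  have : polydisc n = ⋂ i, {Z | ‖Z i‖ ≤ 1} := by ext; simp [polydisc]
  rw [this]
  exact MeasurableSet.iInter fun i =>
    (isClosed_le (by fun_prop) continuous_const).measurableSet

lemma volume_polydisc_lt_top (n : ℕ) : volume (polydisc n) < ∞ := by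
  have : polydisc n ⊆ Metric.closedBall 0 1 := by
    intro Z hZ
    rw [mem_closedBall_zero_iff, pi_norm_le_iff_of_nonneg zero_le_one]
    exact hZ
  exact (measure_mono this).trans_lt measure_closedBall_lt_top

lemma lintegral_polydisc_succ {n : ℕ} {F : (Fin (n + 1) → ℂ) → ℝ≥0∞} (hF : Measurable F) :
    ∫⁻ Z in polydisc (n + 1), F Z =
      ∫⁻ Y in polydisc n, ∫⁻ z in {u : ℂ | ‖u‖ ≤ 1}, F (Fin.cons z Y) := by
  have hm : MeasurableSet {u : ℂ | ‖u‖ ≤ 1} :=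
    (isClosed_le continuous_norm continuous_const).measurableSet
  have e := (volume_preserving_piFinSuccAbove (fun _ : Fin (n + 1) => ℂ) 0).symm
  have hcons : ∀ q : ℂ × (Fin n → ℂ), (MeasurableEquiv.piFinSuccAbove
      (fun _ : Fin (n + 1) => ℂ) 0).symm q = Fin.cons q.1 q.2 := fun q => by
    simp [MeasurableEquiv.piFinSuccAbove, Fin.insertNthEquiv]
  rw [← lintegral_indicator (measurableSet_polydisc _), ← e.lintegral_comp
    (hF.indicator (measurableSet_polydisc _)), Measure.volume_eq_prod,
    lintegral_prod_symm' (fun a => (polydisc (n + 1)).indicator F ((MeasurableEquiv.piFinSuccAbove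
      (fun _ : Fin (n + 1) => ℂ) 0).symm a)) ((hF.indicator (measurableSet_polydisc _)).comp
      (MeasurableEquiv.measurable _)),
    ← lintegral_indicator (measurableSet_polydisc n)]
  refine lintegral_congr fun Y => ?_
  by_cases hY : Y ∈ polydisc n
  · rw [Set.indicator_of_mem hY, ← lintegral_indicator hm]
    refine lintegral_congr fun z => ?_
    rw [hcons]
    have : (Fin.cons z Y : Fin (n + 1) → ℂ) ∈ polydisc (n + 1) ↔ z ∈ {u : ℂ | ‖u‖ ≤ 1} := by
      simp [polydisc, Fin.forall_fin_succ]
      intro _; exact hY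
    by_cases hz : z ∈ {u : ℂ | ‖u‖ ≤ 1}
    · rw [Set.indicator_of_mem hz, Set.indicator_of_mem (this.2 hz)]
    · rw [Set.indicator_of_notMem hz, Set.indicator_of_notMem (fun h => hz (this.1 h))]
  · rw [Set.indicator_of_notMem hY]
    refine (lintegral_congr fun z => ?_).trans lintegral_zero
    rw [hcons, Set.indicator_of_notMem]
    intro h
    exact hY fun i => by simpa using h i.succ

/-- Two variables are integrated out. As a function of the first, `Z · Z` has the two zeros `± root
Y`, and partial fractions leave a multiple of `1 / |root Y|`; this is bounded by a sum of two simple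
singularities in the second variable. With only one variable the integrand would be `1/|z|²`, which
is not integrable. -/
lemma lintegral_inv_quad_lt_top {n : ℕ} (hn : 2 ≤ n) :
    ∫⁻ Z in polydisc n, ‖quad Z‖ₑ⁻¹ < ∞ := by
  obtain ⟨m, rfl⟩ : ∃ m, n = m + 2 := ⟨n - 2, by omega⟩
  have hq : ∀ k, Measurable fun Z : Fin k → ℂ => ‖quad Z‖ₑ⁻¹ := fun k =>
    (continuous_quad (n := k)).measurable.enorm.inv
  have hr : ∀ k, Measurable fun Z : Fin k → ℂ => ‖root Z‖ₑ⁻¹ := fun k =>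
    (measurable_root (n := k)).enorm.inv
  rw [lintegral_polydisc_succ (hq _)]
  refine (lintegral_mono fun Y => lintegral_inv_quad_cons_le Y).trans_lt ?_
  rw [lintegral_mul_const _ (hr _), lintegral_polydisc_succ (hr _)]
  have hfin : discBound + discBound < ∞ := ENNReal.add_lt_top.2 ⟨discBound_lt_top, discBound_lt_top⟩
  refine ENNReal.mul_lt_top ((lintegral_mono fun Y => lintegral_inv_root_cons_le Y).trans_lt ?_) hfin
  rw [lintegral_const]
  exact ENNReal.mul_lt_top hfin (by simpa using volume_polydisc_lt_top m)

lemma baseSet_subset_polydisc (n : ℕ) : baseSet n ⊆ polydisc n := by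
  intro Z hZ i
  have h1 : ‖Z i‖ ^ 2 ≤ ∑ i, ‖Z i‖ ^ 2 :=
    Finset.single_le_sum (f := fun i => ‖Z i‖ ^ 2) (fun _ _ => by positivity) (Finset.mem_univ i)
  have h2 := hZ.2
  have h3 := norm_nonneg (quad Z)
  exact le_of_sq_le_sq (by linarith) zero_le_one

lemma mu_univ (n : ℕ) : mu n Set.univ =
    ∫⁻ Z in baseSet n, ENNReal.ofReal (1 / ‖quad Z‖) * 2 := by
  have := lintegral_mu (n := n) (h := fun _ => 1) measurable_const
  rw [lintegral_one] at this
  rw [this, one_add_one_eq_two]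

lemma mu_univ_lt_top {n : ℕ} (hn : 2 ≤ n) : mu n Set.univ < ∞ := by
  rw [mu_univ, lintegral_mul_const _ measurable_inv_quad]
  refine ENNReal.mul_lt_top ?_ (by simp)
  refine lt_of_le_of_lt ?_ (lintegral_inv_quad_lt_top hn)
  refine (lintegral_mono_set (baseSet_subset_polydisc n)).trans (lintegral_mono fun Z => ?_)
  by_cases h : quad Z = 0
  · simp [h]
  · rw [one_div, ENNReal.ofReal_inv_of_pos (by simpa using h), ofReal_norm]

lemma baseSet_nonempty {n : ℕ} (hn : 1 ≤ n) : (baseSet n).Nonempty := by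
  obtain ⟨p, hp, -, hl⟩ := exists_mem_ball_normSq hn (t := 1 / 2) (by norm_num)
  refine ⟨coord (Fin.last n) p, by rw [quad_coord hp]; simpa using hl, ?_⟩
  have := height_coord hp (Fin.last n)
  rw [height] at this
  rw [this]
  exact hp.2.2

lemma mu_univ_pos {n : ℕ} (hn : 1 ≤ n) : 0 < mu n Set.univ := by
  rw [mu_univ, lintegral_mul_const _ measurable_inv_quad]
  refine ENNReal.mul_pos (ne_of_gt ?_) (by simp)
  rw [setLIntegral_pos_iff measurable_inv_quad]
  refine lt_of_lt_of_le ((isOpen_baseSet n).measure_pos volume (baseSet_nonempty hn))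
    (measure_mono fun Z hZ => ⟨?_, hZ⟩)
  have : 0 < ‖quad Z‖ := norm_pos_iff.2 hZ.1
  simpa using this

lemma mu_ball (n : ℕ) : mu n (ball n) = mu n Set.univ :=
  measure_eq_measure_of_null_sdiff (Set.subset_univ _)
    (by rw [← Set.compl_eq_univ_sdiff]; exact mu_compl_ball n)

end Finite

/-! ### Behaviour of the invariant measure under dilations -/

section Scaling

lemma map_smul_volume {n : ℕ} {c : ℂ} (hc : c ≠ 0) :
    ENNReal.ofReal (‖c‖ ^ (2 * n)) • (volume : Measure (Fin n → ℂ)).map (fun Z => c • Z) =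
      volume := by
  let L : (Fin n → ℂ) →ₗ[ℝ] (Fin n → ℂ) := (c • (LinearMap.id : (Fin n → ℂ) →ₗ[ℂ] _)).restrictScalars ℝ
  have hL : LinearMap.det L = ‖c‖ ^ (2 * n) := by
    rw [LinearMap.det_restrictScalars, LinearMap.det_smul, LinearMap.det_id, Algebra.norm_complex_eq]
    simp [Complex.normSq_eq_norm_sq, ← pow_mul, mul_comm]
  have hc' : 0 < ‖c‖ ^ (2 * n) := pow_pos (norm_pos_iff.2 hc) _
  have := Measure.map_linearMap_addHaar_eq_smul_addHaar (volume : Measure (Fin n → ℂ)) (f := L)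
    (by rw [hL]; exact hc'.ne')
  have h2 : (⇑L) = fun Z => c • Z := by ext; simp [L]
  rw [h2, hL, abs_of_pos (by positivity)] at this
  rw [this, smul_smul, ← ENNReal.ofReal_mul hc'.le, mul_inv_cancel₀ hc'.ne']
  simp

lemma quad_smul {n : ℕ} (c : ℂ) (Z : Fin n → ℂ) : quad (c • Z) = c ^ 2 * quad Z := sum_sq_smul c Z

lemma smul_pt {n : ℕ} (c : ℂ) (Z : Fin n → ℂ) (w : ℂ) : c • pt Z w = pt (c • Z) (c * w) := by
  ext i
  refine Fin.lastCases ?_ (fun i => ?_) i <;> simp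

/-- Sums over the two points above `Z` do not depend on the choice of the square root. -/
lemma sum_sheets {M : Type*} [AddCommMonoid M] {n : ℕ} (h : (Fin (n + 1) → ℂ) → M)
    {Z : Fin n → ℂ} {w : ℂ} (hw : w ^ 2 = -quad Z) :
    h (pt Z (root Z)) + h (pt Z (-root Z)) = h (pt Z w) + h (pt Z (-w)) := by
  rcases eq_or_eq_neg_root hw with rfl | rfl
  · rfl
  · rw [neg_neg, add_comm]

/-- Scaling behaviour of the invariant measure. -/
lemma lintegral_mu_smul {n : ℕ} {c : ℂ} (hc : c ≠ 0) (hc1 : ‖c‖ ≤ 1)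
    {h : (Fin (n + 1) → ℂ) → ℝ≥0∞} (hh : Measurable h) :
    ENNReal.ofReal (‖c‖ ^ (2 * n)) * ∫⁻ z, h (c • z) ∂(mu n) = ENNReal.ofReal (‖c‖ ^ 2) *
      ∫⁻ z in {z | normSq z < ‖c‖ ^ 2}, h z ∂(mu n) := by
  have hcp : 0 < ‖c‖ := norm_pos_iff.2 hc
  have hs : MeasurableSet {z : Fin (n + 1) → ℂ | normSq z < ‖c‖ ^ 2} :=
    (isOpen_lt continuous_normSq continuous_const).measurableSet
  have hi : Measurable ({z : Fin (n + 1) → ℂ | normSq z < ‖c‖ ^ 2}.indicator h) := hh.indicator hs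
  have hb := (isOpen_baseSet n).measurableSet
  have hroot : Measurable fun Z : Fin n → ℂ => h (pt Z (root Z)) :=
    hh.comp (measurable_pt measurable_root)
  have hroot' : Measurable fun Z : Fin n → ℂ => h (pt Z (-root Z)) :=
    hh.comp (measurable_pt measurable_root.neg)
  rw [← lintegral_indicator hs, lintegral_mu hi, lintegral_mu (h := fun z => h (c • z))
      (hh.comp (measurable_const_smul c)),
    ← lintegral_indicator hb, ← lintegral_indicator hb]
  -- `F` is the integrand of the right side on the base. Replacing `Z` by `c Z` turns it into that
  -- of the left side: the density `1 / |Z · Z|` accounts for `‖c‖²` and Lebesgue measure for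
  -- `‖c‖^(2n)`.
  set F : (Fin n → ℂ) → ℝ≥0∞ := (baseSet n ∩ {Z | height Z < ‖c‖ ^ 2}).indicator fun Z =>
    ENNReal.ofReal (1 / ‖quad Z‖) * (h (pt Z (root Z)) + h (pt Z (-root Z))) with hFdef
  have hcont : Continuous (height (n := n)) := by
    have := continuous_quad (n := n)
    unfold height; fun_prop
  have hFm : Measurable F := (measurable_inv_quad.mul (hroot.add hroot')).indicator
    (hb.inter (isOpen_lt hcont continuous_const).measurableSet)
  have e1 : ∀ Z, (baseSet n).indicator (fun Z => ENNReal.ofReal (1 / ‖quad Z‖) *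
      ({z | normSq z < ‖c‖ ^ 2}.indicator h (pt Z (root Z)) +
        {z | normSq z < ‖c‖ ^ 2}.indicator h (pt Z (-root Z)))) Z = F Z := by
    intro Z
    have n1 : normSq (pt Z (root Z)) = height Z := by
      rw [normSq_pt, norm_root_sq, height]
    have n2 : normSq (pt Z (-root Z)) = height Z := by
      rw [normSq_pt, norm_neg, norm_root_sq, height]
    by_cases h1 : Z ∈ baseSet n
    · by_cases h2 : height Z < ‖c‖ ^ 2
      · rw [hFdef, Set.indicator_of_mem h1,
          Set.indicator_of_mem (show Z ∈ baseSet n ∩ {Z | height Z < ‖c‖ ^ 2} from ⟨h1, h2⟩),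
          Set.indicator_of_mem (show pt Z (root Z) ∈ {z | normSq z < ‖c‖ ^ 2} from n1.trans_lt h2),
          Set.indicator_of_mem (show pt Z (-root Z) ∈ {z | normSq z < ‖c‖ ^ 2} from n2.trans_lt h2)]
      · rw [hFdef, Set.indicator_of_mem h1,
          Set.indicator_of_notMem (show Z ∉ baseSet n ∩ {Z | height Z < ‖c‖ ^ 2} from
            fun h => h2 h.2),
          Set.indicator_of_notMem (show pt Z (root Z) ∉ {z | normSq z < ‖c‖ ^ 2} from
            fun h => h2 (n1.symm.trans_lt h)),
          Set.indicator_of_notMem (show pt Z (-root Z) ∉ {z | normSq z < ‖c‖ ^ 2} from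
            fun h => h2 (n2.symm.trans_lt h))]
        simp
    · rw [hFdef, Set.indicator_of_notMem h1, Set.indicator_of_notMem (fun h => h1 h.1)]
  have e2 : ∀ Z, (baseSet n).indicator (fun Z => ENNReal.ofReal (1 / ‖quad Z‖) *
      ((fun z => h (c • z)) (pt Z (root Z)) + (fun z => h (c • z)) (pt Z (-root Z)))) Z =
      ENNReal.ofReal (‖c‖ ^ 2) * F (c • Z) := by
    intro Z
    have hq : quad (c • Z) ≠ 0 ↔ quad Z ≠ 0 := by rw [quad_smul]; simp [hc]
    have hh' : height (c • Z) = ‖c‖ ^ 2 * height Z := by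
      simp [height, quad_smul, mul_add, Finset.mul_sum, mul_pow]
    have hmem : c • Z ∈ baseSet n ∩ {Z | height Z < ‖c‖ ^ 2} ↔ Z ∈ baseSet n := by
      have hlt : height (c • Z) < ‖c‖ ^ 2 ↔ height Z < 1 := by
        rw [hh']; exact mul_lt_iff_lt_one_right (by positivity)
      constructor
      · rintro ⟨h1, h2⟩
        exact ⟨hq.1 h1.1, hlt.1 h2⟩
      · rintro ⟨h1, h2⟩
        have h3 := hlt.2 h2
        exact ⟨⟨hq.2 h1, h3.trans_le (pow_le_one₀ (norm_nonneg _) hc1)⟩, h3⟩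
    by_cases h1 : Z ∈ baseSet n
    · rw [hFdef, Set.indicator_of_mem h1, Set.indicator_of_mem (hmem.2 h1)]
      -- The number `c * root Z` is a square root of `-(cZ · cZ)` but not necessarily the principal
      -- one; the sum over both sheets does not see the difference.
      rw [sum_sheets h (w := c * root Z) (by rw [quad_smul, mul_pow, root_sq]; ring)]
      simp only [smul_pt, mul_neg]
      rw [← mul_assoc, ← ENNReal.ofReal_mul (by positivity), quad_smul, norm_mul, norm_pow]
      congr 2
      field_simp
    · rw [hFdef, Set.indicator_of_notMem h1, Set.indicator_of_notMem (fun h => h1 (hmem.1 h)),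
        mul_zero]
  have e2' : ∫⁻ Z, (baseSet n).indicator (fun Z => ENNReal.ofReal (1 / ‖quad Z‖) *
      ((fun z => h (c • z)) (pt Z (root Z)) + (fun z => h (c • z)) (pt Z (-root Z)))) Z =
      ENNReal.ofReal (‖c‖ ^ 2) * ∫⁻ Z, F (c • Z) := by
    rw [lintegral_congr e2]
    exact lintegral_const_mul _ (hFm.comp (measurable_const_smul c))
  rw [lintegral_congr e1]
  refine (congrArg _ e2').trans ?_
  rw [mul_left_comm]
  congr 1
  conv_rhs => rw [← map_smul_volume hc]
  rw [lintegral_smul_measure, lintegral_map hFm (measurable_const_smul c), smul_eq_mul]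

end Scaling

end Kepler
end

/-! ### Integration in polar coordinates -/

noncomputable section
namespace Kepler
open MeasureTheory
open scoped ComplexOrder ENNReal ComplexConjugate

section Polar

lemma lintegral_mu_circle {n : ℕ} {c : ℂ} (hc : ‖c‖ = 1) {h : (Fin (n + 1) → ℂ) → ℝ≥0∞}
    (hh : Measurable h) : ∫⁻ z, h (c • z) ∂(mu n) = ∫⁻ z, h z ∂(mu n) := by
  have h1 := lintegral_mu_smul (n := n) (c := c) (by rintro rfl; simp at hc) hc.le hh
  rw [hc] at h1
  simp only [one_pow, ENNReal.ofReal_one, one_mul] at h1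
  rw [h1]
  rw [Measure.restrict_eq_self_of_ae_mem
    (by filter_upwards [ae_mem_ball n] with z hz using hz.2.2)]

lemma lintegral_Ioo_pow (m : ℕ) {a : ℝ} (ha : 0 ≤ a) :
    ∫⁻ t in Set.Ioo 0 a, ENNReal.ofReal ((m + 1) * t ^ m) = ENNReal.ofReal (a ^ (m + 1)) := by
  rw [← ofReal_integral_eq_lintegral_ofReal]
  · rw [← integral_Ioc_eq_integral_Ioo, ← intervalIntegral.integral_of_le ha,
      intervalIntegral.integral_const_mul, integral_pow]
    congr 1
    have : (m : ℝ) + 1 ≠ 0 := by positivity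
    field_simp
    simp
  · have : Continuous fun t : ℝ => ((m : ℝ) + 1) * t ^ m := by fun_prop
    exact (this.integrableOn_Icc).mono_set Set.Ioo_subset_Icc_self
  · filter_upwards [ae_restrict_mem measurableSet_Ioo] with t ht
    have := ht.1.le
    positivity

/-- This is the scaling formula for `c = √a`, where homogeneity of `h` pulls out `a^k`. One factor
`a` cancels against the right side of that formula, hence the exponent `n - 1 + k`. -/
lemma lintegral_normSq_lt {n : ℕ} (hn : 1 ≤ n) {k : ℕ} {h : (Fin (n + 1) → ℂ) → ℝ≥0∞}
    (hh : Measurable h) (hom : ∀ z ∈ ball n, ∀ r ∈ Set.Ioo (0 : ℝ) 1,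
      h ((r : ℂ) • z) = ENNReal.ofReal (r ^ (2 * k)) * h z) {a : ℝ} (ha : a ∈ Set.Ioo (0 : ℝ) 1) :
    ∫⁻ z in {z | normSq z < a}, h z ∂(mu n) =
      ENNReal.ofReal (a ^ (n - 1 + k)) * ∫⁻ z, h z ∂(mu n) := by
  have hs : √a ∈ Set.Ioo (0 : ℝ) 1 :=
    ⟨Real.sqrt_pos.2 ha.1, by rw [Real.sqrt_lt' one_pos]; simpa using ha.2⟩
  have hsn : ‖((√a : ℝ) : ℂ)‖ = √a := by
    rw [Complex.norm_real, Real.norm_eq_abs, abs_of_pos hs.1]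
  have h1 := lintegral_mu_smul (n := n) (c := ((√a : ℝ) : ℂ))
    (by exact_mod_cast hs.1.ne') (by rw [hsn]; exact hs.2.le) hh
  have h2 : ∫⁻ z, h (((√a : ℝ) : ℂ) • z) ∂(mu n) =
      ENNReal.ofReal (√a ^ (2 * k)) * ∫⁻ z, h z ∂(mu n) := by
    rw [← lintegral_const_mul _ hh]
    refine lintegral_congr_ae ?_
    filter_upwards [ae_mem_ball n] with z hz using hom z hz _ hs
  rw [h2, hsn, pow_mul, pow_mul, Real.sq_sqrt ha.1.le, ← mul_assoc,
    ← ENNReal.ofReal_mul (by have := ha.1; positivity), ← pow_add] at h1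
  have h3 : n + k = (n - 1 + k) + 1 := by omega
  rw [h3, pow_succ', ENNReal.ofReal_mul ha.1.le, mul_assoc] at h1
  exact ((ENNReal.mul_right_inj (by simpa using ha.1) ENNReal.ofReal_ne_top).1 h1).symm

/-- Integration in polar coordinates of a homogeneous function times a radial function. -/
lemma lintegral_mu_radial {n : ℕ} (hn : 2 ≤ n) {k : ℕ} {h : (Fin (n + 1) → ℂ) → ℝ≥0∞}
    (hh : Measurable h) (hom : ∀ z ∈ ball n, ∀ r ∈ Set.Ioo (0 : ℝ) 1,
      h ((r : ℂ) • z) = ENNReal.ofReal (r ^ (2 * k)) * h z) (hfin : ∫⁻ z, h z ∂(mu n) ≠ ∞)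
    {φ : ℝ → ℝ≥0∞} (hφ : Measurable φ) :
    ∫⁻ z, h z * φ (normSq z) ∂(mu n) = ENNReal.ofReal ((k + n - 1 : ℕ) : ℝ) *
      (∫⁻ z, h z ∂(mu n)) * ∫⁻ t in Set.Ioo 0 1, ENNReal.ofReal (t ^ (k + n - 2)) * φ t := by
  set I := ∫⁻ z, h z ∂(mu n)
  set m := k + n - 2
  have hm : k + n - 1 = m + 1 := by omega
  set w : ℝ → ℝ≥0∞ := fun t => ENNReal.ofReal ((m + 1) * t ^ m)
  have hw : Measurable w := by fun_prop
  have hns : Measurable (normSq (n := n)) := continuous_normSq.measurable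
  set m1 : Measure ℝ := ((mu n).withDensity h).map normSq
  set m2 : Measure ℝ := I • (volume.restrict (Set.Ioo 0 1)).withDensity w
  have hm1u : m1 Set.univ = I := by
    rw [Measure.map_apply hns MeasurableSet.univ, Set.preimage_univ,
      withDensity_apply _ MeasurableSet.univ, Measure.restrict_univ]
  have hm1 : ∀ a, m1 (Set.Iio a) = ∫⁻ z in {z | normSq z < a}, h z ∂(mu n) := by
    intro a
    rw [Measure.map_apply hns measurableSet_Iio, withDensity_apply _ (hns measurableSet_Iio)]
    rfl
  have hm2 : ∀ a, m2 (Set.Iio a) = I * ∫⁻ t in Set.Iio a ∩ Set.Ioo 0 1, w t := by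
    intro a
    rw [Measure.smul_apply, withDensity_apply _ measurableSet_Iio,
      Measure.restrict_restrict measurableSet_Iio, smul_eq_mul]
  have hw1 : ∫⁻ t in Set.Ioo 0 1, w t = 1 := by
    rw [lintegral_Ioo_pow m zero_le_one]; simp
  have hm2u : m2 Set.univ = I := by
    rw [Measure.smul_apply, withDensity_apply _ MeasurableSet.univ, Measure.restrict_univ, hw1,
      smul_eq_mul, mul_one]
  have : IsFiniteMeasure m1 := ⟨by rw [hm1u]; exact hfin.lt_top⟩
  have heq : m1 = m2 := by
    refine ext_of_generate_finite (Set.range Set.Iio) (borel_eq_generateFrom_Iio ℝ ▸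
      (BorelSpace.measurable_eq (α := ℝ))) isPiSystem_Iio ?_ (by rw [hm1u, hm2u])
    rintro _ ⟨a, rfl⟩
    rw [hm1, hm2]
    rcases le_or_gt a 0 with h0 | h0
    · have e1 : Set.Iio a ∩ Set.Ioo (0 : ℝ) 1 = ∅ := by
        ext t; simp only [Set.mem_inter_iff, Set.mem_Iio, Set.mem_Ioo, Set.mem_empty_iff_false]
        constructor
        · rintro ⟨h1, h2, -⟩; linarith
        · simp
      have e2 : {z : Fin (n + 1) → ℂ | normSq z < a} = ∅ := by
        ext z; simpa using h0.trans (normSq_nonneg z)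
      simp [e1, e2]
    rcases lt_or_ge a 1 with h1 | h1
    · have e1 : Set.Iio a ∩ Set.Ioo (0 : ℝ) 1 = Set.Ioo 0 a := by
        ext t; simp only [Set.mem_inter_iff, Set.mem_Iio, Set.mem_Ioo]
        constructor
        · rintro ⟨h1, h2, -⟩; exact ⟨h2, h1⟩
        · rintro ⟨h2, h3⟩; exact ⟨h3, h2, h3.trans h1⟩
      rw [e1, lintegral_Ioo_pow m h0.le, lintegral_normSq_lt (by omega) hh hom ⟨h0, h1⟩, mul_comm,
        show n - 1 + k = m + 1 by omega]
    · have e1 : Set.Iio a ∩ Set.Ioo (0 : ℝ) 1 = Set.Ioo 0 1 := by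
        ext t; simp only [Set.mem_inter_iff, Set.mem_Iio, Set.mem_Ioo]
        constructor
        · rintro ⟨-, h⟩; exact h
        · rintro ⟨h2, h3⟩; exact ⟨h3.trans_le h1, h2, h3⟩
      rw [e1, hw1, mul_one]
      rw [Measure.restrict_eq_self_of_ae_mem
        (by filter_upwards [ae_mem_ball n] with z hz using hz.2.2.trans_le h1)]
  have h1 : ∫⁻ z, h z * φ (normSq z) ∂(mu n) = ∫⁻ t, φ t ∂m1 := by
    rw [lintegral_map hφ hns]
    exact (lintegral_withDensity_eq_lintegral_mul _ hh (hφ.comp hns)).symm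
  have h2 : ∀ t ∈ Set.Ioo (0 : ℝ) 1, (w * φ) t = ENNReal.ofReal ((m + 1 : ℕ) : ℝ) *
      (ENNReal.ofReal (t ^ m) * φ t) := by
    intro t ht
    simp only [w, Pi.mul_apply]
    rw [ENNReal.ofReal_mul (by positivity), mul_assoc]
    push_cast
    rfl
  rw [h1, heq, lintegral_smul_measure, lintegral_withDensity_eq_lintegral_mul _ hw hφ,
    setLIntegral_congr_fun measurableSet_Ioo h2, lintegral_const_mul _ (by fun_prop), smul_eq_mul,
    hm]
  ring

end Polar

end Kepler
end

/-! ### Null sets defined by quadratic conditions -/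

noncomputable section
namespace Kepler
open MeasureTheory
open scoped ComplexOrder ENNReal ComplexConjugate

section Null

lemma finite_quadratic_zeros {a : ℂ} (ha : a ≠ 0) (b c : ℂ) :
    {t : ℝ | a * (t : ℂ) ^ 2 + b * t + c = 0}.Finite := by
  open Polynomial in
  set p : ℂ[X] := C a * X ^ 2 + C b * X + C c with hp
  have hp0 : p ≠ 0 := by
    intro h
    have := congrArg (fun q => q.coeff 2) h
    simp [hp] at this
    exact ha (by simpa [Polynomial.coeff_X, Polynomial.coeff_C] using this)
  refine Set.Finite.subset (Set.Finite.preimage (f := fun t : ℝ => (t : ℂ))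
    Complex.ofReal_injective.injOn (Polynomial.finite_setOfPred_isRoot hp0)) fun t ht => ?_
  simpa [Polynomial.IsRoot, hp] using ht

/-- On every real line of direction `e` the function is a polynomial of degree two with the same
nonzero leading coefficient, so it has finitely many zeros there; Fubini along these lines gives the
claim. -/
lemma volume_zero_of_quadratic {n : ℕ} {g : (Fin n → ℂ) → ℂ} (hg : Continuous g)
    {a : ℂ} (ha : a ≠ 0) (e : Fin n → ℂ)
    (h : ∀ Z, ∃ b c : ℂ, ∀ t : ℝ, g (Z + (t : ℂ) • e) = a * (t : ℂ) ^ 2 + b * t + c) :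
    ∀ᵐ Z : Fin n → ℂ, g Z ≠ 0 := by
  let L : ℝ →ₗ[ℝ] (Fin n → ℂ) := LinearMap.toSpanSingleton ℝ _ e
  refine ae_mem_of_ae_add_linearMap_mem (s := {Z | g Z ≠ 0}) L volume volume
    (isOpen_ne_fun hg continuous_const).measurableSet fun Z => ?_
  obtain ⟨b, c, hbc⟩ := h Z
  have hfin := (finite_quadratic_zeros ha b c).measure_zero volume
  refine measure_mono_null (fun t ht => ?_) hfin
  simp only [Set.mem_compl_iff, Set.mem_ofPred_eq, not_not] at ht
  have : Z + L t = Z + (t : ℂ) • e := by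
    simp [L, LinearMap.toSpanSingleton_apply]
  rw [Set.mem_ofPred_eq, ← hbc, ← this]
  simpa using ht

lemma quad_add_smul {n : ℕ} (Z e : Fin n → ℂ) (t : ℂ) :
    quad (Z + t • e) = quad e * t ^ 2 + (2 * ∑ i, Z i * e i) * t + quad Z := by
  simp only [quad, Pi.add_apply, Pi.smul_apply, smul_eq_mul, Finset.mul_sum, Finset.sum_mul,
    ← Finset.sum_add_distrib]
  exact Finset.sum_congr rfl fun i _ => by ring

lemma quad_single {n : ℕ} (i : Fin n) (a : ℂ) : quad (Pi.single i a : Fin n → ℂ) = a ^ 2 := by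
  rw [quad, Finset.sum_eq_single i (fun j _ hj => by simp [hj]) (by simp)]
  simp

/-- The branch cut lies in the set where `Im (Z · Z) = 0`. With `ω² = i`, moving along `ω` times a
basis vector makes `Im (Z · Z)` a monic quadratic polynomial in the real parameter. -/
lemma ae_neg_quad_mem_slitPlane {n : ℕ} (hn : 1 ≤ n) :
    ∀ᵐ Z : Fin n → ℂ, -quad Z ∈ Complex.slitPlane := by
  obtain ⟨ω, hω⟩ : ∃ ω : ℂ, ω ^ 2 = Complex.I :=
    IsAlgClosed.exists_pow_nat_eq _ two_pos
  let i : Fin n := ⟨0, hn⟩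
  have := volume_zero_of_quadratic (n := n) (g := fun Z => ((quad Z).im : ℂ))
    (by have := continuous_quad (n := n); fun_prop) one_ne_zero (Pi.single i ω) fun Z =>
    ⟨((2 * ∑ j, Z j * (Pi.single i ω : Fin n → ℂ) j).im : ℝ), ((quad Z).im : ℝ), fun t => by
      rw [quad_add_smul, quad_single, hω]
      rw [Complex.add_im, Complex.add_im, Complex.mul_im (2 * _) (t : ℂ)]
      simp [← Complex.ofReal_pow]⟩
  filter_upwards [this] with Z hZ
  refine Or.inr ?_
  simpa using hZ

end Null

/-! ### Invariance under real reflections -/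

section Reflection

variable {n : ℕ}

/-- The (complexified) reflection in the hyperplane orthogonal to the real unit vector `v`. -/
def refl (v : Fin (n + 1) → ℝ) (z : Fin (n + 1) → ℂ) : Fin (n + 1) → ℂ :=
  fun i => z i - 2 * (∑ j, (v j : ℂ) * z j) * v i

lemma sum_mul_refl {v : Fin (n + 1) → ℝ} (hv : ∑ i, v i ^ 2 = 1) (z : Fin (n + 1) → ℂ) :
    ∑ j, (v j : ℂ) * refl v z j = -∑ j, (v j : ℂ) * z j := by
  have hv' : ∑ i, (v i : ℂ) ^ 2 = 1 := by exact_mod_cast congrArg (fun x : ℝ => (x : ℂ)) hv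
  have : ∀ j, (v j : ℂ) * refl v z j =
      v j * z j - (2 * ∑ j, (v j : ℂ) * z j) * (v j : ℂ) ^ 2 := by
    intro j; rw [refl]; ring
  simp only [this, Finset.sum_sub_distrib, ← Finset.mul_sum, hv']
  ring

lemma refl_refl {v : Fin (n + 1) → ℝ} (hv : ∑ i, v i ^ 2 = 1) (z : Fin (n + 1) → ℂ) :
    refl v (refl v z) = z := by
  ext i
  rw [refl, sum_mul_refl hv, refl]
  ring

lemma sum_sq_refl {v : Fin (n + 1) → ℝ} (hv : ∑ i, v i ^ 2 = 1) (z : Fin (n + 1) → ℂ) :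
    ∑ i, refl v z i ^ 2 = ∑ i, z i ^ 2 := by
  have hv' : ∑ i, (v i : ℂ) ^ 2 = 1 := by exact_mod_cast congrArg (fun x : ℝ => (x : ℂ)) hv
  set s := ∑ j, (v j : ℂ) * z j with hs
  have : ∀ j, refl v z j ^ 2 = z j ^ 2 - 4 * s * (v j * z j) + 4 * s ^ 2 * (v j : ℂ) ^ 2 := by
    intro j; rw [refl]; ring
  simp only [this, Finset.sum_add_distrib, Finset.sum_sub_distrib, ← Finset.mul_sum, hv', ← hs]
  ring

lemma normSq_refl {v : Fin (n + 1) → ℝ} (hv : ∑ i, v i ^ 2 = 1) (z : Fin (n + 1) → ℂ) :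
    normSq (refl v z) = normSq z := by
  have hv' : ∑ i, (v i : ℂ) ^ 2 = 1 := by exact_mod_cast congrArg (fun x : ℝ => (x : ℂ)) hv
  set s := ∑ j, (v j : ℂ) * z j with hs
  have hs' : ∑ j, (v j : ℂ) * conj (z j) = conj s := by simp [hs]
  have key : ((normSq (refl v z) : ℝ) : ℂ) = (normSq z : ℝ) := by
    rw [normSq, normSq, ← sum_norm_sq_eq, ← sum_norm_sq_eq]
    have : ∀ j, refl v z j * conj (refl v z j) = z j * conj (z j) - 2 * conj s * (v j * z j) -
        2 * s * (v j * conj (z j)) + 4 * (s * conj s) * (v j : ℂ) ^ 2 := by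
      intro j
      rw [refl, ← hs]
      simp only [map_sub, map_mul, Complex.conj_ofReal, map_ofNat]
      ring
    simp only [this, Finset.sum_add_distrib, Finset.sum_sub_distrib, ← Finset.mul_sum, hv', ← hs,
      hs']
    ring
  exact_mod_cast key

lemma continuous_refl (v : Fin (n + 1) → ℝ) : Continuous (refl v) := by
  unfold refl; fun_prop

lemma refl_mem_ball {v : Fin (n + 1) → ℝ} (hv : ∑ i, v i ^ 2 = 1) {z : Fin (n + 1) → ℂ}
    (hz : z ∈ ball n) : refl v z ∈ ball n := by
  refine ⟨by rw [sum_sq_refl hv, hz.1], fun h => hz.2.1 ?_, by rw [normSq_refl hv]; exact hz.2.2⟩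
  rw [← normSq_eq_zero, ← normSq_refl hv, h, normSq_eq_zero]

/-- The first coordinates of the reflection of the point `sheet s Z`. -/
def reflBase (v : Fin (n + 1) → ℝ) (s : Fin 2) (Z : Fin n → ℂ) : Fin n → ℂ :=
  fun i => refl v (sheet (Fin.last n) s Z) i.castSucc

/-- The last coordinate of the reflection of the point `sheet s Z`. -/
def reflLast (v : Fin (n + 1) → ℝ) (s : Fin 2) (Z : Fin n → ℂ) : ℂ :=
  refl v (sheet (Fin.last n) s Z) (Fin.last n)

lemma pt_reflBase (v : Fin (n + 1) → ℝ) (s : Fin 2) (Z : Fin n → ℂ) :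
    pt (reflBase v s Z) (reflLast v s Z) = refl v (sheet (Fin.last n) s Z) := pt_init _

lemma sum_sq_sheet (s : Fin 2) (Z : Fin n → ℂ) : ∑ i, sheet (Fin.last n) s Z i ^ 2 = 0 := by
  rw [sheet_last, sum_sq_pt, sheet_last_sq, add_neg_cancel]

lemma reflLast_sq {v : Fin (n + 1) → ℝ} (hv : ∑ i, v i ^ 2 = 1) (s : Fin 2) (Z : Fin n → ℂ) :
    reflLast v s Z ^ 2 = -quad (reflBase v s Z) := by
  have := sum_sq_refl hv (sheet (Fin.last n) s Z)
  rw [sum_sq_sheet, ← pt_reflBase, sum_sq_pt] at this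
  linear_combination this

lemma reflLast_eq (v : Fin (n + 1) → ℝ) (s : Fin 2) (Z : Fin n → ℂ) :
    reflLast v s Z = (1 - 2 * (v (Fin.last n) : ℂ) ^ 2) * ((-1) ^ (s : ℕ) * root Z) -
      2 * v (Fin.last n) * ∑ j : Fin n, (v j.castSucc : ℂ) * Z j := by
  rw [reflLast, refl, Fin.sum_univ_castSucc, sheet_last]
  simp only [pt_last, pt_castSucc]
  ring

/-- Vanishing of the last coordinate of the reflected point equates a multiple of `root Z` with a
linear form; squaring removes the root and leaves the zero set of a quadratic form in `Z`. -/
lemma ae_reflLast_ne_zero (hn : 1 ≤ n) {v : Fin (n + 1) → ℝ} (hv : ∑ i, v i ^ 2 = 1) (s : Fin 2) :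
    ∀ᵐ Z : Fin n → ℂ, reflLast v s Z ≠ 0 := by
  set a := v (Fin.last n) with ha
  have hsum : ∑ j : Fin n, v j.castSucc ^ 2 = 1 - a ^ 2 := by
    rw [Fin.sum_univ_castSucc] at hv; linarith
  -- The form is a sum of squares on real vectors. If `a² = 1/2`, the remaining coordinates of `v`
  -- have squared length `1/2` and give the value `1/2`; otherwise a basis vector already makes the
  -- first term positive.
  obtain ⟨e, he⟩ : ∃ e : Fin n → ℝ, (1 - 2 * a ^ 2) ^ 2 * ∑ i, e i ^ 2 +
      4 * a ^ 2 * (∑ j : Fin n, v j.castSucc * e j) ^ 2 ≠ 0 := by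
    by_cases h : 1 - 2 * a ^ 2 = 0
    · refine ⟨fun j => v j.castSucc, ?_⟩
      simp only [← sq, hsum, h]
      have : a ^ 2 = 1 / 2 := by linarith
      rw [this]; norm_num
    · refine ⟨Pi.single ⟨0, hn⟩ 1, ne_of_gt ?_⟩
      rw [Finset.sum_eq_single ⟨0, hn⟩ (fun i _ hi => by simp [hi]) (by simp)]
      simp only [Pi.single_eq_same]
      positivity
  set S : (Fin n → ℂ) → ℂ := fun Z => ∑ j : Fin n, (v j.castSucc : ℂ) * Z j with hS
  have h1 := volume_zero_of_quadratic (n := n)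
    (g := fun Z => (1 - 2 * (a : ℂ) ^ 2) ^ 2 * quad Z + 4 * (a : ℂ) ^ 2 * S Z ^ 2)
    (by have := continuous_quad (n := n); simp only [hS]; fun_prop)
    (a := (((1 - 2 * a ^ 2) ^ 2 * ∑ i, e i ^ 2 +
      4 * a ^ 2 * (∑ j : Fin n, v j.castSucc * e j) ^ 2 : ℝ) : ℂ)) (by exact_mod_cast he)
    (fun i => (e i : ℂ)) fun Z =>
      ⟨(1 - 2 * (a : ℂ) ^ 2) ^ 2 * (2 * ∑ i, Z i * e i) + 8 * (a : ℂ) ^ 2 *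
        (S Z * S fun i => (e i : ℂ)), (1 - 2 * (a : ℂ) ^ 2) ^ 2 * quad Z + 4 * (a : ℂ) ^ 2 * S Z ^ 2,
        fun t => by
      have h2 : S (Z + (t : ℂ) • fun i => (e i : ℂ)) = S Z + t * S fun i => (e i : ℂ) := by
        simp only [hS, Pi.add_apply, Pi.smul_apply, smul_eq_mul, mul_add, Finset.sum_add_distrib,
          Finset.mul_sum]
        congr 1
        exact Finset.sum_congr rfl fun i _ => by ring
      simp only [h2, quad_add_smul]
      simp only [hS, quad]
      push_cast
      ring⟩
  filter_upwards [h1] with Z hZ h0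
  apply hZ
  rw [reflLast_eq, sub_eq_zero] at h0
  have h3 := congrArg (fun x => x ^ 2) h0
  rw [mul_pow, sheet_last_sq] at h3
  simp only [hS]
  linear_combination -h3

lemma hasFDerivAt_root {Z : Fin n → ℂ} (hZ : -quad Z ∈ Complex.slitPlane) :
    HasFDerivAt root (∑ i, (-Z i / root Z) • (ContinuousLinearMap.proj (R := ℂ)
      (φ := fun _ : Fin n => ℂ) i)) Z := by
  have h1 := (hasFDerivAt_quad Z).neg
  have hr : root Z ≠ 0 := by
    rw [Ne, root_eq_zero]
    exact fun h => Complex.slitPlane_ne_zero hZ (by rw [h, neg_zero])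
  have h2 := ((hasDerivAt_id (-quad Z)).cpow_const (c := 1 / 2) hZ).comp_hasFDerivAt Z h1
  refine h2.congr_fderiv ?_
  have h3 : (-quad Z) ^ ((1 / 2 : ℂ) - 1) = (root Z)⁻¹ := by
    rw [root, ← Complex.cpow_neg]; norm_num
  ext v
  simp only [id, h3]
  simp only [smul_apply, neg_apply, sum_apply, ContinuousLinearMap.proj_apply, smul_eq_mul,
    ← Finset.sum_neg_distrib, Finset.mul_sum]
  refine Finset.sum_congr rfl fun i _ => ?_
  field_simp

lemma hasFDerivAt_reflBase {v : Fin (n + 1) → ℝ} (s : Fin 2) {Z : Fin n → ℂ}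
    (hZ : -quad Z ∈ Complex.slitPlane) :
    HasFDerivAt (reflBase v s) (ContinuousLinearMap.id ℂ (Fin n → ℂ) +
      (∑ i : Fin n, (-2 * ((v i.castSucc : ℂ) + v (Fin.last n) * ((-1) ^ (s : ℕ) * (-Z i / root Z)))) •
        (ContinuousLinearMap.proj (R := ℂ) (φ := fun _ : Fin n => ℂ) i)).smulRight
          (fun i => (v i.castSucc : ℂ))) Z := by
  rw [hasFDerivAt_pi']
  intro i
  have hb : (fun Y => reflBase v s Y i) = fun Y : Fin n → ℂ => Y i -
      2 * (∑ j : Fin n, (v j.castSucc : ℂ) * Y j + v (Fin.last n) * ((-1) ^ (s : ℕ) * root Y)) *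
        v i.castSucc := by
    ext Y
    rw [reflBase, refl, Fin.sum_univ_castSucc, sheet_last]
    simp only [pt_last, pt_castSucc]
  rw [hb]
  have h1 := hasFDerivAt_apply (𝕜 := ℂ) (F' := fun _ : Fin n => ℂ) i Z
  have h2 : HasFDerivAt (fun Y : Fin n → ℂ => ∑ j : Fin n, (v j.castSucc : ℂ) * Y j)
      (∑ j : Fin n, (v j.castSucc : ℂ) • ContinuousLinearMap.proj (R := ℂ)
        (φ := fun _ : Fin n => ℂ) j) Z :=
    HasFDerivAt.fun_sum fun j _ =>
      (hasFDerivAt_apply (𝕜 := ℂ) (F' := fun _ : Fin n => ℂ) j Z).const_mul _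
  have h3 := ((hasFDerivAt_root hZ).const_mul ((-1 : ℂ) ^ (s : ℕ))).const_mul (v (Fin.last n) : ℂ)
  refine (h1.sub (((h2.add h3).const_mul 2).mul_const (v i.castSucc : ℂ))).congr_fderiv ?_
  ext x
  have key : ∑ j : Fin n, (-2 * ((v j.castSucc : ℂ) +
      v (Fin.last n) * ((-1) ^ (s : ℕ) * (-Z j / root Z)))) * x j =
      -2 * (∑ j : Fin n, (v j.castSucc : ℂ) * x j +
        v (Fin.last n) * ((-1) ^ (s : ℕ) * ∑ j : Fin n, (-Z j / root Z) * x j)) := by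
    rw [Finset.mul_sum, Finset.mul_sum, ← Finset.sum_add_distrib, Finset.mul_sum]
    exact Finset.sum_congr rfl fun j _ => by ring
  simp only [sub_apply, add_apply, smul_apply, sum_apply, ContinuousLinearMap.proj_apply,
    ContinuousLinearMap.comp_apply, ContinuousLinearMap.smulRight_apply, Pi.add_apply,
    Pi.smul_apply, smul_eq_mul, ContinuousLinearMap.coe_id', id, key]
  ring

/-- The differential is the identity plus a map of rank one, so its complex determinant is `1 +
ℓ(v)`, which up to sign is the quotient of the new last coordinate by the old one. The real Jacobian
is the squared modulus of this, and exactly compensates the change of the density `1 / |Z · Z|`. -/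
lemma abs_det_reflBase {v : Fin (n + 1) → ℝ} (hv : ∑ i, v i ^ 2 = 1) (s : Fin 2) {Z : Fin n → ℂ}
    (hZ : -quad Z ∈ Complex.slitPlane) :
    |((fderiv ℂ (reflBase v s) Z).restrictScalars ℝ).det| =
      ‖quad (reflBase v s Z)‖ / ‖quad Z‖ := by
  have hr : root Z ≠ 0 := by
    rw [Ne, root_eq_zero]
    exact fun h => Complex.slitPlane_ne_zero hZ (by rw [h, neg_zero])
  have hv' : ∑ i, (v i : ℂ) ^ 2 = 1 := by exact_mod_cast congrArg (fun x : ℝ => (x : ℂ)) hv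
  rw [(hasFDerivAt_reflBase s hZ).fderiv]
  set ℓ : (Fin n → ℂ) →L[ℂ] ℂ := ∑ i : Fin n,
    (-2 * ((v i.castSucc : ℂ) + v (Fin.last n) * ((-1) ^ (s : ℕ) * (-Z i / root Z)))) •
        (ContinuousLinearMap.proj (R := ℂ) (φ := fun _ : Fin n => ℂ) i) with hℓ
  have hdet : LinearMap.det ((ContinuousLinearMap.id ℂ (Fin n → ℂ) +
      ℓ.smulRight fun i => (v i.castSucc : ℂ) : (Fin n → ℂ) →L[ℂ] _) : (Fin n → ℂ) →ₗ[ℂ] _) =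
      1 + ℓ fun i => (v i.castSucc : ℂ) :=
    LinearMap.transvection.det (ℓ : (Fin n → ℂ) →ₗ[ℂ] ℂ) _
  have hval : (root Z) * (1 + ℓ fun i => (v i.castSucc : ℂ)) = -((-1) ^ (s : ℕ) * reflLast v s Z) := by
    have e1 : ℓ (fun i => (v i.castSucc : ℂ)) = -2 * ∑ i : Fin n, (v i.castSucc : ℂ) ^ 2 +
        2 * v (Fin.last n) * (-1) ^ (s : ℕ) / root Z * ∑ i : Fin n, (v i.castSucc : ℂ) * Z i := by
      simp only [hℓ, sum_apply, smul_apply, ContinuousLinearMap.proj_apply, smul_eq_mul]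
      rw [Finset.mul_sum, Finset.mul_sum, ← Finset.sum_add_distrib]
      exact Finset.sum_congr rfl fun i _ => by ring
    rw [Fin.sum_univ_castSucc] at hv'
    have hs1 : ((-1 : ℂ) ^ (s : ℕ)) * (-1) ^ (s : ℕ) = 1 := by
      rw [← mul_pow]; simp
    rw [e1, reflLast_eq]
    field_simp
    linear_combination (-2 * root Z) * hv' - (-1 + 2 * (v (Fin.last n) : ℂ) ^ 2) * root Z * hs1
  have hnorm : ‖1 + ℓ fun i => (v i.castSucc : ℂ)‖ ^ 2 = ‖quad (reflBase v s Z)‖ / ‖quad Z‖ := by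
    have h1 := congrArg (fun x => ‖x‖ ^ 2) hval
    simp only [norm_mul, norm_neg, norm_pow, norm_one, one_pow, one_mul, mul_pow,
      norm_root_sq] at h1
    rw [← norm_pow (reflLast v s Z), reflLast_sq hv, norm_neg] at h1
    have hq : ‖quad Z‖ ≠ 0 := by
      rw [norm_ne_zero_iff]
      intro h; exact hr ((root_eq_zero Z).2 h)
    rw [← h1]; field_simp
  change |LinearMap.det (LinearMap.restrictScalars ℝ ((ContinuousLinearMap.id ℂ (Fin n → ℂ) +
      ℓ.smulRight fun i => (v i.castSucc : ℂ) : (Fin n → ℂ) →L[ℂ] _) : (Fin n → ℂ) →ₗ[ℂ] _))| = _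
  rw [LinearMap.det_restrictScalars, hdet, Algebra.norm_complex_eq, ← hnorm]
  simp [Complex.normSq_eq_norm_sq]

lemma measurable_reflBase (v : Fin (n + 1) → ℝ) (s : Fin 2) : Measurable (reflBase v s) :=
  measurable_pi_lambda _ fun _ => (measurable_pi_apply _).comp
    ((continuous_refl v).measurable.comp (measurable_sheet_last s))

lemma measurable_reflLast (v : Fin (n + 1) → ℝ) (s : Fin 2) : Measurable (reflLast v s) :=
  (measurable_pi_apply _).comp ((continuous_refl v).measurable.comp (measurable_sheet_last s))

/-- The part of the base where the reflection maps the sheet `s` to the sheet `s'`. -/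
def reflPiece (v : Fin (n + 1) → ℝ) (s s' : Fin 2) : Set (Fin n → ℂ) :=
  {Z | Z ∈ baseSet n ∧ -quad Z ∈ Complex.slitPlane ∧ reflLast v s Z ≠ 0 ∧
    reflLast v s Z = (-1) ^ (s' : ℕ) * root (reflBase v s Z)}

lemma measurableSet_reflPiece (v : Fin (n + 1) → ℝ) (s s' : Fin 2) :
    MeasurableSet (reflPiece v s s') := by
  refine (isOpen_baseSet n).measurableSet.inter (MeasurableSet.inter ?_ (MeasurableSet.inter ?_ ?_))
  · exact (Complex.isOpen_slitPlane.preimage continuous_quad.neg).measurableSet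
  · exact (measurableSet_eq_fun (measurable_reflLast v s) measurable_const).compl
  · exact measurableSet_eq_fun (measurable_reflLast v s)
      ((measurable_root.comp (measurable_reflBase v s)).const_mul _)

lemma refl_sheet_of_mem {v : Fin (n + 1) → ℝ} {s s' : Fin 2} {Z : Fin n → ℂ}
    (hZ : Z ∈ reflPiece v s s') :
    refl v (sheet (Fin.last n) s Z) = sheet (Fin.last n) s' (reflBase v s Z) := by
  rw [← pt_reflBase, sheet_last, hZ.2.2.2]

lemma sheet_last_injective (s : Fin 2) : Function.Injective (sheet (n := n) (Fin.last n) s) := by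
  intro Z Z' h
  ext i
  simpa [sheet_last] using congrFun h i.castSucc

lemma injOn_reflBase {v : Fin (n + 1) → ℝ} (hv : ∑ i, v i ^ 2 = 1) (s s' : Fin 2) :
    Set.InjOn (reflBase v s) (reflPiece v s s') := by
  intro Z hZ Z' hZ' h
  have h1 := refl_sheet_of_mem hZ
  rw [h, ← refl_sheet_of_mem hZ'] at h1
  have h2 := congrArg (refl v) h1
  rw [refl_refl hv, refl_refl hv] at h2
  exact sheet_last_injective s h2

lemma hasFDerivWithinAt_reflBase (v : Fin (n + 1) → ℝ) (s s' : Fin 2) {Z : Fin n → ℂ}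
    (hZ : Z ∈ reflPiece v s s') :
    HasFDerivWithinAt (reflBase v s) ((fderiv ℂ (reflBase v s) Z).restrictScalars ℝ)
      (reflPiece v s s') Z :=
  ((hasFDerivAt_reflBase s hZ.2.1).differentiableAt.hasFDerivAt.restrictScalars ℝ).hasFDerivWithinAt

/-- Reflecting back a common image would give two points on different sheets which coincide, so that
`root` vanishes; this is excluded on the base. -/
lemma disjoint_image_reflPiece {v : Fin (n + 1) → ℝ} (hv : ∑ i, v i ^ 2 = 1) (s' : Fin 2) :
    Disjoint (reflBase v 0 '' reflPiece v 0 s') (reflBase v 1 '' reflPiece v 1 s') := by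
  rw [Set.disjoint_left]
  rintro _ ⟨Z, hZ, rfl⟩ ⟨Z', hZ', h⟩
  have h1 := refl_sheet_of_mem hZ
  rw [← h, ← refl_sheet_of_mem hZ'] at h1
  have h2 := congrArg (refl v) h1
  rw [refl_refl hv, refl_refl hv, sheet_last, sheet_last] at h2
  have h3 : Z = Z' := by
    ext i
    simpa using congrFun h2 i.castSucc
  have h4 := congrFun h2 (Fin.last n)
  rw [pt_last, pt_last, h3] at h4
  have h5 : root Z' = 0 := by
    simp at h4
    exact self_eq_neg.1 h4
  exact hZ'.1.1 ((root_eq_zero _).1 h5)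

lemma reflBase_mem_baseSet {v : Fin (n + 1) → ℝ} (hv : ∑ i, v i ^ 2 = 1) {s s' : Fin 2}
    {Z : Fin n → ℂ} (hZ : Z ∈ reflPiece v s s') : reflBase v s Z ∈ baseSet n := by
  have h1 := reflLast_sq hv s Z
  refine ⟨fun h => hZ.2.2.1 ?_, ?_⟩
  · rw [h] at h1; simpa using h1
  · have := (refl_mem_ball hv (sheet_last_mem_ball s hZ.1)).2.2
    rwa [refl_sheet_of_mem hZ, normSq_sheet_last] at this

lemma lintegral_reflPiece {v : Fin (n + 1) → ℝ} (hv : ∑ i, v i ^ 2 = 1) (s s' : Fin 2)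
    (h : (Fin (n + 1) → ℂ) → ℝ≥0∞) :
    ∫⁻ Z in reflPiece v s s', ENNReal.ofReal (1 / ‖quad Z‖) *
        h (refl v (sheet (Fin.last n) s Z)) =
      ∫⁻ Y in reflBase v s '' reflPiece v s s', ENNReal.ofReal (1 / ‖quad Y‖) *
        h (sheet (Fin.last n) s' Y) := by
  rw [lintegral_image_eq_lintegral_abs_det_fderiv_mul volume (measurableSet_reflPiece v s s')
    (fun Z hZ => hasFDerivWithinAt_reflBase v s s' hZ) (injOn_reflBase hv s s')]
  refine setLIntegral_congr_fun (measurableSet_reflPiece v s s') fun Z hZ => ?_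
  have h1 : 0 < ‖quad Z‖ := norm_pos_iff.2 hZ.1.1
  have h2 : 0 < ‖quad (reflBase v s Z)‖ := norm_pos_iff.2 (reflBase_mem_baseSet hv hZ).1
  rw [abs_det_reflBase hv s hZ.2.1, refl_sheet_of_mem hZ, ← mul_assoc,
    ← ENNReal.ofReal_mul (by positivity)]
  congr 2
  field_simp

/-- Up to a null set the base is covered by the pieces on which the reflection maps sheet `s` into
sheet `s'`. For each `s'`, the images of the two pieces are disjoint subsets of the base, and the
change of variables has the right Jacobian. One inequality is enough since a reflection is its own
inverse. -/
lemma lintegral_mu_refl_le (hn : 1 ≤ n) {v : Fin (n + 1) → ℝ} (hv : ∑ i, v i ^ 2 = 1)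
    {h : (Fin (n + 1) → ℂ) → ℝ≥0∞} (hh : Measurable h) :
    ∫⁻ z, h (refl v z) ∂(mu n) ≤ ∫⁻ z, h z ∂(mu n) := by

  have hsplit : ∀ g : (Fin (n + 1) → ℂ) → ℝ≥0∞, Measurable g → ∫⁻ z, g z ∂(mu n) =
      ∑ s : Fin 2, ∫⁻ Z in baseSet n, ENNReal.ofReal (1 / ‖quad Z‖) *
        g (sheet (Fin.last n) s Z) := by
    intro g hg
    rw [lintegral_mu hg, Fin.sum_univ_two]
    refine Eq.trans ?_ (lintegral_add_left
      (measurable_inv_quad.mul (hg.comp (measurable_sheet_last _))) _)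
    simp [sheet_last, mul_add]
  have hcover : ∀ s : Fin 2, ∫⁻ Z in baseSet n, ENNReal.ofReal (1 / ‖quad Z‖) *
      h (refl v (sheet (Fin.last n) s Z)) ≤ ∑ s' : Fin 2, ∫⁻ Z in reflPiece v s s',
        ENNReal.ofReal (1 / ‖quad Z‖) * h (refl v (sheet (Fin.last n) s Z)) := by
    intro s
    rw [Fin.sum_univ_two]
    refine le_trans ?_ (lintegral_union_le _ _ _)
    refine lintegral_mono_set' ?_
    filter_upwards [ae_neg_quad_mem_slitPlane hn, ae_reflLast_ne_zero hn hv s] with Z h1 h2 h3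
    rcases eq_or_eq_neg_root (reflLast_sq hv s Z) with h4 | h4
    · exact Or.inl ⟨h3, h1, h2, by simpa using h4⟩
    · exact Or.inr ⟨h3, h1, h2, by simpa using h4⟩
  rw [hsplit h hh, hsplit (fun z => h (refl v z)) (hh.comp (continuous_refl v).measurable)]
  refine (Finset.sum_le_sum fun s _ => hcover s).trans ?_
  rw [Finset.sum_comm]
  refine Finset.sum_le_sum fun s' _ => ?_
  simp only [lintegral_reflPiece hv]
  have himg : ∀ s, MeasurableSet (reflBase v s '' reflPiece v s s') := fun s =>
    measurable_image_of_fderivWithin (measurableSet_reflPiece v s s')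
      (fun Z hZ => hasFDerivWithinAt_reflBase v s s' hZ) (injOn_reflBase hv s s')
  rw [Fin.sum_univ_two, ← lintegral_union (himg 1) (disjoint_image_reflPiece hv s')]
  refine lintegral_mono_set (Set.union_subset ?_ ?_) <;>
  · rintro _ ⟨Z, hZ, rfl⟩
    exact reflBase_mem_baseSet hv hZ

/-- The invariant measure is invariant under real reflections. -/
lemma lintegral_mu_refl (hn : 1 ≤ n) {v : Fin (n + 1) → ℝ} (hv : ∑ i, v i ^ 2 = 1)
    {h : (Fin (n + 1) → ℂ) → ℝ≥0∞} (hh : Measurable h) :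
    ∫⁻ z, h (refl v z) ∂(mu n) = ∫⁻ z, h z ∂(mu n) := by
  refine le_antisymm (lintegral_mu_refl_le hn hv hh) ?_
  have := lintegral_mu_refl_le hn hv (hh.comp (continuous_refl v).measurable)
  simpa only [Function.comp_apply, refl_refl hv] using this

lemma measurePreserving_refl (hn : 1 ≤ n) {v : Fin (n + 1) → ℝ} (hv : ∑ i, v i ^ 2 = 1) :
    MeasurePreserving (refl v) (mu n) (mu n) := by
  refine ⟨(continuous_refl v).measurable, ?_⟩
  ext s hs
  rw [← lintegral_indicator_one hs, lintegral_map (measurable_one.indicator hs)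
    (continuous_refl v).measurable, lintegral_mu_refl hn hv (measurable_one.indicator hs),
    lintegral_indicator_one hs]

/-- A reflection maps a given real vector to any other one of the same length. -/
lemma exists_refl_real {x y : Fin (n + 1) → ℝ} (h : ∑ i, x i ^ 2 = ∑ i, y i ^ 2) (hxy : x ≠ y) :
    ∃ v : Fin (n + 1) → ℝ, ∑ i, v i ^ 2 = 1 ∧ (∃ r : ℝ, ∀ i, v i = r * (x i - y i)) ∧
      ∀ i, x i - 2 * (∑ j, v j * x j) * v i = y i := by
  set d := ∑ i, (x i - y i) ^ 2 with hd
  have hd0 : 0 < d := by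
    refine lt_of_le_of_ne (Finset.sum_nonneg fun _ _ => sq_nonneg _) fun h0 => hxy ?_
    have := (Finset.sum_eq_zero_iff_of_nonneg (fun _ _ => sq_nonneg _)).1 h0.symm
    ext i
    have := this i (Finset.mem_univ i)
    exact sub_eq_zero.1 (by simpa using this)
  have hs : (√d)⁻¹ ^ 2 = 1 / d := by rw [inv_pow, Real.sq_sqrt hd0.le, one_div]
  refine ⟨fun i => (√d)⁻¹ * (x i - y i), ?_, ⟨(√d)⁻¹, fun _ => rfl⟩, fun i => ?_⟩
  · simp only [mul_pow, ← Finset.mul_sum, hs, ← hd]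
    field_simp
  · have h1 : 2 * ∑ j, (x j - y j) * x j = d := by
      have e : ∀ j, (x j - y j) ^ 2 = 2 * ((x j - y j) * x j) - x j ^ 2 + y j ^ 2 := by
        intro j; ring
      rw [hd]
      simp only [e, Finset.sum_add_distrib, Finset.sum_sub_distrib, ← Finset.mul_sum, h]
      ring
    have h2 : 2 * (∑ j, (√d)⁻¹ * (x j - y j) * x j) * ((√d)⁻¹ * (x i - y i)) =
        (√d)⁻¹ ^ 2 * (2 * ∑ j, (x j - y j) * x j) * (x i - y i) := by
      simp only [mul_assoc, ← Finset.mul_sum]; ring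
    rw [h2, h1, hs]
    field_simp
    ring

lemma refl_re {v : Fin (n + 1) → ℝ} (z : Fin (n + 1) → ℂ) (i : Fin (n + 1)) :
    (refl v z i).re = (z i).re - 2 * (∑ j, v j * (z j).re) * v i := by
  have : (∑ j, (v j : ℂ) * z j).re = ∑ j, v j * (z j).re := by simp
  rw [refl, Complex.sub_re, Complex.re_mul_ofReal, ← this]
  simp

lemma refl_im {v : Fin (n + 1) → ℝ} (z : Fin (n + 1) → ℂ) (i : Fin (n + 1)) :
    (refl v z i).im = (z i).im - 2 * (∑ j, v j * (z j).im) * v i := by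
  have : (∑ j, (v j : ℂ) * z j).im = ∑ j, v j * (z j).im := by simp
  rw [refl, Complex.sub_im, Complex.im_mul_ofReal, ← this]
  simp

lemma ball_re_im {z : Fin (n + 1) → ℂ} (hz : z ∈ ball n) :
    ∑ i, (z i).re ^ 2 = normSq z / 2 ∧ ∑ i, (z i).im ^ 2 = normSq z / 2 ∧
      ∑ i, (z i).re * (z i).im = 0 := by
  have h1 := congrArg Complex.re hz.1
  have h2 := congrArg Complex.im hz.1
  have h3 : normSq z = ∑ i, (z i).re ^ 2 + ∑ i, (z i).im ^ 2 := by
    rw [normSq, ← Finset.sum_add_distrib]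
    exact Finset.sum_congr rfl fun i _ => by rw [Complex.sq_norm, Complex.normSq_apply]; ring
  simp only [Complex.re_sum, Complex.im_sum, sq, Complex.mul_re, Complex.mul_im, Complex.zero_re,
    Complex.zero_im, Finset.sum_sub_distrib, Finset.sum_add_distrib] at h1 h2
  simp only [← sq] at h1
  have h4 : ∑ i, (z i).im * (z i).re = ∑ i, (z i).re * (z i).im :=
    Finset.sum_congr rfl fun i _ => mul_comm _ _
  exact ⟨by linarith, by linarith, by linarith⟩

/-- Functions on the ball that are invariant under reflections depend on `normSq` only. -/
lemma eq_of_normSq_eq {α : Type*} {F : (Fin (n + 1) → ℂ) → α}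
    (hF : ∀ v : Fin (n + 1) → ℝ, ∑ i, v i ^ 2 = 1 → ∀ z ∈ ball n, F (refl v z) = F z)
    {z z' : Fin (n + 1) → ℂ} (hz : z ∈ ball n) (hz' : z' ∈ ball n) (h : normSq z = normSq z') :
    F z = F z' := by
  obtain ⟨a', b', c'⟩ := ball_re_im hz'
  -- On the ball, real and imaginary parts are orthogonal and of equal length. One reflection
  -- matches the real parts, a second one the imaginary parts.
  have hre : ∃ y ∈ ball n, F y = F z ∧ normSq y = normSq z ∧ ∀ i, (y i).re = (z' i).re := by
    by_cases hx : (fun i => (z i).re) = fun i => (z' i).re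
    · exact ⟨z, hz, rfl, rfl, fun i => congrFun hx i⟩
    · obtain ⟨v, hv, -, h1⟩ := exists_refl_real (x := fun i => (z i).re) (y := fun i => (z' i).re)
        (by rw [(ball_re_im hz).1, a', h]) hx
      exact ⟨refl v z, refl_mem_ball hv hz, hF v hv z hz, normSq_refl hv z,
        fun i => by rw [refl_re, ← h1]⟩
  obtain ⟨y, hy, hFy, hny, hyre⟩ := hre
  obtain ⟨-, b, c⟩ := ball_re_im hy
  rw [← hFy]
  by_cases hx : (fun i => (y i).im) = fun i => (z' i).im
  · congr 1
    ext i
    exact Complex.ext (hyre i) (congrFun hx i)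
  -- The axis is a multiple of the difference of the imaginary parts, both of which are orthogonal
  -- to the common real part; so the real part stays fixed.
  · obtain ⟨v, hv, ⟨r, hr⟩, h1⟩ := exists_refl_real (x := fun i => (y i).im)
      (y := fun i => (z' i).im) (by rw [b, b', hny, h]) hx
    rw [← hF v hv y hy]
    congr 1
    ext i
    refine Complex.ext ?_ ?_
    · rw [refl_re]
      have : ∑ j, v j * (y j).re = 0 := by
        have e : ∀ j, v j * (y j).re =
            r * ((y j).re * (y j).im) - r * ((z' j).re * (z' j).im) := by
          intro j; rw [hr, hyre]; ring
        simp only [e, Finset.sum_sub_distrib, ← Finset.mul_sum, c, c']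
        ring
      rw [this, hyre]; ring
    · rw [refl_im, ← h1]

end Reflection

end Kepler
end

/-! ### Holomorphic functions on the ball and homogeneous extension to the cone -/

noncomputable section
namespace Kepler
open MeasureTheory Filter Topology
open scoped ComplexOrder ENNReal ComplexConjugate

section Holomorphic

variable {n : ℕ}

lemma sq_cpow_half {x : ℂ} (hx : 0 < x.re) : (x ^ 2) ^ (1 / 2 : ℂ) = x := by
  rw [one_div]; exact Complex.sq_cpow_two_inv hx

/-- Where `z_j / p_j` has positive real part, it is the principal square root of its own square, so
the chart inverse picks the correct sheet. -/
lemma eventually_localParam_coord {p : Fin (n + 1) → ℂ} {j : Fin (n + 1)}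
    (hj : p j ≠ 0) : ∀ᶠ z in 𝓝 p, z ∈ ball n → localParam j p (coord j z) = z := by
  have hopen : ∀ᶠ z : Fin (n + 1) → ℂ in 𝓝 p, 0 < (z j / p j).re := by
    have hc : Continuous fun z : Fin (n + 1) → ℂ => (z j / p j).re := by fun_prop
    exact (hc.tendsto p).eventually_const_lt (by simp [div_self hj])
  filter_upwards [hopen] with z hz hzb
  have h1 : (∑ i, coord j z i ^ 2) / (-(p j) ^ 2) = (z j / p j) ^ 2 := by
    have h2 : ∑ i, coord j z i ^ 2 = -z j ^ 2 := quad_coord hzb j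
    rw [h2, div_pow, neg_div_neg_eq]
  rw [localParam, h1, sq_cpow_half hz, mul_div_cancel₀ _ hj]
  exact Fin.insertNth_self_removeNth j z

/-- A holomorphic function on the ball is holomorphic along holomorphic maps into the ball. -/
lemma IsHolomorphic.comp_differentiableAt {g : (Fin (n + 1) → ℂ) → ℂ} (hg : IsHolomorphic n g)
    {E : Type*} [NormedAddCommGroup E] [NormedSpace ℂ E] {γ : E → Fin (n + 1) → ℂ} {x : E}
    (hγ : DifferentiableAt ℂ γ x) (hmem : ∀ᶠ y in 𝓝 x, γ y ∈ ball n) :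
    DifferentiableAt ℂ (fun y => g (γ y)) x := by
  obtain ⟨j, hj⟩ : ∃ j, γ x j ≠ 0 := Function.ne_iff.1 hmem.self_of_nhds.2.1
  have h1 := hg (γ x) hmem.self_of_nhds j hj
  have h2 : DifferentiableAt ℂ (fun y => coord j (γ y)) x := by
    rw [differentiableAt_pi] at hγ ⊢
    exact fun i => hγ (j.succAbove i)
  have h3 : DifferentiableAt ℂ (fun y => g (localParam j (γ x) (coord j (γ y)))) x :=
    DifferentiableAt.comp x (g := fun Z => g (localParam j (γ x) Z))
      (f := fun y => coord j (γ y)) h1 h2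
  refine h3.congr_of_eventuallyEq ?_
  filter_upwards [hmem, hγ.continuousAt.eventually (eventually_localParam_coord hj)] with y hy hy'
  rw [hy' hy]

lemma continuous_coord (j : Fin (n + 1)) : Continuous (coord (n := n) j) :=
  continuous_pi fun i => continuous_apply (j.succAbove i)

lemma IsHolomorphic.continuousOn {g : (Fin (n + 1) → ℂ) → ℂ} (hg : IsHolomorphic n g) :
    ContinuousOn g (ball n) := by
  intro p hp
  obtain ⟨j, hj⟩ : ∃ j, p j ≠ 0 := Function.ne_iff.1 hp.2.1
  have h1 : ContinuousAt (fun z => g (localParam j p (coord j z))) p :=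
    ContinuousAt.comp (f := coord j) (hg p hp j hj).continuousAt (continuous_coord j).continuousAt
  refine h1.continuousWithinAt.congr_of_eventuallyEq_of_mem ?_ hp
  filter_upwards [self_mem_nhdsWithin,
    nhdsWithin_le_nhds (eventually_localParam_coord hj)] with z hz h
  rw [h hz]

/-- The cone over the ball. -/
def cone (n : ℕ) : Set (Fin (n + 1) → ℂ) := {z | ∑ i, z i ^ 2 = 0 ∧ z ≠ 0}

/-- Continuity on a subset of the cone together with holomorphy along curves. -/
structure CurveHol (S : Set (Fin (n + 1) → ℂ)) (g : (Fin (n + 1) → ℂ) → ℂ) : Prop where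
  cont : ContinuousOn g S
  hol : ∀ (γ : ℂ → Fin (n + 1) → ℂ) (t : ℂ),
    (∀ᶠ s in 𝓝 t, DifferentiableAt ℂ γ s ∧ γ s ∈ S) → DifferentiableAt ℂ (fun s => g (γ s)) t

/-- The later arguments use one complex parameter at a time. Holomorphy along curves also makes
sense on the cone and passes to products, homogeneous extensions and circle averages without any
charts. -/
lemma IsHolomorphic.curveHol {g : (Fin (n + 1) → ℂ) → ℂ} (hg : IsHolomorphic n g) :
    CurveHol (ball n) g :=
  ⟨hg.continuousOn, fun _ _ h => hg.comp_differentiableAt h.self_of_nhds.1 (h.mono fun _ h => h.2)⟩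

lemma CurveHol.mul {S : Set (Fin (n + 1) → ℂ)} {g h : (Fin (n + 1) → ℂ) → ℂ}
    (hg : CurveHol S g) (hh : CurveHol S h) : CurveHol S fun z => g z * h z :=
  ⟨hg.cont.mul hh.cont, fun γ t ht => (hg.hol γ t ht).mul (hh.hol γ t ht)⟩

lemma CurveHol.of_differentiable {S : Set (Fin (n + 1) → ℂ)} {g : (Fin (n + 1) → ℂ) → ℂ}
    (hg : Differentiable ℂ g) : CurveHol S g :=
  ⟨hg.continuous.continuousOn, fun _ t ht => (hg _).comp t ht.self_of_nhds.1⟩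

/-- `1 / (1 + |z|²)`, which scales the cone into the ball. -/
def shrink (z : Fin (n + 1) → ℂ) : ℂ := (((1 + normSq z)⁻¹ : ℝ) : ℂ)

lemma norm_shrink (z : Fin (n + 1) → ℂ) : ‖shrink z‖ = (1 + normSq z)⁻¹ := by
  have := normSq_nonneg z
  rw [shrink, Complex.norm_real, Real.norm_eq_abs, abs_of_pos (by positivity)]

lemma shrink_ne_zero (z : Fin (n + 1) → ℂ) : shrink z ≠ 0 := by
  have := normSq_nonneg z
  rw [← norm_ne_zero_iff, norm_shrink]
  exact (by positivity : (0 : ℝ) < (1 + normSq z)⁻¹).ne'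

lemma continuous_shrink : Continuous (shrink (n := n)) := by
  unfold shrink
  refine Complex.continuous_ofReal.comp ((continuous_const.add continuous_normSq).inv₀ fun z => ?_)
  have := normSq_nonneg z
  exact (by positivity : (0 : ℝ) < 1 + normSq z).ne'

lemma smul_mem_ball_of_mem_cone {z : Fin (n + 1) → ℂ} (hz : z ∈ cone n) {c : ℂ} (hc : c ≠ 0)
    (h : ‖c‖ ^ 2 * normSq z < 1) : c • z ∈ ball n :=
  ⟨by rw [sum_sq_smul, hz.1, mul_zero], smul_ne_zero hc hz.2, by rwa [normSq_smul]⟩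

lemma shrink_lt (z : Fin (n + 1) → ℂ) : ‖shrink z‖ ^ 2 * normSq z ≤ 1 / 4 := by
  have h := normSq_nonneg z
  rw [norm_shrink, inv_pow, ← div_eq_inv_mul, div_le_div_iff₀ (by positivity) (by norm_num)]
  nlinarith [sq_nonneg (normSq z - 1)]

lemma shrink_smul_mem_ball {z : Fin (n + 1) → ℂ} (hz : z ∈ cone n) : shrink z • z ∈ ball n :=
  smul_mem_ball_of_mem_cone hz (shrink_ne_zero z) ((shrink_lt z).trans_lt (by norm_num))

/-- `g` is homogeneous of degree `k` on the ball. -/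
def IsHomog (k : ℤ) (g : (Fin (n + 1) → ℂ) → ℂ) : Prop :=
  ∀ z ∈ ball n, ∀ c : ℂ, c ≠ 0 → c • z ∈ ball n → g (c • z) = c ^ k * g z

/-- The homogeneous extension of a function from the ball to the cone. -/
def extend (k : ℕ) (g : (Fin (n + 1) → ℂ) → ℂ) (z : Fin (n + 1) → ℂ) : ℂ :=
  (shrink z)⁻¹ ^ k * g (shrink z • z)

/-- Homogeneity makes the extension independent of the scaling factor. Although `shrink` is not
holomorphic, a constant factor may therefore be used near any given point. -/
lemma extend_eq {k : ℕ} {g : (Fin (n + 1) → ℂ) → ℂ} (hg : IsHomog k g) {z : Fin (n + 1) → ℂ}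
    (hz : z ∈ cone n) {c : ℂ} (hc : c ≠ 0) (h : c • z ∈ ball n) :
    extend k g z = c⁻¹ ^ k * g (c • z) := by
  have h1 := shrink_smul_mem_ball hz
  have h2 : (shrink z / c) • (c • z) = shrink z • z := by
    rw [smul_smul, div_mul_cancel₀ _ hc]
  have h3 := hg (c • z) h (shrink z / c) (div_ne_zero (shrink_ne_zero z) hc) (by rwa [h2])
  rw [h2] at h3
  have h0 := shrink_ne_zero z
  rw [extend, h3, zpow_natCast, div_pow, inv_pow, inv_pow]
  field_simp

lemma extend_eq_self {k : ℕ} {g : (Fin (n + 1) → ℂ) → ℂ} (hg : IsHomog k g) {z : Fin (n + 1) → ℂ}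
    (hz : z ∈ ball n) : extend k g z = g z := by
  have := extend_eq hg (c := 1) ⟨hz.1, hz.2.1⟩ one_ne_zero (by simpa using hz)
  simpa using this

lemma CurveHol.extend {k : ℕ} {g : (Fin (n + 1) → ℂ) → ℂ} (hg : CurveHol (ball n) g)
    (hk : IsHomog k g) : CurveHol (cone n) (extend k g) := by
  constructor
  · refine ContinuousOn.mul ?_ ?_
    · exact ((continuous_shrink.inv₀ shrink_ne_zero).pow k).continuousOn
    · exact hg.cont.comp (continuous_shrink.smul continuous_id).continuousOn
        fun z hz => shrink_smul_mem_ball hz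
  · intro γ t ht
    obtain ⟨hd, hm⟩ := ht.self_of_nhds
    set c := shrink (γ t)
    have hc : c ≠ 0 := shrink_ne_zero _
    have hev : ∀ᶠ s in 𝓝 t, DifferentiableAt ℂ (fun s => c • γ s) s ∧ c • γ s ∈ ball n := by
      have h1 : ∀ᶠ s in 𝓝 t, ‖c‖ ^ 2 * normSq (γ s) < 1 := by
        have : ContinuousAt (fun s => ‖c‖ ^ 2 * normSq (γ s)) t :=
          continuousAt_const.mul (continuous_normSq.continuousAt.comp hd.continuousAt)
        exact this.eventually_lt continuousAt_const ((shrink_lt (γ t)).trans_lt (by norm_num))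
      filter_upwards [ht, h1] with s hs h1
      exact ⟨hs.1.const_smul c, smul_mem_ball_of_mem_cone hs.2 hc h1⟩
    have h2 : DifferentiableAt ℂ (fun s => c⁻¹ ^ k * g (c • γ s)) t :=
      (hg.hol _ t hev).const_mul _
    refine h2.congr_of_eventuallyEq ?_
    filter_upwards [ht, hev] with s hs h1
    exact extend_eq hk hs.2 hc h1.2

lemma isCompact_level (n : ℕ) (a : ℝ) :
    IsCompact {z : Fin (n + 1) → ℂ | ∑ i, z i ^ 2 = 0 ∧ normSq z = a} := by
  refine Metric.isCompact_of_isClosed_isBounded ?_ ?_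
  · exact (isClosed_eq (by fun_prop) continuous_const).inter
      (isClosed_eq continuous_normSq continuous_const)
  · refine (Metric.isBounded_closedBall (x := (0 : Fin (n + 1) → ℂ)) (r := √a)).subset ?_
    rintro z ⟨-, hz⟩
    rw [mem_closedBall_zero_iff, pi_norm_le_iff_of_nonneg (Real.sqrt_nonneg _)]
    intro i
    refine Real.le_sqrt_of_sq_le (hz ▸ ?_)
    exact Finset.single_le_sum (f := fun i => ‖z i‖ ^ 2) (fun _ _ => by positivity)
      (Finset.mem_univ i)

/-- The level `|z|² = 1/4` is compact in the ball, and every point is a multiple of a point on it by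
a factor less than 2. As the degree is nonnegative, the bound persists near the origin. -/
lemma exists_bound_of_isHomog {k : ℕ} {g : (Fin (n + 1) → ℂ) → ℂ} (hg : ContinuousOn g (ball n))
    (hk : IsHomog k g) : ∃ M : ℝ, 0 ≤ M ∧ ∀ z ∈ ball n, ‖g z‖ ≤ M := by
  have hsub : {z : Fin (n + 1) → ℂ | ∑ i, z i ^ 2 = 0 ∧ normSq z = 1 / 4} ⊆ ball n := by
    rintro z ⟨h1, h2⟩
    refine ⟨h1, fun h => ?_, by rw [h2]; norm_num⟩
    rw [h, normSq_eq_zero.2 rfl] at h2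
    norm_num at h2
  obtain ⟨M, hM⟩ := (isCompact_level n (1 / 4)).exists_bound_of_continuousOn
    (hg.mono hsub)
  refine ⟨2 ^ k * max M 0, by positivity, fun z hz => ?_⟩
  have hs := normSq_mem_Ioo hz
  have hr : 0 < √(normSq z) := Real.sqrt_pos.2 hs.1
  set c : ℂ := (((2 * √(normSq z))⁻¹ : ℝ) : ℂ) with hc
  have hcn : ‖c‖ = (2 * √(normSq z))⁻¹ := by
    rw [hc, Complex.norm_real, Real.norm_eq_abs, abs_of_pos (by positivity)]
  have hc0 : c ≠ 0 := by rw [← norm_ne_zero_iff, hcn]; positivity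
  have hn : normSq (c • z) = 1 / 4 := by
    rw [normSq_smul, hcn, inv_pow, mul_pow, Real.sq_sqrt hs.1.le]
    have := hs.1.ne'
    field_simp; norm_num
  have hmem : c • z ∈ {z : Fin (n + 1) → ℂ | ∑ i, z i ^ 2 = 0 ∧ normSq z = 1 / 4} :=
    ⟨by rw [sum_sq_smul, hz.1, mul_zero], hn⟩
  have h1 := hM _ hmem
  rw [hk z hz c hc0 (hsub hmem), norm_mul, norm_zpow, hcn, zpow_natCast, inv_pow, mul_pow] at h1
  have hle : √(normSq z) ^ k ≤ 1 :=
    pow_le_one₀ hr.le (Real.sqrt_le_one.2 hs.2.le)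
  have hp : 0 < √(normSq z) ^ k := pow_pos hr k
  rw [inv_mul_le_iff₀ (by positivity)] at h1
  calc ‖g z‖ ≤ 2 ^ k * √(normSq z) ^ k * M := h1
    _ ≤ 2 ^ k * √(normSq z) ^ k * max M 0 := by gcongr; exact le_max_left _ _
    _ ≤ 2 ^ k * 1 * max M 0 := by gcongr
    _ = 2 ^ k * max M 0 := by ring

end Holomorphic

/-! ### Entire functions of polynomial growth -/

section EntirePolynomial

open Polynomial in
-- Cauchy's estimate on circles of radius `R → ∞` kills all Taylor coefficients of order above `d`.
lemma exists_polynomial_of_growth {f : ℂ → ℂ} (hf : Differentiable ℂ f) {C : ℝ} {d : ℕ}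
    (h : ∀ t, ‖f t‖ ≤ C * (1 + ‖t‖) ^ d) : ∃ p : ℂ[X], p.natDegree ≤ d ∧ ∀ t, f t = p.eval t := by
  have hC : 0 ≤ C := by
    have := (norm_nonneg _).trans (h 0)
    simpa using this
  have h0 : ∀ m, d < m → iteratedDeriv m f 0 = 0 := by
    intro m hm
    have h1 : ∀ R : ℝ, 1 ≤ R → ‖iteratedDeriv m f 0‖ ≤ (m.factorial * (C * 2 ^ d)) * R⁻¹ := by
      intro R hR
      have hR0 : 0 < R := by linarith
      refine (Complex.norm_iteratedDeriv_le_of_forall_mem_sphere_norm_le m hR0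
        hf.diffContOnCl (C := C * 2 ^ d * R ^ d) fun z hz => (h z).trans ?_).trans ?_
      · rw [mul_assoc, ← mul_pow]
        have : ‖z‖ = R := by simpa using hz
        rw [this]
        gcongr
        linarith
      · rw [div_le_iff₀ (by positivity)]
        have h2 : R ^ d ≤ R⁻¹ * R ^ m := by
          rw [← div_eq_inv_mul, le_div_iff₀ hR0, ← pow_succ]
          exact pow_le_pow_right₀ hR hm
        calc (m.factorial : ℝ) * (C * 2 ^ d * R ^ d)
            = (m.factorial * (C * 2 ^ d)) * R ^ d := by ring
          _ ≤ (m.factorial * (C * 2 ^ d)) * (R⁻¹ * R ^ m) := by gcongr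
          _ = _ := by ring
    have h2 : Tendsto (fun R : ℝ => (m.factorial * (C * 2 ^ d)) * R⁻¹) atTop (𝓝 0) := by
      simpa using tendsto_inv_atTop_zero.const_mul ((m.factorial : ℝ) * (C * 2 ^ d))
    have h3 := ge_of_tendsto h2 ((eventually_ge_atTop 1).mono h1)
    exact norm_le_zero_iff.1 h3
  refine ⟨∑ i ∈ Finset.range (d + 1), Polynomial.C ((i.factorial : ℂ)⁻¹ * iteratedDeriv i f 0) * X ^ i,
    ?_, fun t => ?_⟩
  · refine Polynomial.natDegree_sum_le_of_forall_le _ _ fun i hi => ?_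
    exact (Polynomial.natDegree_C_mul_X_pow_le _ _).trans (Finset.mem_range_succ_iff.1 hi)
  · rw [← Complex.taylorSeries_eq_of_entire' 0 t hf, tsum_eq_sum (s := Finset.range (d + 1))]
    · simp [Polynomial.eval_finsetSum]
    · intro m hm
      rw [h0 m (by simpa using hm)]
      simp

lemma differentiable_of_off_finite {f : ℂ → ℂ} (hf : Continuous f) {s : Set ℂ} (hs : s.Finite)
    (hd : ∀ t, t ∉ s → DifferentiableAt ℂ f t) : Differentiable ℂ f := by
  intro t
  exact (Complex.hasFPowerSeriesOnBall_of_differentiable_off_countable (R := 1) hs.countable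
    hf.continuousOn (fun z hz => hd z hz.2) zero_lt_one).differentiableOn.differentiableAt
    (Metric.eball_mem_nhds _ (by simp))

open Polynomial in
/-- Functions which are separately polynomial of bounded degree are polynomial. -/
lemma exists_mvPolynomial (D : ℕ) : ∀ (n : ℕ) (A : (Fin n → ℂ) → ℂ),
    (∀ i (Z : Fin n → ℂ), (∀ j, Z j ≠ 0) → ∃ p : ℂ[X], p.natDegree ≤ D ∧
      ∀ t, t ≠ 0 → A (Function.update Z i t) = p.eval t) →
    ∃ P : MvPolynomial (Fin n) ℂ, ∀ Z : Fin n → ℂ, (∀ j, Z j ≠ 0) → A Z = MvPolynomial.eval Z P := by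
  intro n
  induction n with
  | zero => exact fun A _ => ⟨MvPolynomial.C (A 0), fun Z _ => by
      rw [MvPolynomial.eval_C, Subsingleton.elim Z 0]⟩
  | succ n ih =>
    intro A hA
    -- Lagrange interpolation in the first variable at `D + 1` nodes; by induction the values at
    -- each node are polynomial in the other variables. The nodes avoid 0 because the hypothesis
    -- only concerns points with nonzero coordinates.
    let x : ℕ → ℂ := fun j => (j : ℂ) + 1
    have hx0 : ∀ j, x j ≠ 0 := fun j => Nat.cast_add_one_ne_zero j
    have hx : Set.InjOn x (Finset.range (D + 1)) := fun a _ b _ h => by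
      simpa [x] using h
    have h1 : ∀ j, ∃ P : MvPolynomial (Fin n) ℂ, ∀ Y : Fin n → ℂ, (∀ i, Y i ≠ 0) →
        A (Fin.cons (x j) Y) = MvPolynomial.eval Y P := by
      intro j
      refine ih (fun Y => A (Fin.cons (x j) Y)) fun i Y hY => ?_
      obtain ⟨p, hp, hp'⟩ := hA i.succ (Fin.cons (x j) Y)
        (fun l => by refine Fin.cases ?_ (fun l => ?_) l <;> simp [hx0, hY])
      refine ⟨p, hp, fun t ht => ?_⟩
      rw [← hp' t ht, Fin.cons_update]
    choose P hP using h1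
    refine ⟨∑ j ∈ Finset.range (D + 1),
      Polynomial.aeval (MvPolynomial.X (0 : Fin (n + 1)))
        (Lagrange.basis (Finset.range (D + 1)) x j) * MvPolynomial.rename Fin.succ (P j),
      fun Z hZ => ?_⟩
    obtain ⟨p, hp, hp'⟩ := hA 0 Z hZ
    have hcons : ∀ t, Function.update Z 0 t = (Fin.cons t (Fin.tail Z) : Fin (n + 1) → ℂ) := by
      intro t
      conv_lhs => rw [← Fin.cons_self_tail Z]
      rw [Fin.update_cons_zero]
    have h2 : A Z = p.eval (Z 0) := by rw [← hp' _ (hZ 0), Function.update_eq_self]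
    have hdeg : p.degree < (Finset.range (D + 1)).card := by
      rw [Finset.card_range]
      exact lt_of_le_of_lt Polynomial.degree_le_natDegree (by exact_mod_cast Nat.lt_succ_of_le hp)
    rw [h2, Lagrange.eq_interpolate hx hdeg, Lagrange.interpolate_apply, Polynomial.eval_finsetSum,
      map_sum]
    refine Finset.sum_congr rfl fun j _ => ?_
    have h3 : MvPolynomial.eval Z (Polynomial.aeval (MvPolynomial.X (0 : Fin (n + 1)))
        (Lagrange.basis (Finset.range (D + 1)) x j)) =
        (Lagrange.basis (Finset.range (D + 1)) x j).eval (Z 0) := by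
      have := Polynomial.hom_eval₂ (Lagrange.basis (Finset.range (D + 1)) x j)
        (algebraMap ℂ (MvPolynomial (Fin (n + 1)) ℂ)) (MvPolynomial.eval Z) (MvPolynomial.X 0)
      rw [Polynomial.aeval_def, this, MvPolynomial.eval_X, Polynomial.eval]
      congr 1
      ext; simp
    rw [Polynomial.eval_mul, Polynomial.eval_C, map_mul, h3, MvPolynomial.eval_rename,
      ← hp' _ (hx0 j), hcons, hP j (Fin.tail Z) (fun i => hZ i.succ), mul_comm]
    rfl

end EntirePolynomial

end Kepler
end

/-! ### Homogeneous holomorphic functions have the form `A(Z) + w B(Z)` -/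

noncomputable section
namespace Kepler
open MeasureTheory Filter Topology
open scoped ComplexOrder ENNReal ComplexConjugate

section Spanning

variable {n : ℕ}

lemma pt_mem_cone {Z : Fin n → ℂ} (hZ : Z ≠ 0) {w : ℂ} (hw : w ^ 2 = -quad Z) : pt Z w ∈ cone n := by
  refine ⟨by rw [sum_sq_pt, hw, add_neg_cancel], fun h => hZ ?_⟩
  ext i
  simpa using congrFun h i.castSucc

/-- The sum of the values of `G` at the two points above `Z`. -/
def evenPart (G : (Fin (n + 1) → ℂ) → ℂ) (Z : Fin n → ℂ) : ℂ :=
  G (pt Z (root Z)) + G (pt Z (-root Z))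

lemma evenPart_eq (G : (Fin (n + 1) → ℂ) → ℂ) {Z : Fin n → ℂ} {w : ℂ} (hw : w ^ 2 = -quad Z) :
    evenPart G Z = G (pt Z w) + G (pt Z (-w)) := sum_sheets G hw

/-- A square root of `-(Z · Z)` which is holomorphic near `Z₀`. -/
def localRoot (Z₀ Z : Fin n → ℂ) : ℂ := root Z₀ * (quad Z / quad Z₀) ^ (1 / 2 : ℂ)

lemma localRoot_sq {Z₀ : Fin n → ℂ} (h : quad Z₀ ≠ 0) (Z : Fin n → ℂ) :
    localRoot Z₀ Z ^ 2 = -quad Z := by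
  have h1 : ((quad Z / quad Z₀) ^ (1 / 2 : ℂ)) ^ 2 = quad Z / quad Z₀ := by
    rw [one_div]
    exact_mod_cast Complex.cpow_nat_inv_pow (quad Z / quad Z₀) two_ne_zero
  rw [localRoot, mul_pow, root_sq, h1]
  field_simp

lemma differentiableAt_quad_div (Z₀ Z : Fin n → ℂ) :
    DifferentiableAt ℂ (fun Z : Fin n → ℂ => quad Z / quad Z₀) Z := by
  simp only [div_eq_mul_inv]
  exact (hasFDerivAt_quad Z).differentiableAt.mul_const _

lemma differentiableAt_localRoot {Z₀ : Fin n → ℂ} (h : quad Z₀ ≠ 0) :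
    DifferentiableAt ℂ (localRoot Z₀) Z₀ := by
  refine ((differentiableAt_quad_div Z₀ Z₀).cpow_const ?_).const_mul _
  rw [div_self h]
  exact Complex.one_mem_slitPlane

lemma eventually_differentiableAt_localRoot {Z₀ : Fin n → ℂ} (h : quad Z₀ ≠ 0) :
    ∀ᶠ Z in 𝓝 Z₀, DifferentiableAt ℂ (localRoot Z₀) Z := by
  have hc : ContinuousAt (fun Z : Fin n → ℂ => quad Z / quad Z₀) Z₀ :=
    (continuous_quad.div_const _).continuousAt
  have hs : ∀ᶠ Z in 𝓝 Z₀, quad Z / quad Z₀ ∈ Complex.slitPlane :=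
    hc.eventually (Complex.isOpen_slitPlane.mem_nhds
      (by simp only [div_self h]; exact Complex.one_mem_slitPlane))
  filter_upwards [hs] with Z hZ
  exact ((differentiableAt_quad_div Z₀ Z).cpow_const hZ).const_mul _

lemma continuous_pt : Continuous fun q : (Fin n → ℂ) × ℂ => pt q.1 q.2 := by
  refine continuous_pi fun i => ?_
  refine Fin.lastCases ?_ (fun i => ?_) i
  · simpa using continuous_snd
  · simp only [pt_castSucc]
    exact (continuous_apply i).comp continuous_fst

lemma continuousAt_comp_pt {G : (Fin (n + 1) → ℂ) → ℂ} (hG : ContinuousOn G (cone n))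
    {Z₀ : Fin n → ℂ} (h0 : Z₀ ≠ 0) {w : (Fin n → ℂ) → ℂ} (hw : ContinuousAt w Z₀)
    (hsq : ∀ Z, w Z ^ 2 = -quad Z) : ContinuousAt (fun Z => G (pt Z (w Z))) Z₀ := by
  have h1 : ContinuousAt (fun Z => pt Z (w Z)) Z₀ :=
    continuous_pt.continuousAt.comp (continuousAt_id.prodMk hw)
  have h2 : Tendsto (fun Z => pt Z (w Z)) (𝓝 Z₀) (𝓝[cone n] (pt Z₀ (w Z₀))) := by
    refine tendsto_nhdsWithin_iff.2 ⟨h1, ?_⟩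
    filter_upwards [isOpen_ne.mem_nhds h0] with Z hZ
    exact pt_mem_cone hZ (hsq Z)
  exact (hG _ (pt_mem_cone h0 (hsq Z₀))).tendsto.comp h2

lemma continuousAt_root_of_quad_eq_zero {Z₀ : Fin n → ℂ} (h : quad Z₀ = 0) :
    ContinuousAt root Z₀ := by
  have h0 : root Z₀ = 0 := (root_eq_zero _).2 h
  rw [ContinuousAt, h0, tendsto_zero_iff_norm_tendsto_zero]
  have h1 : (fun Z : Fin n → ℂ => ‖root Z‖) = fun Z => √‖quad Z‖ := by
    ext Z; rw [← norm_root_sq, Real.sqrt_sq (norm_nonneg _)]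
  rw [h1]
  have h2 : Continuous fun Z : Fin n → ℂ => √‖quad Z‖ := by
    have := continuous_quad (n := n)
    fun_prop
  simpa [h] using h2.tendsto Z₀

/-- The even part does not depend on the choice of the square root, so any square root continuous at
the given point may be used: the principal one on the quadric, where it tends to 0, and a local
branch elsewhere. -/
lemma continuousAt_evenPart {G : (Fin (n + 1) → ℂ) → ℂ} (hG : ContinuousOn G (cone n))
    {Z₀ : Fin n → ℂ} (h0 : Z₀ ≠ 0) : ContinuousAt (evenPart G) Z₀ := by
  obtain ⟨w, hw, hsq⟩ : ∃ w : (Fin n → ℂ) → ℂ, ContinuousAt w Z₀ ∧ ∀ Z, w Z ^ 2 = -quad Z := by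
    by_cases hq : quad Z₀ = 0
    · exact ⟨root, continuousAt_root_of_quad_eq_zero hq, root_sq⟩
    · exact ⟨localRoot Z₀, (differentiableAt_localRoot hq).continuousAt, localRoot_sq hq⟩
  have h1 : evenPart G = fun Z => G (pt Z (w Z)) + G (pt Z (-w Z)) :=
    funext fun Z => evenPart_eq G (hsq Z)
  rw [h1]
  exact (continuousAt_comp_pt hG h0 hw hsq).add
    (continuousAt_comp_pt (w := fun Z => -w Z) hG h0 hw.neg fun Z => by rw [neg_sq, hsq])

lemma differentiable_update (Z : Fin n → ℂ) (i : Fin n) :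
    Differentiable ℂ fun t : ℂ => Function.update Z i t := by
  rw [differentiable_pi]
  intro j
  by_cases h : j = i
  · subst h; simp
  · simp [h]

lemma quad_update (Z : Fin n → ℂ) (i : Fin n) (t : ℂ) :
    quad (Function.update Z i t) = t ^ 2 + ∑ j ∈ Finset.univ.erase i, Z j ^ 2 := by
  rw [quad, ← Finset.add_sum_erase _ _ (Finset.mem_univ i), Function.update_self]
  congr 1
  exact Finset.sum_congr rfl fun j hj => by
    rw [Function.update_of_ne (Finset.ne_of_mem_erase hj)]

lemma update_ne_zero (hn : 2 ≤ n) {Z : Fin n → ℂ} (hZ : ∀ j, Z j ≠ 0) (i : Fin n) (t : ℂ) :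
    Function.update Z i t ≠ 0 := by
  have : Nontrivial (Fin n) := Fin.nontrivial_iff_two_le.2 hn
  obtain ⟨j, hj⟩ := exists_ne i
  intro h
  apply hZ j
  simpa [hj] using congrFun h j

lemma differentiableAt_evenPart_comp {G : (Fin (n + 1) → ℂ) → ℂ} (hG : CurveHol (cone n) G)
    {L : ℂ → Fin n → ℂ} (hL : Differentiable ℂ L) (h0 : ∀ t, L t ≠ 0) {t : ℂ}
    (hq : quad (L t) ≠ 0) : DifferentiableAt ℂ (fun s => evenPart G (L s)) t := by
  have hd : ∀ ε : ℂ, ε ^ 2 = 1 →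
      DifferentiableAt ℂ (fun s => G (pt (L s) (ε * localRoot (L t) (L s)))) t := by
    intro ε hε
    refine hG.hol _ _ ?_
    filter_upwards [hL.continuous.continuousAt.eventually
      (eventually_differentiableAt_localRoot hq)] with s hs
    refine ⟨?_, pt_mem_cone (h0 s) (by rw [mul_pow, hε, localRoot_sq hq, one_mul])⟩
    rw [differentiableAt_pi]
    intro i
    refine Fin.lastCases ?_ (fun i => ?_) i
    · simp only [pt_last]
      exact (hs.comp s (hL s)).const_mul ε
    · simp only [pt_castSucc]
      exact differentiableAt_pi.1 (hL s) i
  have h1 : (fun s => evenPart G (L s)) = fun s => G (pt (L s) (1 * localRoot (L t) (L s))) +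
      G (pt (L s) ((-1) * localRoot (L t) (L s))) := by
    ext s
    rw [evenPart_eq G (localRoot_sq hq (L s))]
    simp
  rw [h1]
  exact (hd 1 (by norm_num)).add (hd (-1) (by norm_num))

lemma finite_sq_add_eq_zero (c : ℂ) : {t : ℂ | t ^ 2 + c = 0}.Finite := by
  open Polynomial in
  have hp0 : (X ^ 2 + C c : ℂ[X]) ≠ 0 := Polynomial.X_pow_add_C_ne_zero two_pos c
  refine (Polynomial.finite_setOfPred_isRoot hp0).subset fun t ht => ?_
  simpa [Polynomial.IsRoot] using ht

lemma norm_quad_le (Z : Fin n → ℂ) : ‖quad Z‖ ≤ ∑ i, ‖Z i‖ ^ 2 := by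
  refine (norm_sum_le _ _).trans (le_of_eq ?_)
  simp

lemma sum_norm_sq_update_le (Z : Fin n → ℂ) (i : Fin n) (t : ℂ) :
    ∑ j, ‖Function.update Z i t j‖ ^ 2 ≤ ‖t‖ ^ 2 + ∑ j, ‖Z j‖ ^ 2 := by
  rw [← Finset.add_sum_erase _ _ (Finset.mem_univ i), Function.update_self]
  gcongr
  rw [Finset.sum_congr rfl (g := fun j => ‖Z j‖ ^ 2) fun j hj => by
    rw [Function.update_of_ne (Finset.ne_of_mem_erase hj)]]
  exact Finset.sum_le_sum_of_subset_of_nonneg (Finset.erase_subset _ _)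
    fun _ _ _ => by positivity

/-- The even part of a function of polynomial growth on the cone is a polynomial. -/
lemma exists_evenPart_eq (hn : 2 ≤ n) {G : (Fin (n + 1) → ℂ) → ℂ} (hG : CurveHol (cone n) G)
    {M : ℝ} {d : ℕ} (hM : ∀ z ∈ cone n, ‖G z‖ ≤ M * (1 + normSq z) ^ d) :
    ∃ P : MvPolynomial (Fin n) ℂ, ∀ Z : Fin n → ℂ, Z ≠ 0 → evenPart G Z = MvPolynomial.eval Z P := by
  obtain ⟨P, hP⟩ := exists_mvPolynomial (2 * d) n (evenPart G) (by
    intro i Z hZ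
    set L : ℂ → Fin n → ℂ := fun t => Function.update Z i t
    have hL : Differentiable ℂ L := differentiable_update Z i
    have hL0 : ∀ t, L t ≠ 0 := update_ne_zero hn hZ i
    -- The line avoids the origin, since the other coordinates are nonzero. The restriction is
    -- continuous and is holomorphic off the zeros of a quadratic polynomial, hence entire. Since
    -- `|z|²` is of order `|t|²` along the line, the degree is at most `2 d`.
    have hent : Differentiable ℂ fun t => evenPart G (L t) := by
      refine differentiable_of_off_finite ?_
        (finite_sq_add_eq_zero (∑ j ∈ Finset.univ.erase i, Z j ^ 2)) fun t ht =>
        differentiableAt_evenPart_comp hG hL hL0 ?_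
      · exact continuous_iff_continuousAt.2 fun t =>
          ContinuousAt.comp (continuousAt_evenPart hG.cont (hL0 t)) hL.continuous.continuousAt
      · rwa [quad_update]
    set S := ∑ j, ‖Z j‖ ^ 2
    have hS : 0 ≤ S := Finset.sum_nonneg fun _ _ => by positivity
    have hM0 : 0 ≤ M := by
      have h1 := (norm_nonneg _).trans (hM _ (pt_mem_cone (hL0 0) (root_sq _)))
      exact nonneg_of_mul_nonneg_left h1
        (pow_pos (by have := normSq_nonneg (pt (L 0) (root (L 0))); positivity) _)
    have hgr : ∀ t, ‖evenPart G (L t)‖ ≤ (2 * M * (2 * (1 + S)) ^ d) * (1 + ‖t‖) ^ (2 * d) := by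
      intro t
      have h1 : ∀ w : ℂ, w ^ 2 = -quad (L t) →
          ‖G (pt (L t) w)‖ ≤ M * ((2 * (1 + S)) ^ d * (1 + ‖t‖) ^ (2 * d)) := by
        intro w hw
        refine (hM _ (pt_mem_cone (hL0 t) hw)).trans ?_
        rw [pow_mul, ← mul_pow]
        have h2 : normSq (pt (L t) w) ≤ 2 * (‖t‖ ^ 2 + S) := by
          rw [normSq_pt, ← norm_pow w, hw, norm_neg]
          have := norm_quad_le (L t)
          have := sum_norm_sq_update_le Z i t
          linarith
        have h3 := normSq_nonneg (pt (L t) w)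
        have h4 : 1 + normSq (pt (L t) w) ≤ 2 * (1 + S) * (1 + ‖t‖) ^ 2 := by
          have := norm_nonneg t
          nlinarith [mul_nonneg hS this, mul_nonneg hS (sq_nonneg ‖t‖)]
        gcongr
      refine (norm_add_le _ _).trans ((add_le_add (h1 _ (root_sq _))
        (h1 _ (by rw [neg_sq, root_sq]))).trans (le_of_eq ?_))
      ring
    obtain ⟨p, hp, hp'⟩ := exists_polynomial_of_growth hent hgr
    exact ⟨p, hp, fun t _ => hp' t⟩)
  refine ⟨P, fun Z hZ => ?_⟩
  -- Points with some vanishing coordinates are limits of `Z + t (1, …, 1)`, whose coordinates are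
  -- nonzero for small `t ≠ 0`; both sides are continuous away from the origin.
  have hc : ContinuousAt (fun t : ℂ => Z + t • (1 : Fin n → ℂ)) 0 := by fun_prop
  have h0 : Z + (0 : ℂ) • (1 : Fin n → ℂ) = Z := by simp
  have t1 : Tendsto (fun t : ℂ => evenPart G (Z + t • (1 : Fin n → ℂ))) (𝓝[≠] 0)
      (𝓝 (evenPart G Z)) := by
    have : ContinuousAt (fun t : ℂ => evenPart G (Z + t • (1 : Fin n → ℂ))) 0 :=
      ContinuousAt.comp (g := evenPart G) (f := fun t : ℂ => Z + t • (1 : Fin n → ℂ))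
        (by rw [h0]; exact continuousAt_evenPart hG.cont hZ) hc
    have h2 := this.tendsto
    rw [h0] at h2
    exact h2.mono_left nhdsWithin_le_nhds
  have t2 : Tendsto (fun t : ℂ => MvPolynomial.eval (Z + t • (1 : Fin n → ℂ)) P) (𝓝[≠] 0)
      (𝓝 (MvPolynomial.eval Z P)) := by
    have : ContinuousAt (fun t : ℂ => MvPolynomial.eval (Z + t • (1 : Fin n → ℂ)) P) 0 :=
      ContinuousAt.comp (g := fun Y => MvPolynomial.eval Y P)
        (MvPolynomial.continuous_eval P).continuousAt hc
    have h2 := this.tendsto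
    rw [h0] at h2
    exact h2.mono_left nhdsWithin_le_nhds
  refine tendsto_nhds_unique_of_eventuallyEq t1 t2 ?_
  have h3 : ∀ᶠ t : ℂ in 𝓝[≠] 0, ∀ i, Z i + t ≠ 0 := by
    rw [eventually_all]
    intro i
    by_cases hi : Z i = 0
    · filter_upwards [self_mem_nhdsWithin] with t ht
      simpa [hi] using ht
    · have : ContinuousAt (fun t : ℂ => Z i + t) 0 := by fun_prop
      exact nhdsWithin_le_nhds (this.eventually_ne (by simpa using hi))
  filter_upwards [h3] with t ht
  exact hP _ fun i => by simpa using ht i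

open Polynomial in
/-- A polynomial which vanishes on the quadric `Z · Z = 0` is divisible by `Z · Z`. -/
lemma exists_eq_quad_mul (hn : 2 ≤ n) (P : MvPolynomial (Fin n) ℂ)
    (hP : ∀ Z : Fin n → ℂ, Z ≠ 0 → quad Z = 0 → MvPolynomial.eval Z P = 0) :
    ∃ B : MvPolynomial (Fin n) ℂ, ∀ Z : Fin n → ℂ,
      MvPolynomial.eval Z P = quad Z * MvPolynomial.eval Z B := by
  obtain ⟨m, rfl⟩ : ∃ m, n = m + 1 := ⟨n - 1, by omega⟩
  set e := MvPolynomial.finSuccEquiv ℂ m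
  set c : MvPolynomial (Fin m) ℂ := ∑ i, MvPolynomial.X i ^ 2 with hc
  have hce : ∀ Y : Fin m → ℂ, MvPolynomial.eval Y c = quad Y := fun Y => by simp [hc, quad]
  set q : (MvPolynomial (Fin m) ℂ)[X] := X ^ 2 + C c with hq
  have hqm : q.Monic := monic_X_pow_add_C c two_ne_zero
  have hqd : q.natDegree = 2 := natDegree_X_pow_add_C
  -- Division by `Z · Z`, which is monic quadratic in the first variable. The linear remainder
  -- vanishes at both points `± root Y`, which are distinct if `Y · Y ≠ 0`, so its coefficients
  -- vanish there. No irreducibility is used; for `n = 2` the quadric is reducible.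
  set r := e P %ₘ q with hr
  have hrd : r.natDegree < 2 := hqd ▸ natDegree_modByMonic_lt (e P) hqm (by
    intro h; rw [h] at hqd; simp at hqd)
  obtain ⟨r1, r0, hr10⟩ : ∃ r1 r0, r = C r1 * X + C r0 :=
    ⟨_, _, eq_X_add_C_of_natDegree_le_one (by omega)⟩
  have hcons : ∀ (t : ℂ) (Y : Fin m → ℂ), quad (Fin.cons t Y : Fin (m + 1) → ℂ) = t ^ 2 + quad Y := by
    intro t Y
    rw [quad, Fin.sum_univ_succ]
    rfl
  have heval : ∀ (t : ℂ) (Y : Fin m → ℂ), MvPolynomial.eval (Fin.cons t Y : Fin (m + 1) → ℂ) P =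
      (MvPolynomial.eval Y r1 * t + MvPolynomial.eval Y r0) +
      (t ^ 2 + quad Y) * MvPolynomial.eval (Fin.cons t Y : Fin (m + 1) → ℂ) (e.symm (e P /ₘ q)) := by
    intro t Y
    have h1 := modByMonic_add_div (e P) q
    rw [← hr, hr10] at h1
    rw [MvPolynomial.eval_eq_eval_mv_eval', MvPolynomial.eval_eq_eval_mv_eval']
    change (Polynomial.map (MvPolynomial.eval Y) (e P)).eval t = _ + _ *
      (Polynomial.map (MvPolynomial.eval Y) (e (e.symm (e P /ₘ q)))).eval t
    rw [AlgEquiv.apply_symm_apply]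
    conv_lhs => rw [← h1]
    simp [hq, hce]
  have hzero : ∀ Y : Fin m → ℂ, quad Y ≠ 0 →
      MvPolynomial.eval Y r1 = 0 ∧ MvPolynomial.eval Y r0 = 0 := by
    intro Y hY
    have hY0 : Y ≠ 0 := by rintro rfl; simp [quad] at hY
    have h1 : ∀ t : ℂ, t ^ 2 = -quad Y →
        MvPolynomial.eval Y r1 * t + MvPolynomial.eval Y r0 = 0 := by
      intro t ht
      have h2 := heval t Y
      rw [hP (Fin.cons t Y) (fun h => hY0 (by ext i; simpa using congrFun h i.succ))
        (by rw [hcons, ht, neg_add_cancel]), ht] at h2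
      simpa using h2.symm
    have a := h1 (root Y) (root_sq Y)
    have b := h1 (-root Y) (by rw [neg_sq, root_sq])
    have hr0 : root Y ≠ 0 := by rwa [Ne, root_eq_zero]
    have c1 : MvPolynomial.eval Y r0 = 0 := by linear_combination (a + b) / 2
    rw [c1, add_zero] at a
    exact ⟨(mul_eq_zero.1 a).resolve_right hr0, c1⟩
  have hc0 : c ≠ 0 := by
    intro h
    have := hce (Pi.single ⟨0, by omega⟩ 1)
    rw [h, quad_single] at this
    simp at this
  -- Multiplication by the nonzero polynomial `c` gives a function vanishing everywhere, and `c` can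
  -- be cancelled in the polynomial ring.
  have hvan : ∀ s : MvPolynomial (Fin m) ℂ,
      (∀ Y : Fin m → ℂ, quad Y ≠ 0 → MvPolynomial.eval Y s = 0) → s = 0 := by
    intro s hs
    have : s * c = 0 := MvPolynomial.funext fun Y => by
      rw [map_mul, hce, map_zero]
      by_cases hY : quad Y = 0
      · rw [hY, mul_zero]
      · rw [hs Y hY, zero_mul]
    exact (mul_eq_zero.1 this).resolve_right hc0
  have e1 := hvan r1 fun Y hY => (hzero Y hY).1
  have e0 := hvan r0 fun Y hY => (hzero Y hY).2
  refine ⟨e.symm (e P /ₘ q), fun Z => ?_⟩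
  have h1 := heval (Z 0) (Fin.tail Z)
  rw [e1, e0, ← hcons, Fin.cons_self_tail] at h1
  simpa using h1

/-- Holomorphic homogeneous functions on the ball are of the form `A(Z) + w B(Z)`. -/
lemma exists_eq_add_mul (hn : 2 ≤ n) {k : ℕ} {g : (Fin (n + 1) → ℂ) → ℂ}
    (hg : CurveHol (ball n) g) (hk : IsHomog k g) :
    ∃ A B : MvPolynomial (Fin n) ℂ, ∀ z ∈ ball n,
      g z = MvPolynomial.eval (fun i => z i.castSucc) A +
        z (Fin.last n) * MvPolynomial.eval (fun i => z i.castSucc) B := by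
  obtain ⟨M, hM0, hM⟩ := exists_bound_of_isHomog hg.cont hk
  set G := extend k g with hGdef
  have hG : CurveHol (cone n) G := hg.extend hk
  have hGM : ∀ z ∈ cone n, ‖G z‖ ≤ M * (1 + normSq z) ^ k := by
    intro z hz
    rw [hGdef, extend, norm_mul, norm_pow, norm_inv, norm_shrink, inv_inv, mul_comm]
    have := normSq_nonneg z
    gcongr
    exact hM _ (shrink_smul_mem_ball hz)
  have hw : CurveHol (cone n) fun z : Fin (n + 1) → ℂ => z (Fin.last n) * G z :=
    (CurveHol.of_differentiable (differentiable_apply (Fin.last n))).mul hG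
  have hwM : ∀ z ∈ cone n, ‖z (Fin.last n) * G z‖ ≤ M * (1 + normSq z) ^ (k + 1) := by
    intro z hz
    have h1 : ‖z (Fin.last n)‖ ^ 2 ≤ normSq z :=
      Finset.single_le_sum (f := fun i => ‖z i‖ ^ 2) (fun _ _ => by positivity) (Finset.mem_univ _)
    have h2 : ‖z (Fin.last n)‖ ≤ 1 + normSq z := by nlinarith [sq_nonneg (‖z (Fin.last n)‖ - 1)]
    rw [norm_mul, pow_succ, ← mul_assoc, mul_comm]
    have := normSq_nonneg z
    exact mul_le_mul (hGM z hz) h2 (norm_nonneg _) (by positivity)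
  obtain ⟨A, hA⟩ := exists_evenPart_eq hn hG hGM
  obtain ⟨C, hC⟩ := exists_evenPart_eq hn hw hwM
  obtain ⟨B, hB⟩ := exists_eq_quad_mul hn C (by
    intro Z hZ hq
    rw [← hC Z hZ, evenPart, (root_eq_zero Z).2 hq]
    simp)
  -- The even part of `w G` is `w (G(Z, w) - G(Z, -w))`. It equals `(Z · Z) B = -w² B`, so the odd
  -- part of `G` is `-w B / 2`. Where `w = 0`, the even part of `G` alone gives the claim.
  refine ⟨MvPolynomial.C (1 / 2) * A, MvPolynomial.C (-1 / 2) * B, fun z hz => ?_⟩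
  set Z : Fin n → ℂ := fun i => z i.castSucc with hZdef
  set w := z (Fin.last n) with hwdef
  have hzp : z = pt Z w := (pt_init z).symm
  have hsq : w ^ 2 = -quad Z := by
    have := hz.1
    rw [hzp, sum_sq_pt] at this
    linear_combination this
  have hZ0 : Z ≠ 0 := by
    intro h
    rw [h] at hsq
    have h2 : w = 0 := by simpa [quad] using hsq
    apply hz.2.1
    rw [hzp, h, h2]
    ext i
    refine Fin.lastCases ?_ (fun i => ?_) i <;> simp
  have e1 := hA Z hZ0
  have e2 := hC Z hZ0
  rw [evenPart_eq _ hsq] at e1 e2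
  rw [hB] at e2
  simp only [pt_last] at e2
  have e3 : g z = G (pt Z w) := by rw [← hzp, hGdef, extend_eq_self hk hz]
  rw [e3, map_mul, map_mul, MvPolynomial.eval_C, MvPolynomial.eval_C]
  by_cases hw0 : w = 0
  · rw [hw0] at e1 ⊢
    rw [neg_zero] at e1
    linear_combination e1 / 2
  · have e4 : w * (G (pt Z w) - G (pt Z (-w)) + w * MvPolynomial.eval Z B) = 0 := by
      linear_combination e2 + MvPolynomial.eval Z B * hsq
    have e5 := (mul_eq_zero.1 e4).resolve_left hw0
    linear_combination e1 / 2 + e5 / 2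

end Spanning

end Kepler
end

/-! ### The monomial basis and its cardinality -/

noncomputable section
namespace Kepler
open MeasureTheory Filter Topology
open scoped ComplexOrder ENNReal ComplexConjugate

section Monomials

variable {n : ℕ}

/-- The exponents of the monomials `w Z^β` of degree `k`. -/
def shiftedExponents (n : ℕ) : ℕ → Finset (Fin n →₀ ℕ)
  | 0 => ∅
  | k + 1 => Finset.finsuppAntidiag Finset.univ k

/-- The index set of a basis of the homogeneous holomorphic functions of degree `k`. -/
abbrev Idx (n k : ℕ) : Type :=
  (Finset.finsuppAntidiag (Finset.univ : Finset (Fin n)) k) ⊕ (shiftedExponents n k)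

/-- The monomial basis `Z^α`, `w Z^β` of the homogeneous holomorphic functions of degree `k`. -/
def mon (k : ℕ) (i : Idx n k) (z : Fin (n + 1) → ℂ) : ℂ :=
  i.elim (fun α => ∏ j : Fin n, z j.castSucc ^ α.1 j)
    (fun β => z (Fin.last n) * ∏ j : Fin n, z j.castSucc ^ β.1 j)

lemma card_Idx (hn : 2 ≤ n) (k : ℕ) : Fintype.card (Idx n k) = N n k := by
  obtain ⟨m, rfl⟩ : ∃ m, n = m + 2 := ⟨n - 2, by omega⟩
  rw [Fintype.card_sum, Fintype.card_coe, Fintype.card_coe,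
    Finset.card_finsuppAntidiag_nat_eq_choose, N]
  congr 1
  · rw [Finset.card_univ, Fintype.card_fin]
    have : m + 2 + k - 1 = (m + 1) + k := by omega
    rw [this, show k + (m + 2) - 1 = k + (m + 1) by omega, show m + 2 - 1 = m + 1 by omega,
      add_comm k, Nat.choose_symm_add]
  · cases k with
    -- In degree 0 there is no monomial with a factor `w`, in agreement with `C(m, m + 1) = 0`.
    | zero => simp [shiftedExponents]
    | succ k =>
      rw [shiftedExponents, Finset.card_finsuppAntidiag_nat_eq_choose, Finset.card_univ,
        Fintype.card_fin]
      rw [show m + 2 + k - 1 = (m + 1) + k by omega, show k + 1 + (m + 2) - 2 = (m + 1) + k by omega,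
        show m + 2 - 1 = m + 1 by omega, Nat.choose_symm_add]

lemma differentiable_mon (k : ℕ) (i : Idx n k) : Differentiable ℂ (mon k i) := by
  rcases i with α | β
  · change Differentiable ℂ fun z : Fin (n + 1) → ℂ => ∏ j : Fin n, z j.castSucc ^ α.1 j
    fun_prop
  · change Differentiable ℂ fun z : Fin (n + 1) → ℂ =>
      z (Fin.last n) * ∏ j : Fin n, z j.castSucc ^ β.1 j
    fun_prop

lemma degree_of_mem_antidiag {k : ℕ} {α : Fin n →₀ ℕ}
    (h : α ∈ Finset.finsuppAntidiag (Finset.univ : Finset (Fin n)) k) : ∑ j, α j = k := by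
  simpa using (Finset.mem_finsuppAntidiag.1 h).1

lemma mon_smul (k : ℕ) (i : Idx n k) (c : ℂ) (z : Fin (n + 1) → ℂ) :
    mon k i (c • z) = c ^ k * mon k i z := by
  rcases i with α | β
  · have := degree_of_mem_antidiag α.2
    simp only [mon, Sum.elim_inl, Pi.smul_apply, smul_eq_mul, mul_pow, Finset.prod_mul_distrib,
      Finset.prod_pow_eq_pow_sum, this]
  · cases k with
    | zero => exact absurd β.2 (by simp [shiftedExponents])
    | succ k =>
      have := degree_of_mem_antidiag β.2
      simp only [mon, Sum.elim_inr, Pi.smul_apply, smul_eq_mul, mul_pow, Finset.prod_mul_distrib,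
        Finset.prod_pow_eq_pow_sum, this]
      ring

lemma norm_apply_le_one {z : Fin (n + 1) → ℂ} (hz : z ∈ ball n) (i : Fin (n + 1)) :
    ‖z i‖ ≤ 1 := by
  have h1 : ‖z i‖ ^ 2 ≤ normSq z :=
    Finset.single_le_sum (f := fun i => ‖z i‖ ^ 2) (fun _ _ => by positivity) (Finset.mem_univ _)
  have h2 : normSq z < 1 := hz.2.2
  nlinarith [norm_nonneg (z i)]

lemma norm_mon_le_one (k : ℕ) (i : Idx n k) {z : Fin (n + 1) → ℂ} (hz : z ∈ ball n) :
    ‖mon k i z‖ ≤ 1 := by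
  have hp : ∀ α : Fin n →₀ ℕ, ‖∏ j : Fin n, z j.castSucc ^ α j‖ ≤ 1 := by
    intro α
    rw [norm_prod]
    refine Finset.prod_le_one (fun _ _ => norm_nonneg _) fun j _ => ?_
    rw [norm_pow]
    exact pow_le_one₀ (norm_nonneg _) (norm_apply_le_one hz _)
  rcases i with α | β
  · exact hp α
  · simp only [mon, Sum.elim_inr, norm_mul]
    exact mul_le_one₀ (norm_apply_le_one hz _) (norm_nonneg _) (hp β)

/-- The polynomials whose coefficients are given by `a`. -/
def coeffPoly (s : Finset (Fin n →₀ ℕ)) (a : s → ℂ) : MvPolynomial (Fin n) ℂ :=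
  ∑ α : s, MvPolynomial.monomial (α : Fin n →₀ ℕ) (a α)

lemma eval_coeffPoly (s : Finset (Fin n →₀ ℕ)) (a : s → ℂ) (Z : Fin n → ℂ) :
    MvPolynomial.eval Z (coeffPoly s a) = ∑ α : s, a α * ∏ j, Z j ^ (α : Fin n →₀ ℕ) j := by
  rw [coeffPoly, map_sum]
  refine Finset.sum_congr rfl fun α _ => ?_
  rw [MvPolynomial.eval_monomial, Finsupp.prod_fintype _ _ (by simp)]

lemma coeff_coeffPoly (s : Finset (Fin n →₀ ℕ)) (a : s → ℂ) (α : s) :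
    MvPolynomial.coeff (α : Fin n →₀ ℕ) (coeffPoly s a) = a α := by
  classical
  rw [coeffPoly, MvPolynomial.coeff_sum, Finset.sum_eq_single α]
  · simp
  · intro β _ hb
    rw [MvPolynomial.coeff_monomial, if_neg fun h => hb (Subtype.ext h)]
  · simp

lemma sum_mon (k : ℕ) (a : Idx n k → ℂ) (z : Fin (n + 1) → ℂ) :
    ∑ i, a i * mon k i z =
      MvPolynomial.eval (fun i => z i.castSucc) (coeffPoly _ fun α => a (Sum.inl α)) +
      z (Fin.last n) *
        MvPolynomial.eval (fun i => z i.castSucc) (coeffPoly _ fun β => a (Sum.inr β)) := by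
  rw [Fintype.sum_sum_type, eval_coeffPoly, eval_coeffPoly, Finset.mul_sum]
  congr 1
  refine Finset.sum_congr rfl fun β _ => ?_
  simp only [mon, Sum.elim_inr]
  ring

lemma eval_homogeneousComponent (d : ℕ) (A : MvPolynomial (Fin n) ℂ) (Z : Fin n → ℂ) :
    MvPolynomial.eval Z (MvPolynomial.homogeneousComponent d A) =
      MvPolynomial.eval Z (coeffPoly (Finset.finsuppAntidiag Finset.univ d)
        fun α => MvPolynomial.coeff (α : Fin n →₀ ℕ) A) := by
  congr 1
  rw [MvPolynomial.homogeneousComponent_apply, coeffPoly]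
  rw [Finset.sum_coe_sort (Finset.finsuppAntidiag Finset.univ d)
    fun α => MvPolynomial.monomial α (MvPolynomial.coeff α A)]
  refine Finset.sum_subset (fun α hα => ?_) fun α h1 h2 => ?_
  · rw [Finset.mem_filter] at hα
    rw [Finset.mem_finsuppAntidiag]
    refine ⟨?_, Finset.subset_univ _⟩
    rw [← hα.2, Finsupp.degree_eq_sum]
  · rw [Finset.mem_filter, not_and] at h2
    by_cases h : α ∈ A.support
    · refine absurd ?_ (h2 h)
      rw [Finsupp.degree_eq_sum]
      exact degree_of_mem_antidiag h1
    · rw [MvPolynomial.notMem_support_iff.1 h, MvPolynomial.monomial_zero]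

lemma eval_smul_eq_sum (A : MvPolynomial (Fin n) ℂ) {D : ℕ} (hD : A.totalDegree < D)
    (c : ℂ) (Z : Fin n → ℂ) :
    MvPolynomial.eval (c • Z) A =
      ∑ d ∈ Finset.range D, c ^ d * MvPolynomial.eval Z (MvPolynomial.homogeneousComponent d A) := by
  have hs : ∑ d ∈ Finset.range D, MvPolynomial.homogeneousComponent d A = A := by
    conv_rhs => rw [← MvPolynomial.sum_homogeneousComponent A]
    symm
    refine Finset.sum_subset (Finset.range_subset_range.2 hD) fun d _ h => ?_
    refine MvPolynomial.homogeneousComponent_eq_zero d A ?_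
    simpa [Nat.succ_le_iff] using h
  conv_lhs => rw [← hs]
  rw [map_sum]
  refine Finset.sum_congr rfl fun d _ => ?_
  simp only [eval_homogeneousComponent, eval_coeffPoly, Pi.smul_apply, smul_eq_mul, mul_pow,
    Finset.prod_mul_distrib, Finset.prod_pow_eq_pow_sum, Finset.mul_sum]
  refine Finset.sum_congr rfl fun α _ => ?_
  rw [degree_of_mem_antidiag α.2]
  ring

/-- The monomials span the homogeneous holomorphic functions on the ball. -/
lemma exists_coeff (hn : 2 ≤ n) {k : ℕ} {g : (Fin (n + 1) → ℂ) → ℂ}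
    (hg : CurveHol (ball n) g) (hk : IsHomog k g) :
    ∃ a : Idx n k → ℂ, ∀ z ∈ ball n, g z = ∑ i, a i * mon k i z := by
  obtain ⟨A, B, hAB⟩ := exists_eq_add_mul hn hg hk
  refine ⟨Sum.elim (fun α => MvPolynomial.coeff (α : Fin n →₀ ℕ) A)
    fun β => MvPolynomial.coeff (β : Fin n →₀ ℕ) B, fun z hz => ?_⟩
  set Z : Fin n → ℂ := fun i => z i.castSucc with hZ
  set w := z (Fin.last n) with hw
  rw [sum_mon]
  simp only [Sum.elim_inl, Sum.elim_inr, ← hZ, ← hw]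
  obtain ⟨D, hDA, hDB, hDk⟩ : ∃ D, A.totalDegree < D ∧ B.totalDegree < D ∧ k < D :=
    ⟨A.totalDegree + B.totalDegree + k + 1, by omega, by omega, by omega⟩
  -- `P(r)` is the expansion of `A + w B` at `r z` minus `r^k g(z)`. It vanishes for `0 < r < 1`,
  -- hence identically, and its coefficient at `r^k` retains only the part of `A` of degree `k` and
  -- that of `B` of degree `k - 1`.
  set P : Polynomial ℂ := ∑ d ∈ Finset.range D,
      (Polynomial.monomial d (MvPolynomial.eval Z (MvPolynomial.homogeneousComponent d A)) +
        Polynomial.monomial (d + 1)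
          (w * MvPolynomial.eval Z (MvPolynomial.homogeneousComponent d B))) -
      Polynomial.monomial k (g z) with hP
  have hroot : ∀ r ∈ Set.Ioo (0 : ℝ) 1, P.eval (r : ℂ) = 0 := by
    intro r hr
    have hr0 : (r : ℂ) ≠ 0 := by exact_mod_cast hr.1.ne'
    have hm : (r : ℂ) • z ∈ ball n := smul_mem_ball_of_le hz hr0 (by
      rw [Complex.norm_real, Real.norm_eq_abs, abs_of_pos hr.1]; exact hr.2.le)
    have h1 := hAB _ hm
    have h2 : (fun i : Fin n => ((r : ℂ) • z) i.castSucc) = (r : ℂ) • Z := rfl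
    rw [hk z hz _ hr0 hm, h2, eval_smul_eq_sum A hDA, eval_smul_eq_sum B hDB, Pi.smul_apply,
      smul_eq_mul, ← hw, Finset.mul_sum, ← Finset.sum_add_distrib, zpow_natCast] at h1
    rw [hP, Polynomial.eval_sub, Polynomial.eval_finsetSum, Polynomial.eval_monomial, sub_eq_zero,
      mul_comm (g z), h1]
    refine Finset.sum_congr rfl fun d _ => ?_
    rw [Polynomial.eval_add, Polynomial.eval_monomial, Polynomial.eval_monomial]
    ring
  have hP0 : P = 0 := by
    refine Polynomial.eq_zero_of_infinite_isRoot P (Set.Infinite.mono (s := (fun r : ℝ => (r : ℂ)) ''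
      Set.Ioo (0 : ℝ) 1) ?_ ?_)
    · rintro _ ⟨r, hr, rfl⟩
      exact hroot r hr
    · exact (Set.Ioo_infinite one_pos).image Complex.ofReal_injective.injOn
  have hc := congrArg (fun Q => Polynomial.coeff Q k) hP0
  simp only [hP, Polynomial.coeff_sub, Polynomial.finsetSum_coeff, Polynomial.coeff_add,
    Polynomial.coeff_monomial, Finset.sum_add_distrib, Finset.sum_ite_eq', Finset.mem_range, hDk,
    if_true, Polynomial.coeff_zero] at hc
  rw [sub_eq_zero] at hc
  rw [← hc, eval_homogeneousComponent]
  congr 1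
  cases k with
  | zero => 
    have : IsEmpty (shiftedExponents n 0) := ⟨fun x => by simpa [shiftedExponents] using x.2⟩
    rw [Finset.sum_eq_zero (by intro d _; simp), eval_coeffPoly, Fintype.sum_empty, mul_zero]
  | succ k =>
    simp only [add_left_inj, Finset.sum_ite_eq', Finset.mem_range, (Nat.lt_succ_self k).trans hDk,
      if_true, eval_homogeneousComponent]
    rfl

lemma eq_zero_of_eval_eq_zero_on {U : Set (Fin n → ℂ)} (hU : IsOpen U) (hne : U.Nonempty)
    {P : MvPolynomial (Fin n) ℂ} (h : ∀ Z ∈ U, MvPolynomial.eval Z P = 0) : P = 0 := by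
  obtain ⟨Z, hZ⟩ := hne
  obtain ⟨ε, hε, hb⟩ := Metric.isOpen_iff.1 hU Z hZ
  refine MvPolynomial.funext_set (fun i => Metric.ball (Z i) ε) (fun i => ?_) fun Y hY => ?_
  · exact infinite_of_mem_nhds (Z i) (Metric.ball_mem_nhds _ hε)
  · rw [map_zero]
    refine h Y (hb ?_)
    rw [Metric.mem_ball, dist_pi_lt_iff hε]
    exact fun i => hY i (Set.mem_univ i)

/-- The monomials are linearly independent in `L²`. -/
lemma mon_linearIndependent (hn : 2 ≤ n) {k : ℕ} {a : Idx n k → ℂ}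
    (h : ∀ᵐ z ∂mu n, ∑ i, a i * mon k i z = 0) : a = 0 := by
  set A := coeffPoly _ fun α => a (Sum.inl α) with hA
  set B := coeffPoly _ fun β => a (Sum.inr β) with hB
  set Q : MvPolynomial (Fin n) ℂ := ∑ i, MvPolynomial.X i ^ 2 with hQ
  have hQe : ∀ Z : Fin n → ℂ, MvPolynomial.eval Z Q = quad Z := by
    intro Z; simp [hQ, quad]
  have hne := baseSet_nonempty (n := n) (by omega)
  have hcont : Continuous fun z : Fin (n + 1) → ℂ => ∑ i, a i * mon k i z :=
    continuous_finsetSum _ fun i _ => continuous_const.mul (differentiable_mon k i).continuous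
  have h0 : ∫⁻ z, ‖∑ i, a i * mon k i z‖ₑ ∂mu n = 0 :=
    (lintegral_eq_zero_iff hcont.measurable.enorm).2 (by
      filter_upwards [h] with z hz
      simp [hz])
  have hm1 : Measurable fun Z : Fin n → ℂ => pt Z (root Z) :=
    continuous_pt.measurable.comp (measurable_id.prodMk measurable_root)
  have hm2 : Measurable fun Z : Fin n → ℂ => pt Z (-root Z) :=
    continuous_pt.measurable.comp (measurable_id.prodMk measurable_root.neg)
  have hm : Measurable fun Z : Fin n → ℂ => ENNReal.ofReal (1 / ‖quad Z‖) *
      (‖∑ i, a i * mon k i (pt Z (root Z))‖ₑ + ‖∑ i, a i * mon k i (pt Z (-root Z))‖ₑ) :=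
    measurable_inv_quad.mul
      ((hcont.measurable.comp hm1).enorm.add (hcont.measurable.comp hm2).enorm)
  rw [lintegral_mu hcont.measurable.enorm, lintegral_eq_zero_iff hm] at h0
  -- On the two sheets the sum is `A ± root Z * B`, so both polynomials vanish almost everywhere.
  -- The factor `quad Z` covers the points excluded by the density; continuity and the identity
  -- theorem then apply.
  have hz : ∀ᵐ Z ∂volume.restrict (baseSet n), quad Z * MvPolynomial.eval Z A = 0 ∧
      quad Z * MvPolynomial.eval Z B = 0 := by
    filter_upwards [h0] with Z hZ
    by_cases hq : quad Z = 0
    · simp [hq]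
    have h1 := (mul_eq_zero.1 hZ).resolve_left (by
      simpa using hq)
    obtain ⟨h1, h1'⟩ := add_eq_zero.1 h1
    rw [enorm_eq_zero, sum_mon] at h1 h1'
    simp only [pt_last, pt_castSucc, ← hA, ← hB] at h1 h1'
    have hr : root Z ≠ 0 := fun h => hq ((root_eq_zero Z).1 h)
    have h2 : MvPolynomial.eval Z A = 0 := by linear_combination (h1 + h1') / 2
    have h3 : root Z * MvPolynomial.eval Z B = 0 := by linear_combination (h1 - h1') / 2
    rw [h2, (mul_eq_zero.1 h3).resolve_left hr]
    simp
  have key : ∀ P : MvPolynomial (Fin n) ℂ,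
      (∀ᵐ Z ∂volume.restrict (baseSet n), quad Z * MvPolynomial.eval Z P = 0) → P = 0 := by
    intro P hP
    have h1 := Measure.eqOn_open_of_ae_eq (μ := volume) (g := fun _ => (0 : ℂ)) hP
      (isOpen_baseSet n) (continuous_quad.mul P.continuous_eval).continuousOn continuousOn_const
    have h2 : Q * P = 0 := eq_zero_of_eval_eq_zero_on (isOpen_baseSet n) hne fun Z hZ => by
      rw [map_mul, hQe]
      exact h1 hZ
    refine (mul_eq_zero.1 h2).resolve_left fun hQ0 => ?_
    have h3 := hQe (Pi.single ⟨0, by omega⟩ 1)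
    rw [hQ0, map_zero, quad_single] at h3
    simp at h3
  have hA0 := key A (hz.mono fun _ h => h.1)
  have hB0 := key B (hz.mono fun _ h => h.2)
  ext i
  rcases i with α | β
  · have := coeff_coeffPoly _ (fun α => a (Sum.inl α)) α
    rw [← hA, hA0] at this
    simpa using this.symm
  · have := coeff_coeffPoly _ (fun β => a (Sum.inr β)) β
    rw [← hB, hB0] at this
    simpa using this.symm

end Monomials

end Kepler
end

/-! ### Orthonormal bases and the diagonal of the kernel in a fixed degree -/

noncomputable section
namespace Kepler
open MeasureTheory Filter Topology
open scoped ComplexOrder ENNReal ComplexConjugate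

section OrthonormalBasis

variable {n : ℕ}

lemma isFiniteMeasure_mu (hn : 2 ≤ n) : IsFiniteMeasure (mu n) := ⟨mu_univ_lt_top hn⟩

lemma memLp_mu_of_bound (hn : 2 ≤ n) {g : (Fin (n + 1) → ℂ) → ℂ} (hg : Continuous g) {C : ℝ}
    (hC : ∀ z ∈ ball n, ‖g z‖ ≤ C) (p : ℝ≥0∞) : MemLp g p (mu n) := by
  have := isFiniteMeasure_mu hn
  exact MemLp.of_bound hg.aestronglyMeasurable C ((ae_mem_ball n).mono hC)

lemma memLp_mon (hn : 2 ≤ n) (k : ℕ) (i : Idx n k) : MemLp (mon k i) 2 (mu n) :=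
  memLp_mu_of_bound hn (differentiable_mon k i).continuous (fun _ hz => norm_mon_le_one k i hz) 2

lemma coeFn_sum_toLp {α : Type*} [MeasurableSpace α] {ν : Measure α} {ι : Type*} [Fintype ι]
    {g : ι → α → ℂ} (hg : ∀ i, MemLp (g i) 2 ν) (a : ι → ℂ) :
    ((∑ i, a i • (hg i).toLp : Lp ℂ 2 ν) : α → ℂ) =ᵐ[ν] fun x => ∑ i, a i * g i x := by
  have h1 := Lp.coeFn_finsetSum (μ := ν) (p := 2) (E := ℂ) (s := Finset.univ) (f := fun i => a i • (hg i).toLp)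
  have h2 : ∀ i, ((a i • (hg i).toLp : Lp ℂ 2 ν) : α → ℂ) =ᵐ[ν] fun x => a i * g i x := by
    intro i
    filter_upwards [Lp.coeFn_smul (a i) (hg i).toLp, (hg i).coeFn_toLp] with x h1 h2
    rw [h1, Pi.smul_apply, h2, smul_eq_mul]
  have h3 := ae_all_iff.2 h2
  filter_upwards [h1, h3] with x h1 h3
  rw [h1]
  simp only [Finset.sum_apply]
  exact Finset.sum_congr rfl fun i _ => h3 i

/-- An orthonormal basis of the homogeneous holomorphic functions of degree `k`. -/
lemma exists_orthonormal (hn : 2 ≤ n) (k : ℕ) :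
    ∃ b : Fin (N n k) → (Fin (n + 1) → ℂ) → ℂ,
      (∀ a, ∃ c : Idx n k → ℂ, ∀ z, b a z = ∑ i, c i * mon k i z) ∧
      (∀ a a', ∫ z, b a z * conj (b a' z) ∂mu n = if a = a' then 1 else 0) ∧
      ∀ g, CurveHol (ball n) g → IsHomog k g →
        ∃ c : Fin (N n k) → ℂ, ∀ z ∈ ball n, g z = ∑ a, c a * b a z := by
  classical
  set v : Idx n k → Lp ℂ 2 (mu n) := fun i => (memLp_mon hn k i).toLp with hv
  have hli : LinearIndependent ℂ v := by
    rw [Fintype.linearIndependent_iff]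
    intro a ha i
    have h1 := coeFn_sum_toLp (memLp_mon hn k) a
    have h2 : (∑ i, a i • (memLp_mon hn k i).toLp : Lp ℂ 2 (mu n)) = 0 := ha
    rw [h2] at h1
    have h3 := Lp.coeFn_zero ℂ 2 (mu n)
    refine congrFun (mon_linearIndependent hn (a := a) ?_) i
    filter_upwards [h1, h3] with z h1 h3
    rw [← h1, h3, Pi.zero_apply]
  set S := Submodule.span ℂ (Set.range v) with hS
  have hfd : FiniteDimensional ℂ S := FiniteDimensional.span_of_finite ℂ (Set.finite_range v)
  have hrank : Module.finrank ℂ S = N n k := by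
    rw [hS, finrank_span_eq_card hli, card_Idx hn]
  set e := (stdOrthonormalBasis ℂ S).reindex (finCongr hrank) with he
  have hc : ∀ a, ∃ c : Idx n k → ℂ, ∑ i, c i • v i = (e a : Lp ℂ 2 (mu n)) := fun a =>
    (Submodule.mem_span_range_iff_exists_fun ℂ).1 (e a).2
  choose c hc using hc
  have hb : ∀ a, ((e a : Lp ℂ 2 (mu n)) : (Fin (n + 1) → ℂ) → ℂ) =ᵐ[mu n]
      fun z => ∑ i, c a i * mon k i z := by
    intro a
    rw [← hc a]
    exact coeFn_sum_toLp (memLp_mon hn k) (c a)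
  refine ⟨fun a z => ∑ i, c a i * mon k i z, fun a => ⟨c a, fun _ => rfl⟩, fun a a' => ?_,
    fun g hg hk => ?_⟩
  · have h1 := orthonormal_iff_ite.1 e.orthonormal a' a
    rw [Submodule.coe_inner, L2.inner_def] at h1
    refine Eq.trans (integral_congr_ae ?_) (h1.trans (by simp only [eq_comm]))
    filter_upwards [hb a, hb a'] with z h1 h2
    rw [h1, h2, RCLike.inner_apply]
  · obtain ⟨d, hd⟩ := exists_coeff hn hg hk
    have hx : (∑ i, d i • v i) ∈ S :=
      Submodule.sum_mem _ fun i _ => Submodule.smul_mem _ _ (Submodule.subset_span ⟨i, rfl⟩)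
    have h1 := e.sum_repr ⟨_, hx⟩
    set r := e.repr ⟨_, hx⟩ with hr
    have h2 : ∑ a, r a • (e a : Lp ℂ 2 (mu n)) = ∑ i, d i • v i := by
      simpa using congrArg (Subtype.val) h1
    -- An identity in `L²` holds only almost everywhere. Linear independence of the monomials turns
    -- it into equality of coefficients, hence into equality at every point.
    have h3 : ∑ i, (∑ a, r a * c a i - d i) • v i = 0 := by
      simp only [sub_smul, Finset.sum_sub_distrib, Finset.sum_smul]
      rw [sub_eq_zero, ← h2, Finset.sum_comm]
      refine Finset.sum_congr rfl fun a _ => ?_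
      rw [← hc a, Finset.smul_sum]
      simp only [mul_smul]
    have h4 := Fintype.linearIndependent_iff.1 hli _ h3
    refine ⟨fun a => r a, fun z hz => ?_⟩
    rw [hd z hz]
    simp only [Finset.mul_sum]
    rw [Finset.sum_comm]
    refine Finset.sum_congr rfl fun i _ => ?_
    rw [← sub_eq_zero.1 (h4 i), Finset.sum_mul]
    simp only [mul_assoc]

/-- A chosen orthonormal basis of the homogeneous holomorphic functions of degree `k`. -/
def onb (hn : 2 ≤ n) (k : ℕ) : Fin (N n k) → (Fin (n + 1) → ℂ) → ℂ :=
  (exists_orthonormal hn k).choose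

lemma integral_onb (hn : 2 ≤ n) (k : ℕ) (a a' : Fin (N n k)) :
    ∫ z, onb hn k a z * conj (onb hn k a' z) ∂mu n = if a = a' then 1 else 0 :=
  (exists_orthonormal hn k).choose_spec.2.1 a a'

lemma exists_eq_sum_onb (hn : 2 ≤ n) {k : ℕ} {g : (Fin (n + 1) → ℂ) → ℂ}
    (hg : CurveHol (ball n) g) (hk : IsHomog k g) :
    ∃ c : Fin (N n k) → ℂ, ∀ z ∈ ball n, g z = ∑ a, c a * onb hn k a z :=
  (exists_orthonormal hn k).choose_spec.2.2 g hg hk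

lemma differentiable_onb (hn : 2 ≤ n) (k : ℕ) (a : Fin (N n k)) :
    Differentiable ℂ (onb hn k a) := by
  obtain ⟨c, hc⟩ := (exists_orthonormal hn k).choose_spec.1 a
  have : onb hn k a = fun z => ∑ i, c i * mon k i z := funext hc
  rw [this]
  have := differentiable_mon (n := n) k
  fun_prop

lemma onb_smul (hn : 2 ≤ n) (k : ℕ) (a : Fin (N n k)) (c : ℂ) (z : Fin (n + 1) → ℂ) :
    onb hn k a (c • z) = c ^ k * onb hn k a z := by
  obtain ⟨d, hd⟩ := (exists_orthonormal hn k).choose_spec.1 a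
  change ∀ z, onb hn k a z = _ at hd
  rw [hd, hd, Finset.mul_sum]
  refine Finset.sum_congr rfl fun i _ => ?_
  rw [mon_smul]
  ring

lemma isHomog_onb (hn : 2 ≤ n) (k : ℕ) (a : Fin (N n k)) : IsHomog k (onb hn k a) := by
  intro z _ c _ _
  rw [onb_smul, zpow_natCast]

lemma exists_bound_onb (hn : 2 ≤ n) (k : ℕ) (a : Fin (N n k)) :
    ∃ C, 0 ≤ C ∧ ∀ z ∈ ball n, ‖onb hn k a z‖ ≤ C :=
  exists_bound_of_isHomog (differentiable_onb hn k a).continuous.continuousOn (isHomog_onb hn k a)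

lemma memLp_onb (hn : 2 ≤ n) (k : ℕ) (a : Fin (N n k)) (p : ℝ≥0∞) :
    MemLp (onb hn k a) p (mu n) := by
  obtain ⟨C, -, hC⟩ := exists_bound_onb hn k a
  exact memLp_mu_of_bound hn (differentiable_onb hn k a).continuous hC p

lemma integrable_onb_mul (hn : 2 ≤ n) (k : ℕ) (a a' : Fin (N n k)) :
    Integrable (fun z => onb hn k a z * conj (onb hn k a' z)) (mu n) :=
  MemLp.integrable_mul (memLp_onb hn k a 2) (memLp_onb hn k a' 2).star

lemma integral_sum_onb (hn : 2 ≤ n) (k : ℕ) (c d : Fin (N n k) → ℂ) :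
    ∫ z, (∑ a, c a * onb hn k a z) * conj (∑ a, d a * onb hn k a z) ∂mu n =
      ∑ a, c a * conj (d a) := by
  have h1 : ∀ z, (∑ a, c a * onb hn k a z) * conj (∑ a, d a * onb hn k a z) =
      ∑ a, ∑ a', c a * conj (d a') * (onb hn k a z * conj (onb hn k a' z)) := by
    intro z
    rw [map_sum, Finset.sum_mul_sum]
    refine Finset.sum_congr rfl fun a _ => Finset.sum_congr rfl fun a' _ => ?_
    rw [map_mul]
    ring
  have hi : ∀ a a', Integrable (fun z => c a * conj (d a') *
      (onb hn k a z * conj (onb hn k a' z))) (mu n) := fun a a' =>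
    (integrable_onb_mul hn k a a').const_mul _
  simp only [h1]
  rw [integral_finsetSum _ fun a _ => integrable_finsetSum _ fun a' _ => hi a a']
  refine Finset.sum_congr rfl fun a _ => ?_
  rw [integral_finsetSum _ fun a' _ => hi a a']
  simp only [integral_const_mul, integral_onb, mul_ite, mul_one, mul_zero, Finset.sum_ite_eq,
    Finset.mem_univ, if_true]

/-- The diagonal of the reproducing kernel of the homogeneous functions of degree `k`. -/
def diag (hn : 2 ≤ n) (k : ℕ) (z : Fin (n + 1) → ℂ) : ℝ := ∑ a, ‖onb hn k a z‖ ^ 2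

lemma diag_smul (hn : 2 ≤ n) (k : ℕ) (c : ℂ) (z : Fin (n + 1) → ℂ) :
    diag hn k (c • z) = ‖c‖ ^ (2 * k) * diag hn k z := by
  simp only [diag, onb_smul, norm_mul, norm_pow, mul_pow, ← pow_mul, Finset.mul_sum, mul_comm k 2]

lemma diag_eq_dotProduct (hn : 2 ≤ n) (k : ℕ) (z : Fin (n + 1) → ℂ) :
    (diag hn k z : ℂ) = star (fun a => onb hn k a z) ⬝ᵥ fun a => onb hn k a z := by
  simp only [diag, dotProduct, Pi.star_apply, Complex.ofReal_sum]
  refine Finset.sum_congr rfl fun a _ => ?_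
  rw [Complex.star_def, Complex.conj_mul']
  push_cast
  rfl

lemma differentiable_refl (v : Fin (n + 1) → ℝ) :
    Differentiable ℂ (refl v : (Fin (n + 1) → ℂ) → (Fin (n + 1) → ℂ)) := by
  unfold refl
  fun_prop

lemma refl_smul (v : Fin (n + 1) → ℝ) (c : ℂ) (z : Fin (n + 1) → ℂ) :
    refl v (c • z) = c • refl v z := by
  ext i
  have : ∑ j, (v j : ℂ) * (c * z j) = c * ∑ j, (v j : ℂ) * z j := by
    rw [Finset.mul_sum]
    exact Finset.sum_congr rfl fun j _ => by ring
  simp only [refl, Pi.smul_apply, smul_eq_mul, this]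
  ring

/-- Composition with the reflection maps functions of degree `k` to such functions and preserves the
`L²` product, because `mu` is invariant. Its matrix in the orthonormal basis is therefore unitary,
and the sum of squares is unchanged. -/
lemma diag_refl (hn : 2 ≤ n) (k : ℕ) {v : Fin (n + 1) → ℝ} (hv : ∑ i, v i ^ 2 = 1)
    {z : Fin (n + 1) → ℂ} (hz : z ∈ ball n) : diag hn k (refl v z) = diag hn k z := by
  classical
  have hU : ∀ a, ∃ c : Fin (N n k) → ℂ, ∀ z ∈ ball n,
      onb hn k a (refl v z) = ∑ a', c a' * onb hn k a' z := fun a =>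
    exists_eq_sum_onb hn
      (CurveHol.of_differentiable ((differentiable_onb hn k a).comp (differentiable_refl v)))
      fun z _ c _ _ => by
        simp only [refl_smul, onb_smul, zpow_natCast]
  choose U hU using hU
  set M : Matrix (Fin (N n k)) (Fin (N n k)) ℂ := Matrix.of U with hM
  have hM1 : M * M.conjTranspose = 1 := by
    ext a a'
    have hmp := measurePreserving_refl (by omega : 1 ≤ n) hv
    have h1 : ∫ z, onb hn k a (refl v z) * conj (onb hn k a' (refl v z)) ∂mu n =
        if a = a' then 1 else 0 := by
      rw [← integral_onb hn k a a']
      conv_rhs => rw [← hmp.map_eq]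
      rw [integral_map hmp.measurable.aemeasurable]
      exact ((differentiable_onb hn k a).continuous.mul
        (Complex.continuous_conj.comp (differentiable_onb hn k a').continuous)).aestronglyMeasurable
    rw [Matrix.one_apply, ← h1, integral_congr_ae (g := fun z =>
      (∑ i, U a i * onb hn k i z) * conj (∑ i, U a' i * onb hn k i z)), integral_sum_onb]
    · rfl
    · filter_upwards [ae_mem_ball n] with z hz
      rw [hU a z hz, hU a' z hz]
  have hM2 := mul_eq_one_comm.1 hM1
  have h1 : (fun a => onb hn k a (refl v z)) = M.mulVec fun a => onb hn k a z := by
    ext a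
    rw [hU a z hz]
    rfl
  have h2 : (diag hn k (refl v z) : ℂ) = diag hn k z := by
    rw [diag_eq_dotProduct, diag_eq_dotProduct, h1, Matrix.star_mulVec, Matrix.dotProduct_mulVec,
      Matrix.vecMul_vecMul, hM2, Matrix.vecMul_one]
  exact_mod_cast h2

lemma diag_mul_pow (hn : 2 ≤ n) (k : ℕ) {z z' : Fin (n + 1) → ℂ} (hz : z ∈ ball n)
    (hz' : z' ∈ ball n) : diag hn k z * normSq z' ^ k = diag hn k z' * normSq z ^ k := by
  -- The larger of the two points is scaled down to the level of the smaller one, so as to stay in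
  -- the ball; on one level `diag` is constant by reflection invariance.
  wlog h : normSq z ≤ normSq z' generalizing z z'
  · exact (this hz' hz (le_of_not_ge h)).symm
  have h0 := normSq_pos hz.2.1
  have h0' := normSq_pos hz'.2.1
  set r : ℝ := Real.sqrt (normSq z / normSq z') with hr
  have hr0 : 0 < r := Real.sqrt_pos.2 (div_pos h0 h0')
  have hr2 : r ^ 2 = normSq z / normSq z' := Real.sq_sqrt (div_pos h0 h0').le
  have hr1 : ‖(r : ℂ)‖ = r := by rw [Complex.norm_real, Real.norm_eq_abs, abs_of_pos hr0]
  have hm : (r : ℂ) • z' ∈ ball n := smul_mem_ball_of_le hz' (by exact_mod_cast hr0.ne') (by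
    rw [hr1]
    exact Real.sqrt_le_one.2 ((div_le_one h0').2 h))
  have h1 : diag hn k z = diag hn k ((r : ℂ) • z') := by
    refine eq_of_normSq_eq (fun v hv z hz => diag_refl hn k hv hz) hz hm ?_
    rw [normSq_smul, hr1, hr2, div_mul_cancel₀ _ h0'.ne']
  rw [h1, diag_smul, hr1, pow_mul, hr2, div_pow]
  field_simp

lemma lintegral_normSq_pow (hn : 2 ≤ n) (k : ℕ) :
    ∫⁻ z, ENNReal.ofReal (normSq z ^ k) ∂mu n =
      ENNReal.ofReal ((n - 1) / (n + k - 1)) * mu n Set.univ := by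
  have h1 := lintegral_mu_radial hn (h := fun _ => 1) (k := 0) measurable_const (by simp)
    (by simpa using (mu_univ_lt_top hn).ne) (φ := fun t => ENNReal.ofReal (t ^ k)) (by fun_prop)
  simp only [one_mul, zero_add, lintegral_const] at h1
  have h2 : ∀ t ∈ Set.Ioo (0 : ℝ) 1, ENNReal.ofReal (t ^ (n - 2)) * ENNReal.ofReal (t ^ k) =
      ENNReal.ofReal (1 / ((n - 2 + k : ℕ) + 1)) *
        ENNReal.ofReal (((n - 2 + k : ℕ) + 1) * t ^ (n - 2 + k)) := by
    intro t ht
    rw [← ENNReal.ofReal_mul (pow_nonneg ht.1.le _), ← ENNReal.ofReal_mul (by positivity), pow_add]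
    congr 1
    field_simp
  rw [h1, setLIntegral_congr_fun measurableSet_Ioo h2, lintegral_const_mul _ (by fun_prop),
    lintegral_Ioo_pow _ zero_le_one, one_pow, ENNReal.ofReal_one, mul_one, mul_right_comm,
    ← ENNReal.ofReal_mul (Nat.cast_nonneg _)]
  congr 2
  have h3 : ((n - 1 : ℕ) : ℝ) = n - 1 := by rw [Nat.cast_sub (by omega), Nat.cast_one]
  have h4 : ((n - 2 + k : ℕ) : ℝ) = n - 2 + k := by
    rw [Nat.cast_add, Nat.cast_sub (by omega), Nat.cast_two]
  rw [h3, h4]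
  ring

lemma integral_diag (hn : 2 ≤ n) (k : ℕ) : ∫ z, diag hn k z ∂mu n = N n k := by
  have h1 : ((∫ z, diag hn k z ∂mu n : ℝ) : ℂ) = N n k := by
    rw [← integral_complex_ofReal]
    simp only [diag]
    have h2 : ∀ z, ((∑ a, ‖onb hn k a z‖ ^ 2 : ℝ) : ℂ) =
        ∑ a, onb hn k a z * conj (onb hn k a z) := by
      intro z
      push_cast
      exact Finset.sum_congr rfl fun a _ => (Complex.mul_conj' _).symm
    simp only [h2]
    rw [integral_finsetSum _ fun a _ => integrable_onb_mul hn k a a]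
    simp [integral_onb]
  exact_mod_cast h1

/-- The constant `c_𝕄` in terms of the total mass. -/
lemma cM_eq (n : ℕ) : cM n = (n - 1) * (n + 1) ^ 2 * (mu n).real Set.univ := by
  rw [cM, rho_eq, Measure.real, Measure.smul_apply, smul_eq_mul, mu_ball, ENNReal.toReal_mul,
    ENNReal.toReal_ofReal (by positivity), Measure.real, mul_assoc]

lemma cM_pos (hn : 2 ≤ n) : 0 < cM n := by
  have h2 : (2 : ℝ) ≤ n := by exact_mod_cast hn
  have h3 : 0 < (mu n).real Set.univ :=
    ENNReal.toReal_pos (mu_univ_pos (by omega)).ne' (mu_univ_lt_top hn).ne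
  rw [cM_eq]
  have : 0 < (n : ℝ) - 1 := by linarith
  positivity

/-- Integrating `diag_mul_pow` over `z'` determines the constant: the diagonal has integral `N(k)`,
the dimension, while `|z'|^(2k)` has integral `(n - 1)/(n + k - 1)` times the total mass. -/
lemma diag_eq (hn : 2 ≤ n) (k : ℕ) {z : Fin (n + 1) → ℂ} (hz : z ∈ ball n) :
    diag hn k z = (n + 1) ^ 2 / cM n * (N n k * (k + n - 1)) * normSq z ^ k := by
  have h0 := normSq_pos hz.2.1
  have hn2 : (2 : ℝ) ≤ n := by exact_mod_cast hn
  have hm : 0 < (mu n).real Set.univ :=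
    ENNReal.toReal_pos (mu_univ_pos (by omega)).ne' (mu_univ_lt_top hn).ne
  have h1 : ∫ z', diag hn k z * normSq z' ^ k ∂mu n = ∫ z', diag hn k z' * normSq z ^ k ∂mu n := by
    refine integral_congr_ae ?_
    filter_upwards [ae_mem_ball n] with z' hz'
    exact diag_mul_pow hn k hz hz'
  have h2 : ∫ z', normSq z' ^ k ∂mu n = (n - 1) / (n + k - 1) * (mu n).real Set.univ := by
    rw [integral_eq_lintegral_of_nonneg_ae (ae_of_all _ fun z => pow_nonneg (normSq_nonneg z) k)
      (continuous_normSq.pow k).aestronglyMeasurable, lintegral_normSq_pow hn, ENNReal.toReal_mul,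
      ENNReal.toReal_ofReal, Measure.real]
    exact div_nonneg (by linarith) (by have : (0 : ℝ) ≤ k := Nat.cast_nonneg k; linarith)
  rw [integral_const_mul, integral_mul_const, integral_diag, h2] at h1
  have h3 : 0 < (n : ℝ) - 1 := by linarith
  have h4 : 0 < (n : ℝ) + k - 1 := by have : (0 : ℝ) ≤ k := Nat.cast_nonneg k; linarith
  have h5 : 0 < (k : ℝ) + n - 1 := by linarith
  rw [cM_eq]
  field_simp at h1 ⊢
  linear_combination h1

end OrthonormalBasis

end Kepler
end

/-! ### Homogeneous components along the circle action -/

noncomputable section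
namespace Kepler
open MeasureTheory Filter Topology
open scoped ComplexOrder ENNReal ComplexConjugate

section FourierComponents

variable {n : ℕ}

/-- Holomorphic dependence of an integral over a compact space on a parameter. -/
lemma differentiableAt_integral_of_compact {α : Type*} [TopologicalSpace α] [CompactSpace α]
    [MeasurableSpace α] [OpensMeasurableSpace α] [SecondCountableTopology α] {ν : Measure α}
    [IsFiniteMeasure ν] {U : Set ℂ} (hU : IsOpen U) {F : ℂ → α → ℂ}
    (hF : ContinuousOn (fun q : ℂ × α => F q.1 q.2) (U ×ˢ Set.univ))
    (hd : ∀ x, ∀ s ∈ U, DifferentiableAt ℂ (fun s => F s x) s) {s₀ : ℂ} (hs₀ : s₀ ∈ U) :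
    DifferentiableAt ℂ (fun s => ∫ x, F s x ∂ν) s₀ := by
  obtain ⟨ε, hε, hb⟩ := Metric.nhds_basis_closedBall.mem_iff.1 (hU.mem_nhds hs₀)
  set r := ε / 2 with hr
  have hr0 : 0 < r := by positivity
  have hcF : ∀ s ∈ U, Continuous (F s) := fun s hs =>
    hF.comp_continuous (f := fun x => (s, x)) (by fun_prop) fun x => ⟨hs, Set.mem_univ x⟩
  obtain ⟨M, hM⟩ := ((isCompact_closedBall s₀ ε).prod isCompact_univ).exists_bound_of_continuousOn
    (hF.mono (Set.prod_mono hb le_rfl))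
  have hM' : ∀ s ∈ Metric.closedBall s₀ ε, ∀ x, ‖F s x‖ ≤ M := fun s hs x =>
    hM (s, x) ⟨hs, Set.mem_univ x⟩
  -- Cauchy's estimate on circles of radius `r` turns the uniform bound for `F` into one for its
  -- derivative, which dominates the difference quotients.
  have hderiv : ∀ x, ∀ s ∈ Metric.ball s₀ r, ‖deriv (fun s => F s x) s‖ ≤ M / r := by
    intro x s hs
    have hsub : Metric.closedBall s r ⊆ Metric.closedBall s₀ ε := by
      refine Metric.closedBall_subset_closedBall' ?_
      rw [Metric.mem_ball] at hs
      linarith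
    refine Complex.norm_deriv_le_of_forall_mem_sphere_norm_le hr0 ?_ fun z hz =>
      hM' z (hsub (Metric.sphere_subset_closedBall hz)) x
    refine DifferentiableOn.diffContOnCl fun z hz => ?_
    rw [closure_ball _ hr0.ne'] at hz
    exact (hd x z (hb (hsub hz))).differentiableWithinAt
  -- Measurability of the derivative in `x`: it is a limit of difference quotients along a real
  -- sequence of increments.
  have hmeas : AEStronglyMeasurable (fun x => deriv (fun s => F s x) s₀) ν := by
    obtain ⟨u, -, hum, hu⟩ := exists_seq_strictAnti_tendsto' (x := (0 : ℝ)) (y := ε) hε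
    have hu0 : ∀ m, 0 < u m := fun m => (hum m).1
    have hu1 : ∀ m, u m < ε := fun m => (hum m).2
    have hmem : ∀ m, s₀ + (u m : ℂ) ∈ U := fun m => hb (by
      rw [Metric.mem_closedBall, dist_self_add_left, Complex.norm_real, Real.norm_eq_abs,
        abs_of_pos (hu0 m)]
      exact (hu1 m).le)
    refine aestronglyMeasurable_of_tendsto_ae atTop
      (f := fun m x => (u m : ℂ)⁻¹ * (F (s₀ + u m) x - F s₀ x)) (fun m => ?_) (ae_of_all _ fun x => ?_)
    · exact (continuous_const.mul ((hcF _ (hmem m)).sub (hcF _ hs₀))).aestronglyMeasurable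
    · have h1 := (hd x s₀ hs₀).hasDerivAt.tendsto_slope_zero
      have h2 : Tendsto (fun m => (u m : ℂ)) atTop (𝓝[≠] 0) := by
        refine tendsto_nhdsWithin_iff.2 ⟨?_, Eventually.of_forall fun m => ?_⟩
        · exact (Complex.continuous_ofReal.tendsto 0).comp hu
        · simpa using (hu0 m).ne'
      simpa [Function.comp_def] using h1.comp h2
  have := hasDerivAt_integral_of_dominated_loc_of_deriv_le (μ := ν) (F := F)
    (F' := fun s x => deriv (fun s => F s x) s) (bound := fun _ => M / r)
    (Metric.ball_mem_nhds s₀ hr0) ?_ ?_ hmeas (ae_of_all _ hderiv) (integrable_const _)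
    (ae_of_all _ fun x s hs => (hd x s (hb ?_)).hasDerivAt)
  · exact this.2.differentiableAt
  · filter_upwards [hU.mem_nhds hs₀] with s hs
    exact (hcF s hs).aestronglyMeasurable
  · exact Integrable.of_bound (hcF s₀ hs₀).aestronglyMeasurable M
      (ae_of_all _ (hM' s₀ (Metric.mem_closedBall_self hε.le)))
  · exact Metric.ball_subset_closedBall (Metric.ball_subset_ball (by linarith) hs)

/-- The parametrization of the unit circle. -/
def rot (t : UnitAddCircle) : ℂ := fourier 1 t

lemma continuous_rot : Continuous rot := (fourier 1).continuous

lemma norm_rot (t : UnitAddCircle) : ‖rot t‖ = 1 := by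
  rw [rot, fourier_apply]
  exact Circle.norm_coe _

lemma rot_ne_zero (t : UnitAddCircle) : rot t ≠ 0 := by
  rw [← norm_ne_zero_iff, norm_rot]
  exact one_ne_zero

lemma rot_add (s t : UnitAddCircle) : rot (s + t) = rot s * rot t := by
  simp only [rot, fourier_one, AddCircle.toCircle_add, Circle.coe_mul]

lemma exists_rot_eq {u : ℂ} (hu : ‖u‖ = 1) : ∃ t, rot t = u := by
  obtain ⟨t, ht⟩ := (AddCircle.homeomorphCircle (T := (1 : ℝ)) one_ne_zero).surjective
    ⟨u, mem_sphere_zero_iff_norm.2 hu⟩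
  refine ⟨t, ?_⟩
  rw [AddCircle.homeomorphCircle_apply] at ht
  rw [rot, fourier_one, ht]

lemma fourier_eq_rot_zpow (k : ℤ) (t : UnitAddCircle) : (fourier k t : ℂ) = rot t ^ k := by
  rw [rot, fourier_one, fourier_apply, AddCircle.toCircle_zsmul, Circle.coe_zpow]

lemma rot_smul_mem_ball {z : Fin (n + 1) → ℂ} (hz : z ∈ ball n) (t : UnitAddCircle) :
    rot t • z ∈ ball n := smul_mem_ball_of_le hz (rot_ne_zero t) (norm_rot t).le

/-- The component of degree `k` of a function on the ball. -/
def comp (k : ℤ) (g : (Fin (n + 1) → ℂ) → ℂ) (z : Fin (n + 1) → ℂ) : ℂ :=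
  fourierCoeff (fun t : UnitAddCircle => g (rot t • z)) k

lemma comp_eq (k : ℤ) (g : (Fin (n + 1) → ℂ) → ℂ) (z : Fin (n + 1) → ℂ) :
    comp k g z = ∫ t : UnitAddCircle, rot t ^ (-k) * g (rot t • z) ∂AddCircle.haarAddCircle := by
  simp only [comp, fourierCoeff, fourier_eq_rot_zpow, smul_eq_mul]

lemma continuousOn_rot_zpow_mul {g : (Fin (n + 1) → ℂ) → ℂ} (hg : ContinuousOn g (ball n)) (k : ℤ) :
    ContinuousOn (fun q : (Fin (n + 1) → ℂ) × UnitAddCircle => rot q.2 ^ k * g (rot q.2 • q.1))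
      (ball n ×ˢ Set.univ) := by
  refine ContinuousOn.mul ?_ ?_
  · exact ((continuous_rot.comp continuous_snd).zpow₀ k fun q => Or.inl (rot_ne_zero _)).continuousOn
  · exact hg.comp ((continuous_rot.comp continuous_snd).smul continuous_fst).continuousOn
      fun q hq => rot_smul_mem_ball hq.1 q.2

lemma isLocallyClosed_ball (n : ℕ) : IsLocallyClosed (ball n) := by
  have h1 : IsClosed {z : Fin (n + 1) → ℂ | ∑ i, z i ^ 2 = 0} :=
    isClosed_eq (by fun_prop) continuous_const
  have h2 : IsOpen {z : Fin (n + 1) → ℂ | z ≠ 0} := isOpen_ne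
  have h3 : IsOpen {z : Fin (n + 1) → ℂ | normSq z < 1} :=
    isOpen_lt continuous_normSq continuous_const
  exact h1.isLocallyClosed.inter (h2.inter h3).isLocallyClosed

lemma continuousOn_comp {g : (Fin (n + 1) → ℂ) → ℂ} (hg : ContinuousOn g (ball n)) (k : ℤ) :
    ContinuousOn (comp k g) (ball n) := by
  have := (isLocallyClosed_ball n).locallyCompactSpace
  rw [continuousOn_iff_continuous_domRestrict]
  have h1 := continuous_parametric_integral_of_continuous (X := ball n)
    (μ := (AddCircle.haarAddCircle : Measure UnitAddCircle))
    (f := fun z t => rot t ^ (-k) * g (rot t • z.1)) ?_ isCompact_univ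
  · simpa only [Measure.restrict_univ, Set.domRestrict_def, comp_eq] using h1
  · exact (continuousOn_rot_zpow_mul hg (-k)).comp_continuous
      (f := fun q : ball n × UnitAddCircle => (q.1.1, q.2)) (by fun_prop)
      fun q => ⟨q.1.2, Set.mem_univ _⟩

lemma CurveHol.comp {g : (Fin (n + 1) → ℂ) → ℂ} (hg : CurveHol (ball n) g) (k : ℤ) :
    CurveHol (ball n) (comp k g) := by
  refine ⟨continuousOn_comp hg.cont k, fun γ t₀ h => ?_⟩
  obtain ⟨U, hU, hUo, htU⟩ := mem_nhds_iff.1 h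
  simp only [comp_eq]
  refine differentiableAt_integral_of_compact hUo (F := fun s t => rot t ^ (-k) * g (rot t • γ s))
    ?_ (fun t s hs => ?_) htU
  · have hγ : ContinuousOn γ U := fun s hs => (hU hs).1.continuousAt.continuousWithinAt
    exact (continuousOn_rot_zpow_mul hg.cont (-k)).comp
      (f := fun q : ℂ × UnitAddCircle => (γ q.1, q.2))
      ((hγ.comp continuousOn_fst fun q hq => hq.1).prodMk continuousOn_snd)
      fun q hq => ⟨(hU hq.1).2, Set.mem_univ _⟩
  · refine (hg.hol (fun s => rot t • γ s) s ?_).const_mul _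
    filter_upwards [hUo.mem_nhds hs] with s hs
    exact ⟨(hU hs).1.fun_const_smul _, rot_smul_mem_ball (hU hs).2 t⟩

lemma comp_smul_of_norm_eq_one (k : ℤ) (g : (Fin (n + 1) → ℂ) → ℂ) {u : ℂ} (hu : ‖u‖ = 1)
    (z : Fin (n + 1) → ℂ) : comp k g (u • z) = u ^ k * comp k g z := by
  obtain ⟨s, rfl⟩ := exists_rot_eq hu
  rw [comp_eq, comp_eq, ← integral_const_mul,
    ← integral_add_right_eq_self (fun t => rot s ^ k * (rot t ^ (-k) * g (rot t • z))) s]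
  congr 1
  ext t
  rw [rot_add, mul_zpow, smul_smul, zpow_neg, zpow_neg]
  have := zpow_ne_zero k (rot_ne_zero s)
  field_simp

/-- Homogeneity under unit scalars follows from invariance of Haar measure. For the others, the
function `H` of `σ = log c` is holomorphic on a half-plane and invariant under imaginary
translations; its derivative vanishes, so it is constant. -/
lemma isHomog_comp {g : (Fin (n + 1) → ℂ) → ℂ} (hg : CurveHol (ball n) g) (k : ℤ) :
    IsHomog k (comp k g) := by
  intro z hz c hc hcz
  -- `Re σ < L` says precisely that `exp σ • z` has norm less than 1, so the half-plane contains the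
  -- logarithms of all admissible factors, also those of modulus above 1.
  set L : ℝ := -Real.log (normSq z) / 2 with hL
  have h0 := normSq_pos hz.2.1
  have hmem : ∀ σ : ℂ, σ.re < L → Complex.exp σ • z ∈ ball n := fun σ hσ =>
    smul_mem_ball hz (Complex.exp_ne_zero σ) (by
      rw [Complex.norm_exp, ← Real.exp_nat_mul]
      conv_lhs => rw [← Real.exp_log h0]
      rw [← Real.exp_add, Real.exp_lt_one_iff]
      push_cast
      linarith)
  set S : Set ℂ := {σ | σ.re < L} with hS
  have hSo : IsOpen S := isOpen_lt Complex.continuous_re continuous_const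
  have hSc : IsPreconnected S := (convex_halfSpace_re_lt L).isPreconnected
  set H : ℂ → ℂ := fun σ => comp k g (Complex.exp σ • z) * Complex.exp (-k * σ) with hH
  have hd : ∀ σ ∈ S, DifferentiableAt ℂ H σ := by
    intro σ hσ
    refine DifferentiableAt.mul ?_ (by fun_prop)
    refine (hg.comp k).hol (fun σ => Complex.exp σ • z) σ ?_
    filter_upwards [hSo.mem_nhds hσ] with s hs
    exact ⟨by fun_prop, hmem s hs⟩
  have hper : ∀ σ (θ : ℝ), H (σ + θ * Complex.I) = H σ := by
    intro σ θ
    have h1 : ‖Complex.exp (θ * Complex.I)‖ = 1 := Complex.norm_exp_ofReal_mul_I θ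
    simp only [hH]
    rw [Complex.exp_add, mul_comm (Complex.exp σ), ← smul_smul, comp_smul_of_norm_eq_one k g h1,
      ← Complex.exp_int_mul, mul_comm _ (comp k g _), mul_assoc, ← Complex.exp_add]
    congr 2
    ring
  have hderiv : Set.EqOn (deriv H) 0 S := by
    intro σ hσ
    have h1 := (hd σ hσ).hasDerivAt
    have h2 : HasDerivAt (fun θ : ℝ => σ + θ * Complex.I) Complex.I 0 := by
      simpa using ((Complex.ofRealCLM.hasDerivAt (x := (0 : ℝ))).mul_const Complex.I).const_add σ
    have h3 : HasDerivAt (fun θ : ℝ => H (σ + θ * Complex.I)) (deriv H σ * Complex.I) 0 := by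
      refine HasDerivAt.comp (h₂ := H) 0 ?_ h2
      simpa using h1
    simp only [hper] at h3
    have h4 := h3.unique (hasDerivAt_const (0 : ℝ) (H σ))
    simpa using h4
  have hconst : ∀ σ ∈ S, ∀ τ ∈ S, H σ = H τ := fun σ hσ τ hτ =>
    hSo.is_const_of_deriv_eq_zero hSc (fun σ hσ => (hd σ hσ).differentiableWithinAt) hderiv hσ hτ
  have hl1 : (0 : ℂ) ∈ S := by
    have : Real.log (normSq z) < 0 := Real.log_neg h0 hz.2.2
    simp only [hS, Set.mem_ofPred_eq, Complex.zero_re, hL]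
    linarith
  have hl2 : Complex.log c ∈ S := by
    have h1 : normSq (c • z) < 1 := hcz.2.2
    have hc0 : 0 < ‖c‖ := norm_pos_iff.2 hc
    rw [normSq_smul] at h1
    have h2 := Real.log_neg (by positivity) h1
    rw [Real.log_mul (by positivity) h0.ne', Real.log_pow] at h2
    simp only [hS, Set.mem_ofPred_eq, Complex.log_re, hL]
    push_cast at h2
    linarith
  have h1 := hconst _ hl2 _ hl1
  simp only [hH, Complex.exp_log hc, Complex.exp_zero, one_smul, mul_zero, mul_one] at h1
  rw [← h1, mul_comm, mul_assoc]
  have h2 : Complex.exp (-k * Complex.log c) * c ^ k = 1 := by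
    conv_lhs => rw [← Complex.exp_log hc]
    rw [← Complex.exp_int_mul, Complex.log_exp, ← Complex.exp_add]
    · simp
    · exact Complex.neg_pi_lt_log_im c
    · exact Complex.log_im_le_pi c
  rw [h2, mul_one]

lemma exists_mem_ball_apply_eq_zero (hn : 2 ≤ n) (l : Fin (n + 1)) : ∃ p ∈ ball n, p l = 0 := by
  obtain ⟨m, rfl⟩ : ∃ m, n = m + 1 := ⟨n - 1, by omega⟩
  obtain ⟨p, hp, -, -⟩ := exists_mem_ball_normSq (n := m) (by omega) (t := 1 / 2) (by norm_num)
  refine ⟨l.insertNth (α := fun _ => ℂ) 0 p, ⟨?_, fun h => hp.2.1 ?_, ?_⟩, by simp⟩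
  · rw [Fin.sum_univ_succAbove _ l]
    simpa using hp.1
  · ext i
    simpa using congrFun h (l.succAbove i)
  · rw [normSq, Fin.sum_univ_succAbove _ l]
    simpa [normSq] using hp.2.2

/-- There are no holomorphic functions of negative degree, by Hartogs' phenomenon. -/
lemma eq_zero_of_isHomog_neg (hn : 2 ≤ n) {g : (Fin (n + 1) → ℂ) → ℂ} (hg : CurveHol (ball n) g)
    {k : ℤ} (hk : k < 0) (hh : IsHomog k g) {z : Fin (n + 1) → ℂ} (hz : z ∈ ball n) : g z = 0 := by
  obtain ⟨m, hm⟩ : ∃ m : ℕ, k = -(m : ℤ) := ⟨k.natAbs, by omega⟩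
  have hm0 : m ≠ 0 := by omega
  -- The product has degree 0, so it is constant by `exists_coeff`; and it vanishes at points of the
  -- ball whose `l`-th coordinate is zero.
  have key : ∀ l : Fin (n + 1), z l ^ m * g z = 0 := by
    intro l
    have hG : CurveHol (ball n) fun z : Fin (n + 1) → ℂ => z l ^ m * g z :=
      (CurveHol.of_differentiable (by fun_prop)).mul hg
    obtain ⟨a, ha⟩ := exists_coeff hn (k := 0) hG (by
      intro z hz c hc hcz
      simp only [Pi.smul_apply, smul_eq_mul, mul_pow, hh z hz c hc hcz, hm, zpow_neg, zpow_natCast,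
        Nat.cast_zero, zpow_zero]
      have := pow_ne_zero m hc
      field_simp)
    have hmon : ∀ i (p q : Fin (n + 1) → ℂ), mon 0 i p = mon 0 i q := by
      intro i p q
      rcases i with α | β
      · have h0 : ∀ j, α.1 j = 0 := fun j => by
          simpa using (Finset.sum_eq_zero_iff.1 (degree_of_mem_antidiag α.2)) j (Finset.mem_univ j)
        simp [mon, h0]
      · exact absurd β.2 (by simp [shiftedExponents])
    obtain ⟨p, hp, hpl⟩ := exists_mem_ball_apply_eq_zero hn l
    have h1 := ha p hp
    rw [hpl, zero_pow hm0, zero_mul] at h1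
    rw [ha z hz, h1]
    exact Finset.sum_congr rfl fun i _ => by rw [hmon i z p]
  obtain ⟨l, hl⟩ := Function.ne_iff.1 hz.2.1
  exact (mul_eq_zero.1 (key l)).resolve_left (pow_ne_zero m hl)

/-- This is the Fourier series of `t ↦ g (rot t • z)` at `t = 0`. Since `R z` is still in the ball
for some `R > 1`, homogeneity makes the components decay like `R^(-k)`, so the series converges
absolutely; the negative ones vanish. -/
lemma hasSum_comp (hn : 2 ≤ n) {g : (Fin (n + 1) → ℂ) → ℂ} (hg : CurveHol (ball n) g)
    {z : Fin (n + 1) → ℂ} (hz : z ∈ ball n) : HasSum (fun k : ℕ => comp k g z) (g z) := by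
  have hneg : ∀ k : ℤ, k < 0 → comp k g z = 0 := fun k hk =>
    eq_zero_of_isHomog_neg hn (hg.comp k) hk (isHomog_comp hg k) hz
  have hf : Continuous fun t : UnitAddCircle => g (rot t • z) :=
    hg.cont.comp_continuous (continuous_rot.smul continuous_const) fun t => rot_smul_mem_ball hz t
  have h0 := normSq_pos hz.2.1
  obtain ⟨R, hR1, hR⟩ : ∃ R : ℝ, 1 < R ∧ R ^ 2 * normSq z < 1 := by
    obtain ⟨s, hs1, hs2⟩ := exists_between ((one_lt_inv₀ h0).2 hz.2.2)
    refine ⟨Real.sqrt s, Real.lt_sqrt_of_sq_lt (by simpa using hs1), ?_⟩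
    rw [Real.sq_sqrt (by linarith)]
    rwa [lt_inv_comm₀ (by linarith) h0, lt_inv_comm₀ h0 (by linarith), ← one_div,
      lt_div_iff₀ h0] at hs2
  have hR0 : (R : ℂ) ≠ 0 := by exact_mod_cast (by linarith : R ≠ 0)
  have hRn : ‖(R : ℂ)‖ = R := by rw [Complex.norm_real, Real.norm_eq_abs, abs_of_pos (by linarith)]
  have hRz : (R : ℂ) • z ∈ ball n := smul_mem_ball hz hR0 (by rwa [hRn])
  have hfR : Continuous fun t : UnitAddCircle => g (rot t • (R : ℂ) • z) :=
    hg.cont.comp_continuous (continuous_rot.smul continuous_const) fun t => rot_smul_mem_ball hRz t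
  obtain ⟨M, hM⟩ := isCompact_univ.exists_bound_of_continuousOn hfR.continuousOn
  have hbound : ∀ k : ℕ, ‖comp k g z‖ ≤ M * R⁻¹ ^ k := by
    intro k
    have h1 := isHomog_comp hg k z hz R hR0 hRz
    have h2 : ‖comp k g ((R : ℂ) • z)‖ ≤ M := by
      rw [comp_eq]
      refine (norm_integral_le_of_norm_le_const (C := M) (ae_of_all _ fun t => ?_)).trans (by simp)
      rw [norm_mul, norm_zpow, norm_rot, one_zpow, one_mul]
      exact hM t (Set.mem_univ t)
    rw [h1, zpow_natCast, norm_mul, norm_pow, hRn] at h2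
    rw [inv_pow, ← div_eq_mul_inv, le_div_iff₀ (by positivity), mul_comm]
    exact h2
  have hinj : Function.Injective (fun k : ℕ => (k : ℤ)) := Nat.cast_injective
  have hzero : ∀ x ∉ Set.range (fun k : ℕ => (k : ℤ)), comp x g z = 0 := fun x hx =>
    hneg x (by
      by_contra h
      exact hx ⟨x.toNat, by simp; omega⟩)
  have hsum : Summable fun k : ℤ => comp k g z := by
    rw [← hinj.summable_iff hzero]
    refine Summable.of_norm_bounded (g := fun k : ℕ => M * R⁻¹ ^ k) ?_ hbound
    exact (summable_geometric_of_lt_one (by positivity) (inv_lt_one_of_one_lt₀ hR1)).mul_left M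
  have h1 := has_pointwise_sum_fourier_series_of_summable (f := ⟨_, hf⟩) hsum 0
  have h2 : HasSum (fun k : ℤ => comp k g z) (g z) := by
    have h3 : rot 0 = 1 := by rw [rot, fourier_eval_zero]
    simpa only [comp, fourier_eval_zero, smul_eq_mul, mul_one, ContinuousMap.coe_mk, h3, one_smul]
      using h1
  exact (hinj.hasSum_iff hzero).2 h2

end FourierComponents

end Kepler
end

/-! ### Radial weights and the components of square integrable functions -/

noncomputable section
namespace Kepler
open MeasureTheory Filter Topology
open scoped ComplexOrder ENNReal ComplexConjugate

section RadialMeasures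

variable {n : ℕ} {φ : ℝ → ℝ≥0∞}

/-- The measure with radial density `φ(|z|²)`. -/
def nu (n : ℕ) (φ : ℝ → ℝ≥0∞) : Measure (Fin (n + 1) → ℂ) :=
  (mu n).withDensity fun z => φ (normSq z)

/-- The squared norm in `L²(nu n φ)` of a unit vector of degree `k` in `L²(mu n)`. -/
def gam (n : ℕ) (φ : ℝ → ℝ≥0∞) (k : ℕ) : ℝ≥0∞ :=
  ENNReal.ofReal ((k + n - 1 : ℕ) : ℝ) *
    ∫⁻ t in Set.Ioo 0 1, ENNReal.ofReal (t ^ (k + n - 2)) * φ t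

lemma lintegral_nu (hφ : Measurable φ) {h : (Fin (n + 1) → ℂ) → ℝ≥0∞} (hh : Measurable h) :
    ∫⁻ z, h z ∂nu n φ = ∫⁻ z, h z * φ (normSq z) ∂mu n := by
  have hm : Measurable fun z : Fin (n + 1) → ℂ => φ (normSq z) :=
    hφ.comp continuous_normSq.measurable
  rw [nu, lintegral_withDensity_eq_lintegral_mul _ hm hh]
  simp only [Pi.mul_apply, mul_comm]

lemma ae_nu_mem_ball (n : ℕ) (φ : ℝ → ℝ≥0∞) : ∀ᵐ z ∂nu n φ, z ∈ ball n :=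
  (withDensity_absolutelyContinuous _ _).ae_le (ae_mem_ball n)

lemma sFinite_nu (hn : 2 ≤ n) (φ : ℝ → ℝ≥0∞) : SFinite (nu n φ) := by
  have := isFiniteMeasure_mu hn
  rw [nu]
  infer_instance

lemma lintegral_nu_circle (hφ : Measurable φ) {c : ℂ} (hc : ‖c‖ = 1)
    {h : (Fin (n + 1) → ℂ) → ℝ≥0∞} (hh : Measurable h) :
    ∫⁻ z, h (c • z) ∂nu n φ = ∫⁻ z, h z ∂nu n φ := by
  have hm : Measurable fun z : Fin (n + 1) → ℂ => h z * φ (normSq z) :=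
    hh.mul (hφ.comp continuous_normSq.measurable)
  rw [lintegral_nu hφ (h := fun z => h (c • z)) (hh.comp (measurable_const_smul c)),
    lintegral_nu hφ hh,
    ← lintegral_mu_circle hc hm]
  refine lintegral_congr fun z => ?_
  simp only [normSq_smul, hc, one_pow, one_mul]

lemma measurePreserving_smul_nu (hφ : Measurable φ) {c : ℂ} (hc : ‖c‖ = 1) :
    MeasurePreserving (fun z : Fin (n + 1) → ℂ => c • z) (nu n φ) (nu n φ) := by
  refine ⟨measurable_const_smul c, ?_⟩
  ext s hs
  rw [← lintegral_indicator_one hs, lintegral_map (measurable_one.indicator hs)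
    (measurable_const_smul c), lintegral_nu_circle hφ hc (measurable_one.indicator hs),
    lintegral_indicator_one hs]

/-- On functions of one degree the radial weight acts as the scalar `gam`. This is why the basis
`onb` stays orthogonal for `nu`, with the same norm for all its members. -/
lemma lintegral_nu_of_homog (hn : 2 ≤ n) (hφ : Measurable φ) {k : ℕ}
    {h : (Fin (n + 1) → ℂ) → ℝ≥0∞} (hh : Measurable h)
    (hom : ∀ z ∈ ball n, ∀ r ∈ Set.Ioo (0 : ℝ) 1,
      h ((r : ℂ) • z) = ENNReal.ofReal (r ^ (2 * k)) * h z) (hfin : ∫⁻ z, h z ∂mu n ≠ ∞) :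
    ∫⁻ z, h z ∂nu n φ = gam n φ k * ∫⁻ z, h z ∂mu n := by
  rw [lintegral_nu hφ hh, lintegral_mu_radial hn hh hom hfin hφ, gam, mul_right_comm]

lemma integrable_nu_of_homog (hn : 2 ≤ n) (hφ : Measurable φ) {k : ℕ} (hk : gam n φ k ≠ ∞)
    {h : (Fin (n + 1) → ℂ) → ℂ} (hh : Measurable h) (hi : Integrable h (mu n))
    (hom : ∀ z ∈ ball n, ∀ r ∈ Set.Ioo (0 : ℝ) 1, h ((r : ℂ) • z) = (r : ℂ) ^ (2 * k) * h z) :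
    Integrable h (nu n φ) := by
  refine ⟨hh.aestronglyMeasurable, ?_⟩
  have hfin : ∫⁻ z, ‖h z‖ₑ ∂mu n ≠ ∞ := hi.2.ne
  rw [HasFiniteIntegral, lintegral_nu_of_homog hn hφ (k := k) hh.enorm (fun z hz r hr => ?_) hfin]
  · exact (ENNReal.mul_ne_top hk hfin).lt_top
  · rw [hom z hz r hr, enorm_mul, ← ofReal_norm, norm_pow, Complex.norm_real, Real.norm_eq_abs,
      abs_of_pos hr.1]

lemma integral_nu_of_homog_real (hn : 2 ≤ n) (hφ : Measurable φ) {k : ℕ}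
    {h : (Fin (n + 1) → ℂ) → ℝ} (hh : Measurable h) (hi : Integrable h (mu n))
    (hi' : Integrable h (nu n φ))
    (hom : ∀ z ∈ ball n, ∀ r ∈ Set.Ioo (0 : ℝ) 1, h ((r : ℂ) • z) = r ^ (2 * k) * h z) :
    ∫ z, h z ∂nu n φ = (gam n φ k).toReal * ∫ z, h z ∂mu n := by
  have key : ∀ h : (Fin (n + 1) → ℂ) → ℝ, Measurable h → Integrable h (mu n) →
      (∀ z ∈ ball n, ∀ r ∈ Set.Ioo (0 : ℝ) 1, h ((r : ℂ) • z) = r ^ (2 * k) * h z) →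
      ∫⁻ z, ENNReal.ofReal (h z) ∂nu n φ = gam n φ k * ∫⁻ z, ENNReal.ofReal (h z) ∂mu n := by
    intro h hh hi hom
    refine lintegral_nu_of_homog hn hφ hh.ennreal_ofReal (fun z hz r hr => ?_)
      hi.lintegral_lt_top.ne
    rw [hom z hz r hr, ENNReal.ofReal_mul (pow_nonneg hr.1.le _)]
  rw [integral_eq_lintegral_pos_part_sub_lintegral_neg_part hi,
    integral_eq_lintegral_pos_part_sub_lintegral_neg_part hi', key h hh hi hom,
    key (fun z => -h z) hh.neg hi.neg fun z hz r hr => by rw [hom z hz r hr, mul_neg],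
    ENNReal.toReal_mul, ENNReal.toReal_mul, mul_sub]

lemma integral_nu_of_homog (hn : 2 ≤ n) (hφ : Measurable φ) {k : ℕ} (hk : gam n φ k ≠ ∞)
    {h : (Fin (n + 1) → ℂ) → ℂ} (hh : Measurable h) (hi : Integrable h (mu n))
    (hom : ∀ z ∈ ball n, ∀ r ∈ Set.Ioo (0 : ℝ) 1, h ((r : ℂ) • z) = (r : ℂ) ^ (2 * k) * h z) :
    ∫ z, h z ∂nu n φ = (gam n φ k).toReal * ∫ z, h z ∂mu n := by
  have hi' := integrable_nu_of_homog hn hφ hk hh hi hom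
  have h1 := integral_nu_of_homog_real hn hφ (k := k) (h := fun z => RCLike.re (h z))
    (Complex.measurable_re.comp hh) hi.re hi'.re fun z hz r hr => by
      rw [hom z hz r hr, ← Complex.ofReal_pow]
      exact Complex.re_ofReal_mul _ _
  have h2 := integral_nu_of_homog_real hn hφ (k := k) (h := fun z => RCLike.im (h z))
    (Complex.measurable_im.comp hh) hi.im hi'.im fun z hz r hr => by
      rw [hom z hz r hr, ← Complex.ofReal_pow]
      exact Complex.im_ofReal_mul _ _
  rw [← integral_re_add_im hi, ← integral_re_add_im hi', h1, h2]
  simp only [RCLike.ofReal_mul]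
  rw [mul_add, ← mul_assoc]
  rfl

lemma continuous_onb_mul_conj (hn : 2 ≤ n) (k : ℕ) (a a' : Fin (N n k)) :
    Continuous fun z => onb hn k a z * conj (onb hn k a' z) :=
  (differentiable_onb hn k a).continuous.mul
    (Complex.continuous_conj.comp (differentiable_onb hn k a').continuous)

lemma onb_mul_conj_smul (hn : 2 ≤ n) (k : ℕ) (a a' : Fin (N n k)) (r : ℝ)
    (z : Fin (n + 1) → ℂ) : onb hn k a ((r : ℂ) • z) * conj (onb hn k a' ((r : ℂ) • z)) =
      (r : ℂ) ^ (2 * k) * (onb hn k a z * conj (onb hn k a' z)) := by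
  rw [onb_smul, onb_smul, map_mul, map_pow, Complex.conj_ofReal]
  ring

lemma integrable_onb_mul_nu (hn : 2 ≤ n) (hφ : Measurable φ) {k : ℕ} (hk : gam n φ k ≠ ∞)
    (a a' : Fin (N n k)) :
    Integrable (fun z => onb hn k a z * conj (onb hn k a' z)) (nu n φ) :=
  integrable_nu_of_homog hn hφ hk (continuous_onb_mul_conj hn k a a').measurable
    (integrable_onb_mul hn k a a') fun z _ r _ => onb_mul_conj_smul hn k a a' r z

lemma integral_onb_nu (hn : 2 ≤ n) (hφ : Measurable φ) {k : ℕ} (hk : gam n φ k ≠ ∞)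
    (a a' : Fin (N n k)) : ∫ z, onb hn k a z * conj (onb hn k a' z) ∂nu n φ =
      if a = a' then ((gam n φ k).toReal : ℂ) else 0 := by
  rw [integral_nu_of_homog hn hφ hk (continuous_onb_mul_conj hn k a a').measurable
    (integrable_onb_mul hn k a a') fun z _ r _ => onb_mul_conj_smul hn k a a' r z, integral_onb]
  simp

lemma memLp_onb_nu (hn : 2 ≤ n) (hφ : Measurable φ) {k : ℕ} (hk : gam n φ k ≠ ∞)
    (a : Fin (N n k)) : MemLp (onb hn k a) 2 (nu n φ) := by
  rw [memLp_two_iff_integrable_sq_norm (differentiable_onb hn k a).continuous.aestronglyMeasurable]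
  refine (integrable_onb_mul_nu hn hφ hk a a).norm.congr (ae_of_all _ fun z => ?_)
  simp only [norm_mul, RCLike.norm_conj, sq]

/-- The components of a square integrable function have finite norm. -/
lemma lintegral_comp_le (hn : 2 ≤ n) (hφ : Measurable φ) {g : (Fin (n + 1) → ℂ) → ℂ}
    (hgm : Measurable g) (k : ℤ) :
    ∫⁻ z, ‖comp k g z‖ₑ ^ 2 ∂nu n φ ≤ ∫⁻ z, ‖g z‖ₑ ^ 2 ∂nu n φ := by
  have := sFinite_nu hn φ
  have hm : Measurable fun q : (Fin (n + 1) → ℂ) × UnitAddCircle => ‖g (rot q.2 • q.1)‖ₑ ^ 2 :=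
    ((hgm.comp ((continuous_rot.comp continuous_snd).smul continuous_fst).measurable).enorm.pow_const
      2)
  -- Cauchy–Schwarz on the circle, which has mass one; Tonelli and rotation invariance of `nu` then
  -- finish.
  have h1 : ∀ z ∈ ball n, ‖comp k g z‖ₑ ^ 2 ≤
      ∫⁻ t : UnitAddCircle, ‖g (rot t • z)‖ₑ ^ 2 ∂AddCircle.haarAddCircle := by
    intro z hz
    have h2 : ‖comp k g z‖ₑ ≤ ∫⁻ t : UnitAddCircle, ‖g (rot t • z)‖ₑ ∂AddCircle.haarAddCircle := by
      rw [comp_eq]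
      refine (enorm_integral_le_lintegral_enorm _).trans_eq (lintegral_congr fun t => ?_)
      rw [enorm_mul, ← ofReal_norm, norm_zpow, norm_rot, one_zpow, ENNReal.ofReal_one, one_mul]
    have hmz : Measurable fun t : UnitAddCircle => ‖g (rot t • z)‖ₑ :=
      (hgm.comp (continuous_rot.smul continuous_const).measurable).enorm
    have h3 := ENNReal.lintegral_mul_le_Lp_mul_Lq
      (AddCircle.haarAddCircle : Measure UnitAddCircle) Real.HolderConjugate.two_two
      hmz.aemeasurable (g := fun _ => 1) aemeasurable_const
    simp only [Pi.mul_apply, mul_one, ENNReal.one_rpow, lintegral_const, measure_univ] at h3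
    calc ‖comp k g z‖ₑ ^ 2 ≤
        ((∫⁻ t : UnitAddCircle, ‖g (rot t • z)‖ₑ ^ (2 : ℝ) ∂AddCircle.haarAddCircle) ^
          (1 / 2 : ℝ)) ^ 2 := by
          gcongr
          exact h2.trans h3
      _ = _ := by
        rw [← ENNReal.rpow_natCast, ← ENNReal.rpow_mul]
        norm_num
  calc ∫⁻ z, ‖comp k g z‖ₑ ^ 2 ∂nu n φ
      ≤ ∫⁻ z, ∫⁻ t : UnitAddCircle, ‖g (rot t • z)‖ₑ ^ 2 ∂AddCircle.haarAddCircle ∂nu n φ :=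
        lintegral_mono_ae ((ae_nu_mem_ball n φ).mono h1)
    _ = ∫⁻ t : UnitAddCircle, ∫⁻ z, ‖g (rot t • z)‖ₑ ^ 2 ∂nu n φ ∂AddCircle.haarAddCircle :=
        lintegral_lintegral_swap hm.aemeasurable
    _ = ∫⁻ t : UnitAddCircle, ∫⁻ z, ‖g z‖ₑ ^ 2 ∂nu n φ ∂AddCircle.haarAddCircle := by
        refine lintegral_congr fun t => ?_
        exact lintegral_nu_circle hφ (norm_rot t) (h := fun z => ‖g z‖ₑ ^ 2)
          (hgm.enorm.pow_const 2)
    _ = _ := by simp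

lemma integral_smul_nu (hφ : Measurable φ) {c : ℂ} (hc : ‖c‖ = 1) {h : (Fin (n + 1) → ℂ) → ℂ}
    (hh : Measurable h) : ∫ z, h (c • z) ∂nu n φ = ∫ z, h z ∂nu n φ := by
  have hmp := measurePreserving_smul_nu (n := n) hφ hc
  conv_rhs => rw [← hmp.map_eq]
  rw [integral_map hmp.measurable.aemeasurable hh.aestronglyMeasurable]

lemma memLp_two_conj_mul {α : Type*} [MeasurableSpace α] {ν : Measure α} {g h : α → ℂ}
    (hg : MemLp g 2 ν) (hh : MemLp h 2 ν) : Integrable (fun z => g z * conj (h z)) ν :=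
  MemLp.integrable_mul hg hh.star

/-- Since `nu` is rotation invariant, the integrand may be averaged over the circle. The conjugate
of a degree `k` function contributes `rot t ^ (-k)`, so by Fubini the average replaces `g` by its
component. -/
lemma integral_mul_conj_onb (hn : 2 ≤ n) (hφ : Measurable φ) {k : ℕ} (hk : gam n φ k ≠ ∞)
    {g : (Fin (n + 1) → ℂ) → ℂ} (hgm : Measurable g) (hg : MemLp g 2 (nu n φ)) (a : Fin (N n k)) :
    ∫ z, g z * conj (onb hn k a z) ∂nu n φ =
      ∫ z, comp k g z * conj (onb hn k a z) ∂nu n φ := by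
  have := sFinite_nu hn φ
  set b := onb hn k a with hb
  have hbc : Continuous b := (differentiable_onb hn k a).continuous
  set P : (Fin (n + 1) → ℂ) → ℂ := fun z => g z * conj (b z) with hP
  have hPm : Measurable P := hgm.mul (Complex.continuous_conj.comp hbc).measurable
  have hPi : Integrable P (nu n φ) := memLp_two_conj_mul hg (memLp_onb_nu hn hφ hk a)
  have hrot : ∀ t z, P (rot t • z) = rot t ^ (-(k : ℤ)) * g (rot t • z) * conj (b z) := by
    intro t z
    have h1 : conj (rot t) = (rot t)⁻¹ := by
      refine eq_inv_of_mul_eq_one_left ?_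
      rw [Complex.conj_mul', norm_rot]
      simp
    simp only [hP, hb, onb_smul, map_mul, map_pow, h1, zpow_neg, zpow_natCast, inv_pow]
    ring
  have hcm : Measurable fun q : UnitAddCircle × (Fin (n + 1) → ℂ) => rot q.1 • q.2 :=
    ((continuous_rot.comp continuous_fst).smul continuous_snd).measurable
  have hint : Integrable (fun q : UnitAddCircle × (Fin (n + 1) → ℂ) => P (rot q.1 • q.2))
      (AddCircle.haarAddCircle.prod (nu n φ)) := by
    refine ⟨(hPm.comp hcm).aestronglyMeasurable, ?_⟩
    have hm : Measurable fun q : UnitAddCircle × (Fin (n + 1) → ℂ) => ‖P (rot q.1 • q.2)‖ₑ :=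
      (hPm.comp hcm).enorm
    rw [HasFiniteIntegral, lintegral_prod _ hm.aemeasurable]
    simp only [lintegral_nu_circle hφ (norm_rot _) hPm.enorm, lintegral_const, measure_univ, mul_one]
    exact hPi.2
  have h2 : ∫ z, P z ∂nu n φ = ∫ t : UnitAddCircle, ∫ z, P (rot t • z) ∂nu n φ
      ∂AddCircle.haarAddCircle := by
    simp only [integral_smul_nu hφ (norm_rot _) hPm, integral_const, probReal_univ, one_smul]
  rw [h2, integral_integral_swap hint]
  refine integral_congr_ae (ae_of_all _ fun z => ?_)
  simp only [hrot, integral_mul_const, comp_eq]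

lemma lintegral_sq_ne_top {α : Type*} [MeasurableSpace α] {ν : Measure α} {g : α → ℂ}
    (hg : MemLp g 2 ν) : ∫⁻ z, ‖g z‖ₑ ^ 2 ∂ν ≠ ∞ := by
  have h := (eLpNorm_lt_top_iff_lintegral_rpow_enorm_lt_top two_ne_zero ENNReal.ofNat_ne_top).1 hg.2
  simpa using h.ne

/-- The coefficients of the components of a square integrable function. -/
lemma exists_comp_coeff (hn : 2 ≤ n) (hφ : Measurable φ) {g : (Fin (n + 1) → ℂ) → ℂ}
    (hgh : CurveHol (ball n) g) (hgm : Measurable g) (hg : MemLp g 2 (nu n φ)) (k : ℕ) :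
    ∃ c : Fin (N n k) → ℂ, (∀ z ∈ ball n, comp k g z = ∑ a, c a * onb hn k a z) ∧
      (gam n φ k = ∞ → c = 0) ∧ (gam n φ k ≠ ∞ → ∀ a,
        ∫ z, g z * conj (onb hn k a z) ∂nu n φ = (gam n φ k).toReal * c a) := by
  obtain ⟨c, hc⟩ := exists_eq_sum_onb hn (hgh.comp k) (isHomog_comp hgh k)
  refine ⟨c, hc, fun hk => ?_, fun hk a => ?_⟩
  · set P : (Fin (n + 1) → ℂ) → ℂ := fun z => ∑ a, c a * onb hn k a z with hP
    have hPc : Continuous P := continuous_finsetSum _ fun a _ =>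
      continuous_const.mul (differentiable_onb hn k a).continuous
    have hPL : MemLp P 2 (mu n) := memLp_finsetSum _ fun a _ => (memLp_onb hn k a 2).const_mul _
    have h1 : ∫⁻ z, ‖P z‖ₑ ^ 2 ∂mu n ≠ ∞ := lintegral_sq_ne_top hPL
    have h2 := lintegral_nu_of_homog hn hφ (k := k) (hPc.measurable.enorm.pow_const 2)
      (fun z _ r hr => by
        have : P ((r : ℂ) • z) = (r : ℂ) ^ k * P z := by
          simp only [hP, onb_smul, Finset.mul_sum]
          exact Finset.sum_congr rfl fun a _ => by ring
        rw [this, enorm_mul, mul_pow, ← ofReal_norm, norm_pow, Complex.norm_real,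
          Real.norm_eq_abs, abs_of_pos hr.1, ← ENNReal.ofReal_pow (pow_nonneg hr.1.le _), ← pow_mul,
          mul_comm k 2]) h1
    have h3 : ∫⁻ z, ‖P z‖ₑ ^ 2 ∂nu n φ ≠ ∞ := by
      refine ne_top_of_le_ne_top (lintegral_sq_ne_top hg) (le_trans (lintegral_mono_ae ?_)
        (lintegral_comp_le hn hφ hgm k))
      filter_upwards [ae_nu_mem_ball n φ] with z hz
      rw [hc z hz]
    -- The norm for `nu` is finite and equals `∞` times the norm for `mu`, so the latter is zero.
    have h4 : ∫⁻ z, ‖P z‖ₑ ^ 2 ∂mu n = 0 := by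
      by_contra h
      rw [h2, hk] at h3
      exact h3 (ENNReal.top_mul h)
    have h5 : ∀ᵐ z ∂mu n, P z = 0 := by
      filter_upwards [(lintegral_eq_zero_iff (hPc.measurable.enorm.pow_const 2)).1 h4] with z hz
      simpa using hz
    have h6 : ∑ a, c a * conj (c a) = 0 := by
      rw [← integral_sum_onb hn k c c, integral_congr_ae (g := fun _ => 0), integral_zero]
      filter_upwards [h5] with z hz
      change P z * _ = 0
      rw [hz, zero_mul]
    have h7 : ∑ a, ‖c a‖ ^ 2 = 0 := by
      simp only [Complex.mul_conj'] at h6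
      exact_mod_cast h6
    ext a
    simpa using (Finset.sum_eq_zero_iff_of_nonneg fun _ _ => by positivity).1 h7 a
      (Finset.mem_univ a)
  · rw [integral_mul_conj_onb hn hφ hk hgm hg]
    rw [integral_congr_ae (g := fun z => ∑ a', c a' * (onb hn k a' z * conj (onb hn k a z)))]
    · rw [integral_finsetSum _ fun a' _ => (integrable_onb_mul_nu hn hφ hk a' a).const_mul _]
      simp only [integral_const_mul, integral_onb_nu hn hφ hk, mul_ite, mul_zero,
        Finset.sum_ite_eq', Finset.mem_univ, if_true]
      ring
    · filter_upwards [ae_nu_mem_ball n φ] with z hz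
      rw [hc z hz, Finset.sum_mul]
      simp only [mul_assoc]

end RadialMeasures

end Kepler
end

/-! ### Holomorphy of locally uniformly convergent series -/

noncomputable section
namespace Kepler
open MeasureTheory Filter Topology
open scoped ComplexOrder ENNReal ComplexConjugate

section HolomorphicSeries

variable {n : ℕ}

lemma sum_sq_localParam {p : Fin (n + 1) → ℂ} {j : Fin (n + 1)} (hj : p j ≠ 0) (Z : Fin n → ℂ) :
    ∑ i, localParam j p Z i ^ 2 = 0 := by
  have h1 : (((∑ i, Z i ^ 2) / (-(p j) ^ 2)) ^ (1 / 2 : ℂ)) ^ 2 = (∑ i, Z i ^ 2) / (-(p j) ^ 2) := by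
    rw [one_div]
    exact_mod_cast Complex.cpow_nat_inv_pow _ two_ne_zero
  rw [Fin.sum_univ_succAbove _ j]
  simp only [localParam, Fin.insertNth_apply_same, Fin.insertNth_apply_succAbove, mul_pow, h1]
  field_simp
  ring

lemma eventually_differentiableAt_localParam {p : Fin (n + 1) → ℂ} (hp : p ∈ ball n)
    {j : Fin (n + 1)} (hj : p j ≠ 0) :
    ∀ᶠ Z in 𝓝 (coord j p), DifferentiableAt ℂ (localParam j p) Z := by
  have hc : Continuous fun Z : Fin n → ℂ => (∑ i, Z i ^ 2) / (-(p j) ^ 2) := by fun_prop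
  have h1 : (∑ i, coord j p i ^ 2) / (-(p j) ^ 2) = 1 := by
    have h2 : ∑ i, coord j p i ^ 2 = -p j ^ 2 := quad_coord hp j
    rw [h2, div_self (neg_ne_zero.2 (pow_ne_zero 2 hj))]
  have hs : ∀ᶠ Z in 𝓝 (coord j p), (∑ i, Z i ^ 2) / (-(p j) ^ 2) ∈ Complex.slitPlane :=
    hc.continuousAt.eventually (Complex.isOpen_slitPlane.mem_nhds (by
      simp only [h1]; exact Complex.one_mem_slitPlane))
  filter_upwards [hs] with Z hZ
  rw [differentiableAt_pi]
  intro i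
  refine j.succAboveCases ?_ (fun i => ?_) i
  · simp only [localParam, Fin.insertNth_apply_same]
    have h2 : DifferentiableAt ℂ (fun Z : Fin n → ℂ => (∑ i, Z i ^ 2) / (-(p j) ^ 2)) Z := by
      simp only [div_eq_mul_inv]
      fun_prop
    exact (h2.cpow_const hZ).const_mul _
  · simp only [localParam, Fin.insertNth_apply_succAbove]
    fun_prop

lemma eventually_localParam_mem {p : Fin (n + 1) → ℂ} (hp : p ∈ ball n) {j : Fin (n + 1)}
    (hj : p j ≠ 0) {τ : ℝ} (hτ : normSq p < τ) :
    ∀ᶠ Z in 𝓝 (coord j p), DifferentiableAt ℂ (localParam j p) Z ∧ localParam j p Z ∈ ball n ∧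
      normSq (localParam j p Z) < τ := by
  have h0 : localParam j p (coord j p) = p := (eventually_localParam_coord hj).self_of_nhds hp
  have hd := eventually_differentiableAt_localParam hp hj
  have hc : ContinuousAt (localParam j p) (coord j p) := hd.self_of_nhds.continuousAt
  have hne : ∀ᶠ Z in 𝓝 (coord j p), localParam j p Z ≠ 0 :=
    hc.eventually (isOpen_ne.mem_nhds (by rw [h0]; exact hp.2.1))
  have hlt : ∀ s, normSq p < s → ∀ᶠ Z in 𝓝 (coord j p), normSq (localParam j p Z) < s := by
    intro s hs
    refine hc.eventually (p := fun z => normSq z < s)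
      ((isOpen_lt continuous_normSq continuous_const).mem_nhds ?_)
    rw [h0]
    exact hs
  filter_upwards [hd, hne, hlt τ hτ, hlt 1 hp.2.2] with Z h1 h2 h3 h4
  exact ⟨h1, ⟨sum_sq_localParam hj Z, h2, h4⟩, h3⟩

/-- Locally uniformly convergent series of holomorphic functions are holomorphic. -/
lemma isHolomorphic_tsum {F : ℕ → (Fin (n + 1) → ℂ) → ℂ} (hF : ∀ k, Differentiable ℂ (F k))
    (hb : ∀ τ < 1, ∃ u : ℕ → ℝ, Summable u ∧ ∀ k, ∀ x ∈ ball n, normSq x < τ → ‖F k x‖ ≤ u k) :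
    IsHolomorphic n fun x => ∑' k, F k x := by
  intro p hp j hj
  have hp1 : normSq p < 1 := hp.2.2
  obtain ⟨τ, hτ, hτ1⟩ := exists_between hp1
  obtain ⟨u, hu, hFu⟩ := hb τ hτ1
  obtain ⟨ε, hε, hsub⟩ := Metric.eventually_nhds_iff_ball.1 (eventually_localParam_mem hp hj hτ)
  set r := ε / 2 with hr
  have hr0 : 0 < r := by positivity
  have hd : ∀ k, ∀ Z ∈ Metric.ball (coord j p) ε,
      DifferentiableAt ℂ (fun Z => F k (localParam j p Z)) Z := fun k Z hZ =>
    (hF k _).comp Z (hsub Z hZ).1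
  have hle : ∀ k, ∀ Z ∈ Metric.ball (coord j p) ε, ‖F k (localParam j p Z)‖ ≤ u k := fun k Z hZ =>
    hFu k _ (hsub Z hZ).2.1 (hsub Z hZ).2.2
  have hmem : ∀ Z ∈ Metric.ball (coord j p) r, Metric.ball Z r ⊆ Metric.ball (coord j p) ε := by
    intro Z hZ
    refine Metric.ball_subset_ball' ?_
    rw [Metric.mem_ball] at hZ
    linarith
  have hsmall : Metric.ball (coord j p) r ⊆ Metric.ball (coord j p) ε :=
    Metric.ball_subset_ball (by linarith)
  refine (hasFDerivAt_tsum_of_isPreconnected (𝕜 := ℂ) (u := fun k => 2 * u k / r)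
    (f := fun k Z => F k (localParam j p Z))
    (f' := fun k Z => fderiv ℂ (fun Z => F k (localParam j p Z)) Z)
    ((hu.mul_left 2).div_const r) Metric.isOpen_ball
    (convex_ball (coord j p) r).isPreconnected (fun k Z hZ => (hd k Z (hsmall hZ)).hasFDerivAt)
    (fun k Z hZ => ?_) (Metric.mem_ball_self hr0) ?_ (Metric.mem_ball_self hr0)).differentiableAt
  -- The `k`-th term maps the ball of radius `r` about `Z` into a closed ball of radius `2 u k`; the
  -- Schwarz lemma bounds its derivative.
  · refine Complex.norm_fderiv_le_div_of_mapsTo_ball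
      (fun Y hY => (hd k Y (hmem Z hZ hY)).differentiableWithinAt) (fun Y hY => ?_) hr0
    rw [Metric.mem_closedBall, dist_eq_norm]
    refine (norm_sub_le _ _).trans ?_
    have h1 := hle k Y (hmem Z hZ hY)
    have h2 := hle k Z (hsmall hZ)
    linarith
  · exact Summable.of_norm_bounded hu fun k => hle k _ (Metric.mem_ball_self hε)

end HolomorphicSeries

/-! ### The Bergman kernel of a radial weight -/

section Kernel

variable {n : ℕ} {φ : ℝ → ℝ≥0∞}

/-- The weight of the component of degree `k` in the kernel. -/
def wt (n : ℕ) (φ : ℝ → ℝ≥0∞) (k : ℕ) : ℝ := ((gam n φ k)⁻¹).toReal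

/-- The component of degree `k` of the Bergman kernel. -/
def kap (hn : 2 ≤ n) (φ : ℝ → ℝ≥0∞) (k : ℕ) (x y : Fin (n + 1) → ℂ) : ℂ :=
  ∑ a, (wt n φ k * conj (onb hn k a y)) * onb hn k a x

/-- The diagonal values of the component of degree `k` of the Bergman kernel. -/
def kapDiag (hn : 2 ≤ n) (φ : ℝ → ℝ≥0∞) (k : ℕ) (x : Fin (n + 1) → ℂ) : ℝ :=
  wt n φ k * diag hn k x

/-- The Bergman kernel. -/
def ker (hn : 2 ≤ n) (φ : ℝ → ℝ≥0∞) (x y : Fin (n + 1) → ℂ) : ℂ := ∑' k, kap hn φ k x y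

lemma wt_nonneg (n : ℕ) (φ : ℝ → ℝ≥0∞) (k : ℕ) : 0 ≤ wt n φ k := ENNReal.toReal_nonneg

lemma kap_self (hn : 2 ≤ n) (φ : ℝ → ℝ≥0∞) (k : ℕ) (x : Fin (n + 1) → ℂ) :
    kap hn φ k x x = kapDiag hn φ k x := by
  simp only [kap, kapDiag, diag, mul_assoc, Complex.conj_mul', ← Finset.mul_sum]
  push_cast
  rfl

lemma differentiable_kap (hn : 2 ≤ n) (φ : ℝ → ℝ≥0∞) (k : ℕ) (y : Fin (n + 1) → ℂ) :
    Differentiable ℂ fun x => kap hn φ k x y := by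
  have := differentiable_onb hn k
  unfold kap
  fun_prop

lemma norm_kap_le (hn : 2 ≤ n) (φ : ℝ → ℝ≥0∞) (k : ℕ) (x y : Fin (n + 1) → ℂ) :
    ‖kap hn φ k x y‖ ≤ kapDiag hn φ k x + kapDiag hn φ k y := by
  have hw := wt_nonneg n φ k
  simp only [kapDiag, diag, Finset.mul_sum, ← Finset.sum_add_distrib]
  refine (norm_sum_le _ _).trans (Finset.sum_le_sum fun a _ => ?_)
  rw [norm_mul, norm_mul, RCLike.norm_conj, Complex.norm_real, Real.norm_eq_abs, abs_of_nonneg hw,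
    mul_assoc, ← mul_add]
  refine mul_le_mul_of_nonneg_left ?_ hw
  nlinarith [sq_nonneg (‖onb hn k a x‖ - ‖onb hn k a y‖), sq_nonneg ‖onb hn k a x‖,
    sq_nonneg ‖onb hn k a y‖]

lemma memLp_kap (hn : 2 ≤ n) (hφ : Measurable φ) (k : ℕ) (y : Fin (n + 1) → ℂ) :
    MemLp (fun x => kap hn φ k x y) 2 (nu n φ) := by
  by_cases hk : gam n φ k = ∞
  -- When `gam` is infinite, the weight `wt` is 0, so the degree drops out of the kernel.
  · have : (fun x => kap hn φ k x y) = fun _ => 0 := by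
      ext x
      simp [kap, wt, hk]
    rw [this]
    exact MemLp.zero
  · exact memLp_finsetSum _ fun a _ => (memLp_onb_nu hn hφ hk a).const_mul _

/-- The weight inverts the common norm `gam` of the basis functions, so `kap` reproduces the
component of degree `k`. If `gam` is infinite, both sides vanish. -/
lemma integral_mul_conj_kap (hn : 2 ≤ n) (hφ : Measurable φ) {k : ℕ} (hk0 : gam n φ k ≠ 0)
    {g : (Fin (n + 1) → ℂ) → ℂ} (hgh : CurveHol (ball n) g) (hgm : Measurable g)
    (hg : MemLp g 2 (nu n φ)) {y : Fin (n + 1) → ℂ} (hy : y ∈ ball n) :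
    ∫ x, g x * conj (kap hn φ k x y) ∂nu n φ = comp k g y := by
  obtain ⟨c, hc, hc0, hc1⟩ := exists_comp_coeff hn hφ hgh hgm hg k
  rw [hc y hy]
  by_cases hk : gam n φ k = ∞
  · simp [hc0 hk, kap, wt, hk]
  have hw : (wt n φ k : ℂ) * (gam n φ k).toReal = 1 := by
    rw [wt, ENNReal.toReal_inv]
    push_cast
    exact inv_mul_cancel₀ (by exact_mod_cast (ENNReal.toReal_pos hk0 hk).ne')
  have h1 : ∀ x, g x * conj (kap hn φ k x y) =
      ∑ a, (wt n φ k * onb hn k a y) * (g x * conj (onb hn k a x)) := by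
    intro x
    rw [kap, map_sum, Finset.mul_sum]
    refine Finset.sum_congr rfl fun a _ => ?_
    simp only [map_mul, Complex.conj_ofReal, Complex.conj_conj]
    ring
  simp only [h1]
  rw [integral_finsetSum _ fun a _ =>
    (memLp_two_conj_mul hg (memLp_onb_nu hn hφ hk a)).const_mul _]
  refine Finset.sum_congr rfl fun a _ => ?_
  rw [integral_const_mul, hc1 hk a]
  linear_combination c a * onb hn k a y * hw

lemma integral_norm_kap_sq (hn : 2 ≤ n) (hφ : Measurable φ) {k : ℕ} (hk0 : gam n φ k ≠ 0)
    (y : Fin (n + 1) → ℂ) : ∫ x, ‖kap hn φ k x y‖ ^ 2 ∂nu n φ = kapDiag hn φ k y := by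
  by_cases hk : gam n φ k = ∞
  · simp [kap, kapDiag, wt, hk]
  have hw : (wt n φ k : ℂ) * (gam n φ k).toReal = 1 := by
    rw [wt, ENNReal.toReal_inv]
    push_cast
    exact inv_mul_cancel₀ (by exact_mod_cast (ENNReal.toReal_pos hk0 hk).ne')
  have h1 : ∀ x, ((‖kap hn φ k x y‖ ^ 2 : ℝ) : ℂ) =
      ∑ a, ∑ a', (wt n φ k * conj (onb hn k a y)) * (wt n φ k * onb hn k a' y) *
        (onb hn k a x * conj (onb hn k a' x)) := by
    intro x
    push_cast
    rw [← Complex.mul_conj', kap, map_sum, Finset.sum_mul_sum]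
    refine Finset.sum_congr rfl fun a _ => Finset.sum_congr rfl fun a' _ => ?_
    simp only [map_mul, Complex.conj_ofReal, Complex.conj_conj]
    ring
  have hi : ∀ a a', Integrable (fun x => (wt n φ k * conj (onb hn k a y)) *
      (wt n φ k * onb hn k a' y) * (onb hn k a x * conj (onb hn k a' x))) (nu n φ) := fun a a' =>
    (integrable_onb_mul_nu hn hφ hk a a').const_mul _
  have h2 : ((∫ x, ‖kap hn φ k x y‖ ^ 2 ∂nu n φ : ℝ) : ℂ) = kapDiag hn φ k y := by
    rw [← integral_complex_ofReal]
    simp only [h1]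
    rw [integral_finsetSum _ fun a _ => integrable_finsetSum _ fun a' _ => hi a a', ← kap_self, kap]
    refine Finset.sum_congr rfl fun a _ => ?_
    rw [integral_finsetSum _ fun a' _ => hi a a']
    simp only [integral_const_mul, integral_onb_nu hn hφ hk, mul_ite, mul_zero, Finset.sum_ite_eq,
      Finset.mem_univ, if_true]
    linear_combination wt n φ k * conj (onb hn k a y) * onb hn k a y * hw
  exact_mod_cast h2

lemma eLpNorm_two_eq {α : Type*} [MeasurableSpace α] {ν : Measure α} {g : α → ℂ}
    (hg : MemLp g 2 ν) : eLpNorm g 2 ν = ENNReal.ofReal (Real.sqrt (∫ x, ‖g x‖ ^ 2 ∂ν)) := by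
  rw [hg.eLpNorm_eq_integral_rpow_norm two_ne_zero ENNReal.ofNat_ne_top, Real.sqrt_eq_rpow]
  simp

lemma integral_norm_mul_le {α : Type*} [MeasurableSpace α] {ν : Measure α} {g h : α → ℂ}
    (hg : MemLp g 2 ν) (hh : MemLp h 2 ν) : ∫ x, ‖g x * conj (h x)‖ ∂ν ≤
      Real.sqrt (∫ x, ‖g x‖ ^ 2 ∂ν) * Real.sqrt (∫ x, ‖h x‖ ^ 2 ∂ν) := by
  have h1 := integral_mul_norm_le_Lp_mul_Lq (μ := ν) (f := g) (g := h)
    Real.HolderConjugate.two_two (by simpa using hg) (by simpa using hh)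
  simp only [norm_mul, RCLike.norm_conj, Real.sqrt_eq_rpow]
  simpa using h1

lemma isHolomorphic_congr {g h : (Fin (n + 1) → ℂ) → ℂ} (hg : IsHolomorphic n g)
    (hgh : ∀ z ∈ ball n, h z = g z) : IsHolomorphic n h := by
  intro p hp j hj
  refine (hg p hp j hj).congr_of_eventuallyEq ?_
  filter_upwards [eventually_localParam_mem hp hj hp.2.2] with Z hZ
  exact hgh _ hZ.2.1

/-- Locally uniform summability of the diagonal of the kernel. -/
def DiagSummable (hn : 2 ≤ n) (φ : ℝ → ℝ≥0∞) : Prop :=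
  ∀ τ < 1, ∃ u : ℕ → ℝ, Summable u ∧ ∀ k, ∀ x ∈ ball n, normSq x < τ →
    Real.sqrt (kapDiag hn φ k x) ≤ u k ∧ kapDiag hn φ k x ≤ u k

lemma DiagSummable.exists_bound {hn : 2 ≤ n} (hS : DiagSummable hn φ) {y : Fin (n + 1) → ℂ}
    (hy : y ∈ ball n) : ∃ u : ℕ → ℝ, Summable u ∧ ∀ k,
      Real.sqrt (kapDiag hn φ k y) ≤ u k ∧ kapDiag hn φ k y ≤ u k := by
  obtain ⟨τ, hτ, hτ1⟩ := exists_between (show normSq y < 1 from hy.2.2)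
  obtain ⟨u, hu, hb⟩ := hS τ hτ1
  exact ⟨u, hu, fun k => hb k y hy hτ⟩

lemma DiagSummable.hasSum_ker {hn : 2 ≤ n} (hS : DiagSummable hn φ) {x y : Fin (n + 1) → ℂ}
    (hx : x ∈ ball n) (hy : y ∈ ball n) : HasSum (fun k => kap hn φ k x y) (ker hn φ x y) := by
  obtain ⟨u, hu, hub⟩ := hS.exists_bound hx
  obtain ⟨v, hv, hvb⟩ := hS.exists_bound hy
  exact (Summable.of_norm_bounded (hu.add hv) fun k =>
    (norm_kap_le hn φ k x y).trans (add_le_add (hub k).2 (hvb k).2)).hasSum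

/-- Both bounds in `DiagSummable` are needed: the one for `kapDiag` gives locally uniform
convergence, hence holomorphy, and the one for its square root, which is the `L²` norm of the `k`-th
term, gives square integrability. -/
lemma memBergman_ker {hn : 2 ≤ n} (hφ : Measurable φ) (h0 : ∀ k, gam n φ k ≠ 0)
    (hS : DiagSummable hn φ) {y : Fin (n + 1) → ℂ} (hy : y ∈ ball n) :
    MemBergman n (nu n φ) fun x => ker hn φ x y := by
  obtain ⟨v, hv, hvb⟩ := hS.exists_bound hy
  refine ⟨isHolomorphic_tsum (fun k => differentiable_kap hn φ k y) fun τ hτ => ?_, ?_⟩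
  · obtain ⟨u, hu, hub⟩ := hS τ hτ
    exact ⟨fun k => u k + v k, hu.add hv, fun k x hx hxτ =>
      (norm_kap_le hn φ k x y).trans (add_le_add (hub k x hx hxτ).2 (hvb k).2)⟩
  · have hm : ∀ m, MemLp (fun x => ∑ k ∈ Finset.range m, kap hn φ k x y) 2 (nu n φ) := fun m =>
      memLp_finsetSum _ fun k _ => memLp_kap hn hφ k y
    have ht : ∀ᵐ x ∂nu n φ, Tendsto (fun m => ∑ k ∈ Finset.range m, kap hn φ k x y) atTop
        (𝓝 (ker hn φ x y)) := by
      filter_upwards [ae_nu_mem_ball n φ] with x hx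
      exact (hS.hasSum_ker hx hy).tendsto_sum_nat
    refine ⟨aestronglyMeasurable_of_tendsto_ae atTop (fun m => (hm m).1) ht, ?_⟩
    refine lt_of_le_of_lt (Lp.eLpNorm_le_of_ae_tendsto (u := atTop) (C := ENNReal.ofReal (∑' k, v k))
      (Eventually.of_forall fun m => ?_) (fun m => (hm m).1) ht) ENNReal.ofReal_lt_top
    have hv0 : ∀ k, 0 ≤ v k := fun k => (Real.sqrt_nonneg _).trans (hvb k).1
    have h1 := eLpNorm_sum_le (μ := nu n φ) (p := 2) (s := Finset.range m)
      (f := fun k x => kap hn φ k x y) (fun k _ => (memLp_kap hn hφ k y).1) one_le_two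
    have h2 : (∑ k ∈ Finset.range m, fun x => kap hn φ k x y) =
        fun x => ∑ k ∈ Finset.range m, kap hn φ k x y := by
      ext x
      simp
    rw [h2] at h1
    refine h1.trans ?_
    calc ∑ k ∈ Finset.range m, eLpNorm (fun x => kap hn φ k x y) 2 (nu n φ)
        ≤ ∑ k ∈ Finset.range m, ENNReal.ofReal (v k) := by
          refine Finset.sum_le_sum fun k _ => ?_
          rw [eLpNorm_two_eq (memLp_kap hn hφ k y), integral_norm_kap_sq hn hφ (h0 k)]
          exact ENNReal.ofReal_le_ofReal (hvb k).1
      _ = ENNReal.ofReal (∑ k ∈ Finset.range m, v k) :=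
          (ENNReal.ofReal_sum_of_nonneg fun k _ => hv0 k).symm
      _ ≤ _ := ENNReal.ofReal_le_ofReal (hv.sum_le_tsum _ fun k _ => hv0 k)

/-- By Cauchy–Schwarz the `L¹` norms of the terms are at most the norm of `g` times the square root
of `kapDiag` at `y`, which is summable. Sum and integral may be interchanged, and the terms
integrate to the components of `g` at `y`. -/
lemma eq_integral_ker {hn : 2 ≤ n} (hφ : Measurable φ) (h0 : ∀ k, gam n φ k ≠ 0)
    (hS : DiagSummable hn φ) {g : (Fin (n + 1) → ℂ) → ℂ} (hgh : CurveHol (ball n) g)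
    (hgm : Measurable g) (hg : MemLp g 2 (nu n φ)) {y : Fin (n + 1) → ℂ} (hy : y ∈ ball n) :
    g y = ∫ x, g x * conj (ker hn φ x y) ∂nu n φ := by
  obtain ⟨v, hv, hvb⟩ := hS.exists_bound hy
  have h1 := hasSum_integral_of_summable_integral_norm (μ := nu n φ)
    (F := fun k x => g x * conj (kap hn φ k x y))
    (fun k => memLp_two_conj_mul hg (memLp_kap hn hφ k y)) (by
      refine Summable.of_nonneg_of_le (fun k => integral_nonneg fun x => norm_nonneg _) (fun k => ?_)
        (hv.mul_left (Real.sqrt (∫ x, ‖g x‖ ^ 2 ∂nu n φ)))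
      refine (integral_norm_mul_le hg (memLp_kap hn hφ k y)).trans ?_
      rw [integral_norm_kap_sq hn hφ (h0 k)]
      exact mul_le_mul_of_nonneg_left (hvb k).1 (Real.sqrt_nonneg _))
  simp only [integral_mul_conj_kap hn hφ (h0 _) hgh hgm hg hy] at h1
  rw [(hasSum_comp hn hgh hy).unique h1]
  refine integral_congr_ae ?_
  filter_upwards [ae_nu_mem_ball n φ] with x hx
  refine HasSum.tsum_eq ?_
  exact ((hS.hasSum_ker hx hy).map (starRingEnd ℂ) Complex.continuous_conj).mul_left (g x)

lemma isBergmanKernel_ker {hn : 2 ≤ n} (hφ : Measurable φ) (h0 : ∀ k, gam n φ k ≠ 0)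
    (hS : DiagSummable hn φ) : IsBergmanKernel n (nu n φ) (ker hn φ) := by
  refine ⟨fun y hy => memBergman_ker hφ h0 hS hy, fun g hg y hy => ?_⟩
  classical
  -- The values of `g` off the ball are arbitrary; cutting them off makes the function Borel
  -- measurable without changing the integrals.
  set g' : (Fin (n + 1) → ℂ) → ℂ := (ball n).indicator g with hg'
  have heq : ∀ z ∈ ball n, g' z = g z := fun z hz => Set.indicator_of_mem hz g
  have hae : g' =ᵐ[nu n φ] g := (ae_nu_mem_ball n φ).mono heq
  have hh : IsHolomorphic n g' := isHolomorphic_congr hg.1 heq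
  have hm : Measurable g' := by
    rw [hg', ← Set.piecewise_eq_indicator]
    exact hg.1.continuousOn.measurable_piecewise continuousOn_const (measurableSet_ball n)
  rw [← heq y hy, eq_integral_ker hφ h0 hS hh.curveHol hm ((memLp_congr_ae hae).2 hg.2) hy]
  refine integral_congr_ae ?_
  filter_upwards [hae] with x hx
  rw [hx]

lemma ker_self {hn : 2 ≤ n} (hS : DiagSummable hn φ) {z : Fin (n + 1) → ℂ} (hz : z ∈ ball n) :
    HasSum (fun k => kapDiag hn φ k z) (ker hn φ z z).re ∧
      ker hn φ z z = ((ker hn φ z z).re : ℂ) := by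
  have h1 := hS.hasSum_ker hz hz
  simp only [kap_self] at h1
  have h2 : HasSum (fun k => kapDiag hn φ k z) (ker hn φ z z).re := by
    simpa using Complex.hasSum_re h1
  exact ⟨h2, h1.unique (Complex.hasSum_ofReal.2 h2)⟩

/-- The diagonal of the Bergman kernel is determined by the reproducing property. -/
lemma IsBergmanKernel.apply_self_eq {ν : Measure (Fin (n + 1) → ℂ)}
    {K L : (Fin (n + 1) → ℂ) → (Fin (n + 1) → ℂ) → ℂ} (hK : IsBergmanKernel n ν K)
    (hL : IsBergmanKernel n ν L) {z : Fin (n + 1) → ℂ} (hz : z ∈ ball n) :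
    K z z = conj (L z z) := by
  rw [hK.2 _ (hL.1 z hz) z hz, hL.2 _ (hK.1 z hz) z hz, ← integral_conj]
  refine integral_congr_ae (ae_of_all _ fun x => ?_)
  simp only [map_mul, Complex.conj_conj]
  ring

end Kernel

end Kepler
end

/-! ### Moments of `W[f]` and convergence of the series -/

noncomputable section
namespace Kepler
open MeasureTheory Filter Topology
open scoped ComplexOrder ENNReal ComplexConjugate

section Moments

variable {n : ℕ} {f : ℝ → ℝ}

/-- The radial density of the weighted measure. -/
def density (n : ℕ) (f : ℝ → ℝ) : ℝ → ℝ≥0∞ :=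
  (Set.Ioo (0 : ℝ) 1).indicator fun t => ENNReal.ofReal (W n f t)

lemma measurable_density (n : ℕ) (hf : ContDiffOn ℝ 2 f (Set.Ioo 0 1)) :
    Measurable (density n f) := by
  classical
  rw [density, ← Set.piecewise_eq_indicator]
  exact ContinuousOn.measurable_piecewise
    (ENNReal.continuous_ofReal.comp_continuousOn (continuousOn_W n hf)) continuousOn_const
    measurableSet_Ioo

lemma weightMeasure_eq (hn : 2 ≤ n) (hf : ContDiffOn ℝ 2 f (Set.Ioo 0 1))
    (hpos : ∀ t ∈ Set.Ioo (0 : ℝ) 1, 0 < f t)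
    (hpsh : IsStrictlyPSH n (fun z => Real.log (1 / f (normSq z)))) :
    weightMeasure n (fun z => f (normSq z)) = nu n (density n f) := by
  refine formMeasure_eq _ ((measurable_density n hf).comp continuous_normSq.measurable)
    fun z hz hl => ?_
  rw [det_leviMatrix_log hf hpos hn hpsh hz hl, ENNReal.ofReal_mul (by positivity), density,
    Set.indicator_of_mem (normSq_mem_Ioo hz)]

lemma W_pos (hn : 2 ≤ n) (hf : ContDiffOn ℝ 2 f (Set.Ioo 0 1))
    (hpos : ∀ t ∈ Set.Ioo (0 : ℝ) 1, 0 < f t)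
    (hpsh : IsStrictlyPSH n (fun z => Real.log (1 / f (normSq z)))) {t : ℝ}
    (ht : t ∈ Set.Ioo (0 : ℝ) 1) : 0 < W n f t := by
  obtain ⟨p, hp, rfl, -⟩ := exists_mem_ball_normSq (n := n) (by omega) ht
  exact W_normSq_pos hf hpos hn hpsh hp

lemma gam_density (hn : 2 ≤ n) (f : ℝ → ℝ) (k : ℕ) :
    gam n (density n f) k = ENNReal.ofReal (k + n - 1) * moment (W n f) (k + n - 2) := by
  rw [gam, moment, Nat.cast_sub (by omega), Nat.cast_add, Nat.cast_one]
  congr 1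
  refine setLIntegral_congr_fun measurableSet_Ioo fun t ht => ?_
  simp only [density, Set.indicator_of_mem ht]
  rw [← ENNReal.ofReal_mul (pow_nonneg ht.1.le _)]

/-- Lower bound for the moments. -/
lemma pow_mul_le_moment {φ : ℝ → ℝ} {s : ℝ} (hs : s ∈ Set.Ioo (0 : ℝ) 1) (k : ℕ) :
    ENNReal.ofReal (s ^ k) * ∫⁻ t in Set.Ioo s 1, ENNReal.ofReal (φ t) ≤ moment φ k := by
  rw [← lintegral_const_mul' _ _ ENNReal.ofReal_ne_top, moment]
  refine (setLIntegral_mono' measurableSet_Ioo fun t ht => ?_).trans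
    (lintegral_mono_set (Set.Ioo_subset_Ioo_left hs.1.le))
  rw [ENNReal.ofReal_mul (pow_nonneg (hs.1.trans ht.1).le _)]
  gcongr
  · exact hs.1.le
  · exact ht.1.le

lemma lintegral_Ioo_pos {φ : ℝ → ℝ} (hφ : ContinuousOn φ (Set.Ioo 0 1))
    (hpos : ∀ t ∈ Set.Ioo (0 : ℝ) 1, 0 < φ t) {s : ℝ} (hs : s ∈ Set.Ioo (0 : ℝ) 1) :
    0 < ∫⁻ t in Set.Ioo s 1, ENNReal.ofReal (φ t) := by
  have hsub : Set.Ioo s 1 ⊆ Set.Ioo (0 : ℝ) 1 := Set.Ioo_subset_Ioo_left hs.1.le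
  have hm : AEMeasurable (fun t => ENNReal.ofReal (φ t)) (volume.restrict (Set.Ioo s 1)) :=
    (ENNReal.continuous_ofReal.comp_continuousOn (hφ.mono hsub)).aemeasurable measurableSet_Ioo
  rw [pos_iff_ne_zero, Ne, lintegral_eq_zero_iff' hm]
  intro h
  have h1 : ∀ᵐ t ∂volume.restrict (Set.Ioo s 1), False := by
    filter_upwards [h, ae_restrict_mem measurableSet_Ioo] with t h1 h2
    exact absurd (ENNReal.ofReal_eq_zero.1 h1) (not_le.2 (hpos t (hsub h2)))
  rw [eventually_false_iff_eq_bot, ae_eq_bot, Measure.restrict_eq_zero, Real.volume_Ioo,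
    ENNReal.ofReal_eq_zero] at h1
  linarith [hs.2]

lemma N_le (hn : 2 ≤ n) (k : ℕ) : N n k ≤ 2 * (k + (n - 1)).choose (n - 1) := by
  have h1 : k + n - 1 = k + (n - 1) := by omega
  have h2 : (k + n - 2).choose (n - 1) ≤ (k + (n - 1)).choose (n - 1) :=
    Nat.choose_le_choose _ (by omega)
  rw [N, h1]
  omega

/-- The factor `k + n - 1` in `diag_eq` cancels against the one in `gam`. -/
lemma kapDiag_density (hn : 2 ≤ n) (f : ℝ → ℝ) (k : ℕ) {x : Fin (n + 1) → ℂ} (hx : x ∈ ball n) :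
    kapDiag hn (density n f) k x = (n + 1) ^ 2 / cM n * term n f (normSq x) k := by
  have hn2 : (2 : ℝ) ≤ n := by exact_mod_cast hn
  have h1 : (0 : ℝ) < k + n - 1 := by
    have : (0 : ℝ) ≤ k := Nat.cast_nonneg k
    linarith
  rw [kapDiag, wt, gam_density hn, diag_eq hn k hx, term, ENNReal.toReal_inv, ENNReal.toReal_mul,
    ENNReal.toReal_ofReal h1.le, ENNReal.toReal_inv, mul_inv]
  field_simp

/-- For `s` between `τ` and 1, the moment of order `k + n - 2` is at least `s^(k+n-2)` times the
positive integral of `W` over `(s, 1)`. Hence the terms are bounded by a binomial coefficient times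
`(τ/s)^k`. An infinite integral is harmless, since then `B = 0`. -/
lemma exists_term_bound (hn : 2 ≤ n) (hW : ContinuousOn (W n f) (Set.Ioo 0 1))
    (hpos : ∀ t ∈ Set.Ioo (0 : ℝ) 1, 0 < W n f t) {τ : ℝ} (hτ0 : 0 < τ) (hτ : τ < 1) :
    ∃ u : ℕ → ℝ, Summable u ∧ ∀ k, ∀ t, 0 ≤ t → t ≤ τ →
      Real.sqrt (term n f t k) ≤ u k ∧ term n f t k ≤ u k := by
  obtain ⟨s, hs, hs1⟩ := exists_between hτ
  have hsI : s ∈ Set.Ioo (0 : ℝ) 1 := ⟨hτ0.trans hs, hs1⟩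
  have hs0 : 0 < s := hsI.1
  set A := ∫⁻ t in Set.Ioo s 1, ENNReal.ofReal (W n f t) with hA
  have hA0 : 0 < A := lintegral_Ioo_pos hW hpos hsI
  -- The ratio is the square root of `τ / s` because the square roots of the terms have to be
  -- summable as well.
  set q := Real.sqrt (τ / s) with hq
  have hτs : 0 < τ / s := div_pos hτ0 hs0
  have hq0 : 0 < q := Real.sqrt_pos.2 hτs
  have hq2 : q ^ 2 = τ / s := Real.sq_sqrt hτs.le
  have hq1 : q < 1 := by
    rw [hq, Real.sqrt_lt' one_pos, one_pow, div_lt_one hs0]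
    exact hs
  set B := (s ^ (n - 2))⁻¹ * A⁻¹.toReal with hB
  have hB0 : 0 ≤ B := mul_nonneg (by positivity) ENNReal.toReal_nonneg
  have hmom : ∀ k, ((moment (W n f) (k + n - 2))⁻¹).toReal ≤ (s ^ k)⁻¹ * B := by
    intro k
    have h1 := ENNReal.inv_le_inv.2 (pow_mul_le_moment (φ := W n f) hsI (k + n - 2))
    have h2 : ENNReal.ofReal (s ^ (k + n - 2)) ≠ 0 := by
      rw [Ne, ENNReal.ofReal_eq_zero, not_le]
      positivity
    rw [ENNReal.mul_inv (Or.inl h2) (Or.inl ENNReal.ofReal_ne_top)] at h1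
    have h3 := ENNReal.toReal_mono (ENNReal.mul_ne_top (ENNReal.inv_ne_top.2 h2)
      (ENNReal.inv_ne_top.2 hA0.ne')) h1
    rw [ENNReal.toReal_mul, ENNReal.toReal_inv (ENNReal.ofReal _),
      ENNReal.toReal_ofReal (by positivity)] at h3
    refine h3.trans_eq ?_
    rw [hB, show k + n - 2 = k + (n - 2) by omega, pow_add, mul_inv, mul_assoc]
  -- The constant `B + 1` serves both bounds: since the binomial coefficient is at least 1, `2 C B`
  -- is below the square of `2 (B + 1) C`.
  refine ⟨fun k => 2 * (B + 1) * (((k + (n - 1)).choose (n - 1) : ℝ) * q ^ k), ?_, fun k t ht0 ht => ?_⟩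
  · exact (summable_choose_mul_geometric_of_norm_lt_one (n - 1) (r := q)
      (by rwa [Real.norm_eq_abs, abs_of_pos hq0])).mul_left _
  · set C : ℝ := ((k + (n - 1)).choose (n - 1) : ℝ) with hC
    have hC1 : 1 ≤ C := by
      rw [hC]
      exact_mod_cast Nat.choose_pos (by omega)
    have hNC : (N n k : ℝ) ≤ 2 * C := by
      rw [hC]
      exact_mod_cast N_le hn k
    have hterm : term n f t k ≤ 2 * C * B * (q ^ k) ^ 2 := by
      calc term n f t k ≤ 2 * C * ((s ^ k)⁻¹ * B) * τ ^ k := by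
            rw [term]
            gcongr
            exact hmom k
        _ = 2 * C * B * (q ^ k) ^ 2 := by
            rw [← pow_mul, mul_comm k 2, pow_mul, hq2, div_pow]
            field_simp
    have hqk : 0 < q ^ k := by positivity
    have hqk1 : q ^ k ≤ 1 := pow_le_one₀ hq0.le hq1.le
    constructor
    · rw [Real.sqrt_le_left (by positivity)]
      refine hterm.trans ?_
      have : 2 * C * B ≤ (2 * (B + 1) * C) ^ 2 := by nlinarith [mul_nonneg hB0 hB0, mul_nonneg hB0 (sub_nonneg.2 hC1)]
      calc 2 * C * B * (q ^ k) ^ 2 ≤ (2 * (B + 1) * C) ^ 2 * (q ^ k) ^ 2 := by gcongr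
        _ = _ := by ring
    · refine hterm.trans ?_
      calc 2 * C * B * (q ^ k) ^ 2 ≤ 2 * C * (B + 1) * (q ^ k * 1) := by
            rw [sq]
            gcongr
            linarith
        _ = _ := by ring

lemma moment_pos (hW : ContinuousOn (W n f) (Set.Ioo 0 1))
    (hpos : ∀ t ∈ Set.Ioo (0 : ℝ) 1, 0 < W n f t) (k : ℕ) : 0 < moment (W n f) k := by
  have hs : (1 / 2 : ℝ) ∈ Set.Ioo (0 : ℝ) 1 := by norm_num
  refine lt_of_lt_of_le (ENNReal.mul_pos ?_ (lintegral_Ioo_pos hW hpos hs).ne')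
    (pow_mul_le_moment hs k)
  rw [Ne, ENNReal.ofReal_eq_zero, not_le]
  positivity

lemma gam_density_ne_zero (hn : 2 ≤ n) (hW : ContinuousOn (W n f) (Set.Ioo 0 1))
    (hpos : ∀ t ∈ Set.Ioo (0 : ℝ) 1, 0 < W n f t) (k : ℕ) : gam n (density n f) k ≠ 0 := by
  have hn2 : (2 : ℝ) ≤ n := by exact_mod_cast hn
  have h1 : (0 : ℝ) < k + n - 1 := by
    have : (0 : ℝ) ≤ k := Nat.cast_nonneg k
    linarith
  rw [gam_density hn]
  refine mul_ne_zero ?_ (moment_pos hW hpos _).ne'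
  rw [Ne, ENNReal.ofReal_eq_zero, not_le]
  exact h1

lemma diagSummable_density (hn : 2 ≤ n) (hW : ContinuousOn (W n f) (Set.Ioo 0 1))
    (hpos : ∀ t ∈ Set.Ioo (0 : ℝ) 1, 0 < W n f t) : DiagSummable hn (density n f) := by
  intro τ hτ
  -- `τ` may be negative, whereas the bound for the terms requires a positive radius.
  obtain ⟨σ, hσ, hσ1⟩ := exists_between (max_lt hτ one_pos)
  obtain ⟨u, hu, hb⟩ := exists_term_bound hn hW hpos ((le_max_right _ _).trans_lt hσ) hσ1
  have hc : 0 ≤ ((n : ℝ) + 1) ^ 2 / cM n := div_nonneg (by positivity) (cM_pos hn).le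
  set c := ((n : ℝ) + 1) ^ 2 / cM n with hcdef
  refine ⟨fun k => (c + Real.sqrt c) * u k, hu.mul_left _, fun k x hx hxτ => ?_⟩
  obtain ⟨h1, h2⟩ := hb k (normSq x) (normSq_nonneg x) (hxτ.le.trans ((le_max_left _ _).trans hσ.le))
  have hu0 : 0 ≤ u k := (Real.sqrt_nonneg _).trans h1
  have hsc := Real.sqrt_nonneg c
  rw [kapDiag_density hn f k hx, Real.sqrt_mul hc, ← hcdef]
  constructor
  · nlinarith [mul_le_mul_of_nonneg_left h1 hsc, mul_nonneg hc hu0]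
  · nlinarith [mul_le_mul_of_nonneg_left h2 hc, mul_nonneg hsc hu0]

end Moments

end Kepler
end

theorem corollary5 (n : ℕ) (hn : 2 ≤ n) (f : ℝ → ℝ)
    (hf : ContDiffOn ℝ 2 f (Set.Ioo 0 1))
    (hpos : ∀ t ∈ Set.Ioo (0 : ℝ) 1, 0 < f t)
    (hpsh : Kepler.IsStrictlyPSH n (fun z => Real.log (1 / f (Kepler.normSq z)))) :
    (0 < Kepler.rho n (Kepler.ball n) ∧ Kepler.rho n (Kepler.ball n) < ⊤) ∧
    (∀ t ∈ Set.Ioo (0 : ℝ) 1, 0 < Kepler.W n f t) ∧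
    (∃ K, Kepler.IsBergmanKernel n
      (Kepler.weightMeasure n (fun z => f (Kepler.normSq z))) K) ∧
    ∀ K, Kepler.IsBergmanKernel n
        (Kepler.weightMeasure n (fun z => f (Kepler.normSq z))) K →
      ∀ z ∈ Kepler.ball n,
        Summable (Kepler.term n f (Kepler.normSq z)) ∧
        K z z = ((((n : ℝ) + 1) ^ 2 / Kepler.cM n *
          ∑' k, Kepler.term n f (Kepler.normSq z) k : ℝ) : ℂ) := by
  have hW := Kepler.continuousOn_W n hf
  have hWpos : ∀ t ∈ Set.Ioo (0 : ℝ) 1, 0 < Kepler.W n f t := fun t ht =>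
    Kepler.W_pos hn hf hpos hpsh ht
  have hS := Kepler.diagSummable_density hn hW hWpos
  have hker := Kepler.isBergmanKernel_ker (Kepler.measurable_density n hf)
    (Kepler.gam_density_ne_zero hn hW hWpos) hS
  rw [Kepler.weightMeasure_eq hn hf hpos hpsh]
  refine ⟨?_, hWpos, ⟨_, hker⟩, fun K hK z hz => ?_⟩
  · rw [Kepler.rho_eq, MeasureTheory.Measure.smul_apply, smul_eq_mul, Kepler.mu_ball]
    have h0 : 0 < ((n : ℝ) + 1) ^ 2 := by positivity
    exact ⟨ENNReal.mul_pos (ENNReal.ofReal_pos.2 h0).ne' (Kepler.mu_univ_pos (by omega)).ne',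
      ENNReal.mul_lt_top ENNReal.ofReal_lt_top (Kepler.mu_univ_lt_top hn)⟩
  · have hc : ((n : ℝ) + 1) ^ 2 / Kepler.cM n ≠ 0 :=
      (div_pos (by positivity) (Kepler.cM_pos hn)).ne'
    obtain ⟨h1, h2⟩ := Kepler.ker_self hS hz
    simp only [Kepler.kapDiag_density hn f _ hz] at h1
    refine ⟨(summable_mul_left_iff hc).1 h1.summable, ?_⟩
    -- The diagonals of two kernels are conjugate to each other, and that of `ker` is real.
    rw [hK.apply_self_eq hker hz, h2, Complex.conj_ofReal, ← tsum_mul_left, h1.tsum_eq]
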